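/- Let $\mathcal H$ be the $\mathbb Q$-vector space with basis the words in two letters $a,b$, with the shuffle product $*$. For a word $w=ab^{r_1-1}\cdots ab^{r_k-1}$ put $L_w(z)=\sum_{0<n_1<\dots<n_k} n_1^{-r_1}\cdots n_k^{-r_k}z^{n_k}$ for $|z|<1$, and, if $w$ does not end with $a$, $\zeta(w)=\sum_{0<n_1<\dots<n_k} n_1^{-r_1}\cdots n_k^{-r_k}$; both are $1$ for the empty word. Let $\Omega$ be the open unit disc minus $]-1,0]$. The map $w\mapsto L_w$ extends uniquely to a morphism $h\mapsto L_h$ from $(\mathcal H,*)$ to the holomorphic functions on $\Omega$ with $L_b(z)=\log z$, and $w\mapsto \zeta(w)$ extends uniquely to morphisms $\zeta,\zeta^+,\zeta^-:(\mathcal H,*)\to\mathbb C$ that vanish at $b$ and satisfy $\zeta(a)=0$, $\zeta^{\pm}(a)=\pm i\pi$. Let $\rho=e^{i\pi/3}$; the value $L_h(\rho^{\pm1})$ is the limit of $L_h(z)$ for $z\to\rho^{\pm1}$ in $\Omega$. Let $\Gamma$ be the pro-unipotent (Malcev) completion over $\mathbb Q$ of the free group on two generators, i.e. the group of group-like series $g=\sum_w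 w(g)\,w$ in the non-commutative formal power series in two primitive variables $\alpha,\beta$ (corresponding to $a,b$). Its algebra of regular functions $\mathbb Q[\Gamma]$ is identified with $(\mathcal H,*)$, a word $w$ being the coefficient function $g\mapsto w(g)$. For a subset $S\subset\Gamma$ let $\mathbb Q[S]$ be the space of the restrictions to $S$ of the elements of $\mathbb Q[\Gamma]$. Let $\sigma,\tau$ be the linear maps $\mathcal H\to\mathcal H$ that are anti-multiplicative for concatenation, with $\sigma(a)=b$, $\sigma(b)=a$, $\tau(a)=a+b$, $\tau(b)=-a$. They induce anti-automorphisms $\sigma,\tau$ of the group $\Gamma$ by $w(\sigma(g))=(\sigma(w))(g)$ and $w(\tau(g))=(\tau(w))(g)$; they satisfy $\sigma^2(g)=g$ and $\tau^3(g)=g^{-1}$. Put $$K=\{g\in\Gamma:\sigma(g)=g^{-1}\},\quad P=\{g\in\Gamma:\sigma(g)=g\},\quad L=\{g\in\Gamma:\tau(g)=g^{-1}\},\quad Q=\{g\,\tau(g):g\in\Gamma\}.$$ Each $\phi\in\mathbb Q[P]$ extends uniquely to a right $K$-invariant element $\Phi$ of $\mathbb Q[\Gamma]$, and one puts $L_\phi=L_\Phi$;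 and $\zeta(\phi):=\zeta(\hat\phi)$ does not depend on the choice of the element $\hat\phi$ of $\mathbb Q[\Gamma]$ that extends $\phi$. In the same way each $\psi\in\mathbb Q[Q]$ extends uniquely to a right $L$-invariant element $\Psi$ of $\mathbb Q[\Gamma]$, $L_\psi=L_\Psi$, and $\zeta^{\pm}(\psi):=\zeta^{\pm}(\hat\psi)$ does not depend on the element $\hat\psi$ of $\mathbb Q[\Gamma]$ that extends $\psi$. Put $(\sqcup\!\!\sqcup\,\phi)(p)=\phi(p^2)$ for $\phi\in\mathbb Q[P]$, $p\in P$, and $(\nabla\psi)(q)=\psi(q\,\tau(q))$ for $\psi\in\mathbb Q[Q]$, $q\in Q$; these belong to $\mathbb Q[P]$ and $\mathbb Q[Q]$. Theorem. For all $\phi\in\mathbb Q[P]$ and $\psi\in\mathbb Q[Q]$, $$\zeta(\phi)=L_{\sqcup\!\sqcup\phi}(1/2)\qquad\text{and}\qquad \zeta^{\pm}(\psi)=L_{\nabla\psi}(\rho^{\pm1}).$$ -/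

import Mathlib

namespace Polyzeta

/-! ### Words and the shuffle algebra -/

/-- The two letters. -/
inductive Letter
  | a
  | b
  deriving DecidableEq

instance : Fintype Letter := ⟨{.a, .b}, by intro x; cases x <;> simp⟩

/-- Words in the letters `a`, `b`. -/
abbrev Word := List Letter

/-- The rational vector space with basis the set of words. -/
abbrev H := Word →₀ ℚ

/-- A word as a basis vector of `H`. -/
noncomputable def word (w : Word) : H := Finsupp.single w 1

/-- Left concatenation with a letter, `w ↦ x w`. -/
noncomputable def consL (x : Letter) : H →ₗ[ℚ] H := Finsupp.lmapDomain ℚ ℚ (fun w => x :: w)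

/-- Right concatenation with a letter, `w ↦ w x`. -/
noncomputable def snocL (x : Letter) : H →ₗ[ℚ] H := Finsupp.lmapDomain ℚ ℚ (fun w => w ++ [x])

/-- The shuffle product of two words: the sum of all their interleavings. -/
noncomputable def shW : Word → Word → H
  | [], v => word v
  | x :: u, [] => word (x :: u)
  | x :: u, y :: v => consL x (shW u (y :: v)) + consL y (shW (x :: u) v)
termination_by u v => u.length + v.length

/-- The shuffle product on `H`. -/
noncomputable def shuffle : H →ₗ[ℚ] H →ₗ[ℚ] H :=
  Finsupp.linearCombination ℚ fun u => Finsupp.linearCombination ℚ fun v => shW u v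

/-- For a linear map `f` from the span of the letters to itself, `f x = ∑ y, f x y • y`, the image
`f(cₙ) ⋯ f(c₁)` of a word `c₁ ⋯ cₙ`. -/
noncomputable def antiW (f : Letter → Letter → ℚ) : Word → H
  | [] => word []
  | x :: w => ∑ y, f x y • snocL y (antiW f w)

/-- The anti-endomorphism (for concatenation) of `H` that extends `f`. -/
noncomputable def anti (f : Letter → Letter → ℚ) : H →ₗ[ℚ] H :=
  Finsupp.linearCombination ℚ (antiW f)

/-- `σ(a) = b`, `σ(b) = a`. -/
def sigmaMat : Letter → Letter → ℚ
  | .a, .a => 0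
  | .a, .b => 1
  | .b, .a => 1
  | .b, .b => 0

/-- `τ(a) = a + b`, `τ(b) = -a`. -/
def tauMat : Letter → Letter → ℚ
  | .a, .a => 1
  | .a, .b => 1
  | .b, .a => -1
  | .b, .b => 0

/-- `x ↦ -x` on letters; the corresponding anti-endomorphism `c₁ ⋯ cₙ ↦ (-1)ⁿ cₙ ⋯ c₁` is the
antipode. -/
def negMat (x y : Letter) : ℚ := if x = y then -1 else 0

/-- `∑ w' * f(w'')`, the sum running over the deconcatenations `w = w' w''`. -/
noncomputable def twistW (f : Letter → Letter → ℚ) (w : Word) : H :=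
  ∑ i ∈ Finset.range (w.length + 1), shuffle (word (w.take i)) (anti f (word (w.drop i)))

/-- The composite of deconcatenation, `id ⊗ f` and the shuffle product. -/
noncomputable def twist (f : Letter → Letter → ℚ) : H →ₗ[ℚ] H :=
  Finsupp.linearCombination ℚ (twistW f)

/-! ### Elementary identities in the shuffle algebra -/

@[simp] theorem consL_word (x : Letter) (w : Word) : consL x (word w) = word (x :: w) := by
  simp [consL, word, Finsupp.lmapDomain_apply]

@[simp] theorem snocL_word (x : Letter) (w : Word) : snocL x (word w) = word (w ++ [x]) := by
  simp [snocL, word, Finsupp.lmapDomain_apply]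

@[simp] theorem shW_nil_left (v : Word) : shW [] v = word v := by rw [shW]

@[simp] theorem shW_nil_right (u : Word) : shW u [] = word u := by cases u <;> rw [shW]

theorem shW_cons (x y : Letter) (u v : Word) :
    shW (x :: u) (y :: v) = consL x (shW u (y :: v)) + consL y (shW (x :: u) v) := by
  rw [shW]

@[simp] theorem shuffle_word (u v : Word) : shuffle (word u) (word v) = shW u v := by
  simp [shuffle, word]

@[simp] theorem anti_word (f : Letter → Letter → ℚ) (w : Word) : anti f (word w) = antiW f w := by
  simp [anti, word]

/-- Linear maps on `H` agree if they agree on words. -/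
theorem H_ext {M : Type*} [AddCommMonoid M] [Module ℚ M] {f g : H →ₗ[ℚ] M}
    (h : ∀ w, f (word w) = g (word w)) : f = g := by
  apply Finsupp.lhom_ext'
  intro w
  apply LinearMap.ext_ring
  exact h w

/-- Bilinear maps on `H` agree if they agree on words. -/
theorem H_ext₂ {M : Type*} [AddCommMonoid M] [Module ℚ M] {f g : H →ₗ[ℚ] H →ₗ[ℚ] M}
    (h : ∀ u v, f (word u) (word v) = g (word u) (word v)) : f = g :=
  H_ext fun u => H_ext fun v => h u v

theorem shuffle_consL (x y : Letter) (h k : H) :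
    shuffle (consL x h) (consL y k) =
      consL x (shuffle h (consL y k)) + consL y (shuffle (consL x h) k) := by
  have : (shuffle.compl₁₂ (consL x) (consL y)) =
      ((shuffle.compl₁₂ LinearMap.id (consL y)).compr₂ (consL x)) +
      ((shuffle.compl₁₂ (consL x) LinearMap.id).compr₂ (consL y)) := by
    apply H_ext₂
    intro u v
    simp [shW_cons]
  simpa using congrArg (fun F => F h k) this

theorem consL_snocL (x y : Letter) (h : H) : consL x (snocL y h) = snocL y (consL x h) := by
  have : consL x ∘ₗ snocL y = snocL y ∘ₗ consL x := H_ext fun w => by simp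
  simpa using congrArg (fun F => F h) this

@[simp] theorem shuffle_nil_left (h : H) : shuffle (word []) h = h := by
  have : shuffle (word []) = LinearMap.id := H_ext fun w => by simp
  rw [this]; rfl

@[simp] theorem shuffle_nil_right (h : H) : shuffle h (word []) = h := by
  have : shuffle.flip (word []) = LinearMap.id := H_ext fun w => by simp
  simpa using congrArg (fun F => F h) this

/-- The recursion of the shuffle product through last letters. -/
theorem shW_snoc (u v : Word) (x y : Letter) :
    shW (u ++ [x]) (v ++ [y]) =
      snocL x (shW u (v ++ [y])) + snocL y (shW (u ++ [x]) v) := by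
  induction u generalizing v with
  | nil =>
    induction v with
    | nil => simp [shW_cons, add_comm]
    | cons z v ih =>
      have e : shW [x] (v ++ [y]) = snocL x (word (v ++ [y])) + snocL y (shW [x] v) := by
        simpa using ih
      simp only [List.nil_append, List.cons_append, shW_cons, shW_nil_left, consL_word, map_add,
        snocL_word, e, consL_snocL]
      abel
  | cons t u ihu =>
    induction v with
    | nil =>
      have e := ihu []
      simp only [List.nil_append, List.cons_append, shW_cons, shW_nil_right, consL_word, map_add,
        snocL_word] at e ⊢
      rw [e]
      simp only [map_add, consL_snocL, consL_word]
      abel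
    | cons z v ihv =>
      have e1 := ihu (z :: v)
      simp only [List.cons_append] at e1 ihv ⊢
      rw [shW_cons, e1, ihv, shW_cons, shW_cons]
      simp only [map_add, consL_snocL]
      abel

theorem shuffle_snocL (x y : Letter) (h k : H) :
    shuffle (snocL x h) (snocL y k) =
      snocL x (shuffle h (snocL y k)) + snocL y (shuffle (snocL x h) k) := by
  have : (shuffle.compl₁₂ (snocL x) (snocL y)) =
      ((shuffle.compl₁₂ LinearMap.id (snocL y)).compr₂ (snocL x)) +
      ((shuffle.compl₁₂ (snocL x) LinearMap.id).compr₂ (snocL y)) := by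
    apply H_ext₂
    intro u v
    simp [shW_snoc]
  simpa using congrArg (fun F => F h k) this

theorem shW_comm (u v : Word) : shW u v = shW v u := by
  induction u generalizing v with
  | nil => simp
  | cons x u ihu =>
    induction v with
    | nil => simp
    | cons y v ihv => rw [shW_cons, shW_cons, ihu, ihv, add_comm]

theorem shuffle_comm (h k : H) : shuffle h k = shuffle k h := by
  have : shuffle = shuffle.flip := H_ext₂ fun u v => by simp [shW_comm u v]
  exact congrArg (fun F => F h k) this

theorem shuffle_assoc_word (u v w : Word) :
    shuffle (shW u v) (word w) = shuffle (word u) (shW v w) := by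
  induction u generalizing v w with
  | nil => simp
  | cons x u ihu =>
    induction v generalizing w with
    | nil => simp
    | cons y v ihv =>
      induction w with
      | nil => simp
      | cons z w ihw =>
        have e1 := ihu (y :: v) (z :: w)
        have e2 := ihv (z :: w)
        have l : shuffle (shW (x :: u) (y :: v)) (word (z :: w)) =
            consL x (shuffle (shW u (y :: v)) (word (z :: w))) +
            consL y (shuffle (shW (x :: u) v) (word (z :: w))) +
            consL z (shuffle (shW (x :: u) (y :: v)) (word w)) := by
          rw [shW_cons, ← consL_word z w]
          simp only [map_add, LinearMap.add_apply, shuffle_consL]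
          abel
        have r : shuffle (word (x :: u)) (shW (y :: v) (z :: w)) =
            consL x (shuffle (word u) (shW (y :: v) (z :: w))) +
            consL y (shuffle (word (x :: u)) (shW v (z :: w))) +
            consL z (shuffle (word (x :: u)) (shW (y :: v) w)) := by
          rw [shW_cons, ← consL_word x u]
          simp only [map_add, shuffle_consL]
          abel
        rw [l, r, e1, e2, ihw]

theorem shuffle_assoc (h k l : H) : shuffle (shuffle h k) l = shuffle h (shuffle k l) := by
  have : ∀ u, shuffle ∘ₗ shuffle (word u) = (LinearMap.llcomp ℚ H H H (shuffle (word u))) ∘ₗ shuffle :=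
    fun u => H_ext₂ fun v w => by simpa using shuffle_assoc_word u v w
  have h2 : (shuffle.flip l) ∘ₗ (shuffle.flip k) = shuffle.flip (shuffle k l) :=
    H_ext fun u => by
      have := congrArg (fun F => F k l) (this u)
      simpa using this
  simpa using congrArg (fun F => F h) h2

theorem antiW_shuffle (f : Letter → Letter → ℚ) (u v : Word) :
    anti f (shW u v) = shuffle (antiW f u) (antiW f v) := by
  have key : ∀ (x : Letter) (h : H), anti f (consL x h) = ∑ y, f x y • snocL y (anti f h) := by
    intro x h
    have : anti f ∘ₗ consL x = ∑ y, f x y • (snocL y ∘ₗ anti f) :=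
      H_ext fun w => by simp [antiW]
    simpa using congrArg (fun F => F h) this
  induction u generalizing v with
  | nil => simp [antiW]
  | cons x u ihu =>
    induction v with
    | nil => simp [antiW]
    | cons y v ihv =>
      rw [shW_cons, map_add, key, key, ihu, ihv]
      simp only [antiW, map_sum, map_smul, LinearMap.sum_apply, LinearMap.smul_apply,
        shuffle_snocL, smul_add, Finset.sum_add_distrib, Finset.smul_sum]
      congr 1
      rw [Finset.sum_comm]
      exact Finset.sum_congr rfl fun _ _ => Finset.sum_congr rfl fun _ _ => smul_comm _ _ _

/-! ### Non-commutative formal power series -/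

/-- The linear form on `H` with prescribed values on words: the pairing of `H` with the
non-commutative formal power series `∑ f(w) w`. -/
noncomputable def pair (f : Word → ℚ) : H →ₗ[ℚ] ℚ := Finsupp.linearCombination ℚ f

/-- The coefficients of the product of two non-commutative formal power series. -/
def conv (f g : Word → ℚ) (w : Word) : ℚ :=
  ∑ i ∈ Finset.range (w.length + 1), f (w.take i) * g (w.drop i)

@[simp] theorem pair_word (f : Word → ℚ) (w : Word) : pair f (word w) = f w := by
  simp [pair, word]

theorem pair_consL (f : Word → ℚ) (x : Letter) (h : H) :
    pair f (consL x h) = pair (fun w => f (x :: w)) h := by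
  have : pair f ∘ₗ consL x = pair (fun w => f (x :: w)) := H_ext fun w => by simp
  simpa using congrArg (fun F => F h) this

theorem conv_nil (f g : Word → ℚ) : conv f g [] = f [] * g [] := by simp [conv]

theorem conv_cons (f g : Word → ℚ) (x : Letter) (w : Word) :
    conv f g (x :: w) = conv (fun w => f (x :: w)) g w + f [] * g (x :: w) := by
  simp [conv, Finset.sum_range_succ']

theorem conv_add_left (f f' g : Word → ℚ) (w : Word) :
    conv (fun w => f w + f' w) g w = conv f g w + conv f' g w := by
  simp [conv, add_mul, Finset.sum_add_distrib]

theorem conv_smul_left (c : ℚ) (f g : Word → ℚ) (w : Word) :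
    conv (fun w => c * f w) g w = c * conv f g w := by
  simp [conv, mul_assoc, Finset.mul_sum]

theorem conv_assoc (f g h : Word → ℚ) (w : Word) :
    conv (conv f g) h w = conv f (conv g h) w := by
  induction w generalizing f with
  | nil => simp [conv_nil, mul_assoc]
  | cons x w ih =>
    rw [conv_cons, conv_cons f]
    have : (fun w => conv f g (x :: w)) =
        fun w => conv (fun w => f (x :: w)) g w + f [] * g (x :: w) := by
      funext w; rw [conv_cons]
    rw [this, conv_add_left, conv_smul_left, conv_cons g, conv_nil, ← ih]
    ring

theorem pair_conv_consL (f g : Word → ℚ) (x : Letter) (h : H) :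
    pair (conv f g) (consL x h) =
      pair (conv (fun w => f (x :: w)) g) h + f [] * pair g (consL x h) := by
  have : pair (conv f g) ∘ₗ consL x =
      pair (conv (fun w => f (x :: w)) g) + f [] • (pair g ∘ₗ consL x) :=
    H_ext fun w => by simp [conv_cons]
  simpa using congrArg (fun F => F h) this

/-- Deconcatenation is compatible with the shuffle product. -/
theorem pair_conv_shW (f g : Word → ℚ) (u v : Word) :
    pair (conv f g) (shW u v) =
      ∑ i ∈ Finset.range (u.length + 1), ∑ j ∈ Finset.range (v.length + 1),
        pair f (shW (u.take i) (v.take j)) * pair g (shW (u.drop i) (v.drop j)) := by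
  induction u generalizing f v with
  | nil => simp [conv]
  | cons x u ihu =>
    induction v generalizing f with
    | nil => simp [conv]
    | cons y v ihv =>
      rw [shW_cons, map_add, pair_conv_consL, pair_conv_consL, ihu, ihv]
      have e : pair g (shW (x :: u) (y :: v)) =
        pair g (consL x (shW u (y :: v))) + pair g (consL y (shW (x :: u) v)) := by
          rw [shW_cons, map_add]
      simp only [List.length_cons, Finset.sum_range_succ' _ (u.length + 1),
        Finset.sum_range_succ' _ (v.length + 1), List.take_succ_cons, List.drop_succ_cons,
        List.take_zero, List.drop_zero, shW_nil_left, shW_nil_right, pair_word, shW_cons,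
        map_add, pair_consL, add_mul, Finset.sum_add_distrib] at e ⊢
      ring

/-- The pairing with the product of two series whose coefficients are multiplicative. -/
theorem conv_mul (f g : Word → ℚ) (hf : ∀ u v, pair f (shW u v) = f u * f v)
    (hg : ∀ u v, pair g (shW u v) = g u * g v) (u v : Word) :
    pair (conv f g) (shW u v) = conv f g u * conv f g v := by
  rw [pair_conv_shW]
  simp only [hf, hg, conv, Finset.sum_mul_sum]
  exact Finset.sum_congr rfl fun _ _ => Finset.sum_congr rfl fun _ _ => by ring

theorem pair_mul (f : Word → ℚ) (hf : ∀ u v, pair f (shW u v) = f u * f v) (h k : H) :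
    pair f (shuffle h k) = pair f h * pair f k := by
  have : shuffle.compr₂ (pair f) = (LinearMap.mul ℚ ℚ).compl₁₂ (pair f) (pair f) :=
    H_ext₂ fun u v => by simp [hf]
  simpa using congrArg (fun F => F h k) this

/-! ### The group -/

/-- The pro-unipotent (Malcev) completion of the free group on two generators, through its group of
rational points: the group-like elements of the complete Hopf algebra of non-commutative formal
power series in two primitive variables. The coefficient of `u ⊗ v` in the coproduct of `g` is
the value of `g` on the shuffle product of `u` and `v`, so that `g` is group-like if and only if
its constant term is `1` and `g(u * v) = g(u) g(v)` for all words. -/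
@[ext] structure Gam where
  /-- The coefficients of the series. -/
  coeff : Word → ℚ
  coeff_nil : coeff [] = 1
  coeff_shuffle : ∀ u v, pair coeff (shW u v) = coeff u * coeff v

/-- The function on the group that an element of `H` defines: a word is sent to the corresponding
coefficient. These are the regular functions on the group. -/
noncomputable def ev (h : H) (g : Gam) : ℚ := pair g.coeff h

/-- The transformation of the group that an anti-endomorphism of the Hopf algebra `H` induces:
`w(g^f) = f(w)(g)`. -/
noncomputable def Gam.act (f : Letter → Letter → ℚ) (g : Gam) : Gam where
  coeff w := ev (antiW f w) g
  coeff_nil := by simp [antiW, ev, g.coeff_nil]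
  coeff_shuffle u v := by
    have : pair (fun w => ev (antiW f w) g) = pair g.coeff ∘ₗ anti f :=
      H_ext fun w => by simp [ev]
    rw [this, LinearMap.comp_apply, antiW_shuffle, pair_mul _ g.coeff_shuffle]
    rfl

noncomputable instance : Mul Gam where
  mul g h :=
    { coeff := conv g.coeff h.coeff
      coeff_nil := by simp [conv_nil, g.coeff_nil, h.coeff_nil]
      coeff_shuffle := conv_mul _ _ g.coeff_shuffle h.coeff_shuffle }

noncomputable instance : One Gam where
  one :=
    { coeff := fun w => if w = [] then 1 else 0
      coeff_nil := by simp
      coeff_shuffle := by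
        intro u v
        cases u with
        | nil => simp
        | cons x u =>
          cases v with
          | nil => simp
          | cons y v =>
            have z : ∀ h : H, pair (fun _ => (0 : ℚ)) h = 0 := by
              intro h; simp [pair, Finsupp.linearCombination_apply]
            rw [shW_cons, map_add, pair_consL, pair_consL]
            simp [z] }

/-- The inverse is given by the antipode. -/
noncomputable instance : Inv Gam where
  inv g := g.act negMat

theorem mul_coeff (g h : Gam) (w : Word) : (g * h).coeff w = conv g.coeff h.coeff w := rfl

theorem one_coeff (w : Word) : (1 : Gam).coeff w = if w = [] then 1 else 0 := rfl

theorem act_coeff (f : Letter → Letter → ℚ) (g : Gam) (w : Word) :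
    (g.act f).coeff w = ev (antiW f w) g := rfl

theorem ev_word (w : Word) (g : Gam) : ev (word w) g = g.coeff w := by simp [ev]

theorem ev_shuffle (h k : H) (g : Gam) : ev (shuffle h k) g = ev h g * ev k g :=
  pair_mul _ g.coeff_shuffle h k

theorem ev_act (f : Letter → Letter → ℚ) (h : H) (g : Gam) : ev h (g.act f) = ev (anti f h) g := by
  have : pair (g.act f).coeff = pair g.coeff ∘ₗ anti f :=
    H_ext fun w => by simp [act_coeff, ev]
  exact congrArg (fun F => F h) this

/-- The value of `twist f h` at `g` is the value of `h` at `g g^f`. -/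
theorem ev_twist (f : Letter → Letter → ℚ) (h : H) (g : Gam) :
    ev (twist f h) g = ev h (g * g.act f) := by
  have : pair g.coeff ∘ₗ twist f = pair (g * g.act f).coeff := by
    apply H_ext
    intro w
    have e : twist f (word w) = twistW f w := by simp [twist, word]
    rw [LinearMap.comp_apply, e, twistW, map_sum, pair_word, mul_coeff, conv]
    refine Finset.sum_congr rfl fun i _ => ?_
    rw [pair_mul _ g.coeff_shuffle, pair_word, act_coeff, anti_word]
    rfl
  exact congrArg (fun F => F h) this

/-- The antipode identity. -/
theorem antipode_aux (p w : Word) (y : Letter) :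
    ∑ i ∈ Finset.range (w.length + 1),
      shuffle (word (p ++ [y] ++ w.take i)) (antiW negMat (w.drop i)) =
      snocL y (shuffle (word p) (antiW negMat w)) := by
  induction w generalizing p y with
  | nil => simp [antiW]
  | cons x w ih =>
    have a : antiW negMat (x :: w) = - snocL x (antiW negMat w) := by
      simp [antiW, negMat, ite_smul]
    have e := ih (p ++ [y]) x
    simp only [List.append_assoc, List.cons_append, List.nil_append] at e
    simp only [List.length_cons, Finset.sum_range_succ', List.take_succ_cons, List.drop_succ_cons,
      List.take_zero, List.drop_zero, List.append_assoc, List.cons_append, List.nil_append] at e ⊢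
    rw [e, a, ← snocL_word y p, map_neg, map_neg, map_neg, shuffle_snocL]
    abel

theorem twistW_neg (w : Word) : twistW negMat w = if w = [] then word [] else 0 := by
  cases w with
  | nil => simp [twistW, antiW]
  | cons x w =>
    have a : antiW negMat (x :: w) = - snocL x (antiW negMat w) := by
      simp [antiW, negMat, ite_smul]
    have e := antipode_aux [] w x
    simp only [List.nil_append, List.cons_append] at e
    simp only [twistW, List.length_cons, anti_word]
    rw [Finset.sum_range_succ']
    simp only [List.take_succ_cons, List.drop_succ_cons, List.take_zero, List.drop_zero, e, a]
    simp

noncomputable instance : Group Gam :=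
  Group.ofRightAxioms
    (by
      intro g h k
      ext w
      simp only [mul_coeff]
      exact conv_assoc _ _ _ w)
    (by
      intro g
      ext w
      rw [mul_coeff, conv, Finset.sum_eq_single w.length]
      · simp [one_coeff]
      · intro i hi hne
        have : i < w.length := by
          have := Finset.mem_range.1 hi
          omega
        rw [one_coeff, if_neg, mul_zero]
        simpa using this
      · simp)
    (by
      intro g
      ext w
      have e := ev_twist negMat (word w) g
      rw [ev_word] at e
      have t : twist negMat (word w) = twistW negMat w := by simp [twist, word]
      change (g * g.act negMat).coeff w = _
      rw [← e, t, twistW_neg, one_coeff]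
      split_ifs
      · rw [ev_word, g.coeff_nil]
      · simp [ev])

/-- The right-hand analogue of `pair_conv_consL`. -/
theorem pair_conv_snocL (f g : Word → ℚ) (x : Letter) (h : H) :
    pair (conv f g) (snocL x h) =
      pair (conv f fun w => g (w ++ [x])) h + g [] * pair f (snocL x h) := by
  have c : ∀ w, conv f g (w ++ [x]) =
      conv f (fun w => g (w ++ [x])) w + g [] * f (w ++ [x]) := by
    intro w
    rw [conv, List.length_append, List.length_singleton, Finset.sum_range_succ, conv]
    congr 1
    · refine Finset.sum_congr rfl fun i hi => ?_
      have hi : i ≤ w.length := by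
        have := Finset.mem_range.1 hi
        omega
      rw [List.take_append_of_le_length hi, List.drop_append_of_le_length hi]
    · have l : w.length + 1 = (w ++ [x]).length := by simp
      rw [l, List.take_length, List.drop_length, mul_comm]
  have : pair (conv f g) ∘ₗ snocL x =
      pair (conv f fun w => g (w ++ [x])) + g [] • (pair f ∘ₗ snocL x) :=
    H_ext fun w => by simp [c]
  simpa using congrArg (fun F => F h) this

theorem pair_snocL (f : Word → ℚ) (x : Letter) (h : H) :
    pair f (snocL x h) = pair (fun w => f (w ++ [x])) h := by
  have : pair f ∘ₗ snocL x = pair (fun w => f (w ++ [x])) := H_ext fun w => by simp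
  simpa using congrArg (fun F => F h) this

theorem pair_antiW_conv (m : Letter → Letter → ℚ) (f g : Word → ℚ) (w : Word) :
    pair (conv f g) (antiW m w) =
      conv (fun w => pair g (antiW m w)) (fun w => pair f (antiW m w)) w := by
  induction w generalizing g with
  | nil => simp [antiW, conv_nil, mul_comm]
  | cons x w ih =>
    have s : ∀ (s : Finset Letter) (F : Letter → Word → ℚ) (k : Word → ℚ) (w : Word),
        conv (fun w => ∑ y ∈ s, m x y * F y w) k w = ∑ y ∈ s, m x y * conv (F y) k w := by
      intro s F k w
      simp only [conv, Finset.sum_mul, Finset.mul_sum, mul_assoc]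
      rw [Finset.sum_comm]
    rw [conv_cons]
    have q : ∀ y, pair (conv f g) (snocL y (antiW m w)) =
        conv (fun w => pair (fun w => g (w ++ [y])) (antiW m w)) (fun w => pair f (antiW m w)) w +
          g [] * pair f (snocL y (antiW m w)) := by
      intro y
      rw [pair_conv_snocL, ih]
    simp only [antiW, map_sum, map_smul, smul_eq_mul, q, pair_word, s, mul_add,
      Finset.sum_add_distrib, Finset.mul_sum, pair_snocL g]
    congr 1
    exact Finset.sum_congr rfl fun _ _ => by ring

theorem act_mul (m : Letter → Letter → ℚ) (g h : Gam) : (g * h).act m = h.act m * g.act m := by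
  ext w
  exact pair_antiW_conv m g.coeff h.coeff w

theorem act_one (m : Letter → Letter → ℚ) : (1 : Gam).act m = 1 := by
  have h := act_mul m 1 1
  rw [mul_one] at h
  exact left_eq_mul.1 h

theorem act_inv (m : Letter → Letter → ℚ) (g : Gam) : (g⁻¹).act m = (g.act m)⁻¹ := by
  apply eq_inv_of_mul_eq_one_left
  rw [← act_mul, mul_inv_cancel, act_one]

/-- The anti-involution of the group induced by `σ`. -/
noncomputable def sigma : Gam → Gam := Gam.act sigmaMat

/-- The anti-automorphism of the group induced by `τ`. -/
noncomputable def tau : Gam → Gam := Gam.act tauMat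

/-- The subgroup of all `g` with `g^f = g⁻¹`. -/
noncomputable def invertedBy (f : Letter → Letter → ℚ) : Subgroup Gam where
  carrier := {g | g.act f = g⁻¹}
  mul_mem' := by
    intro g h hg hh
    simp only [Set.mem_ofPred_eq] at *
    rw [act_mul, hg, hh, mul_inv_rev]
  one_mem' := by simp [act_one]
  inv_mem' := by
    intro g hg
    simp only [Set.mem_ofPred_eq] at *
    rw [act_inv, hg]

/-- `K = {g | σ(g) = g⁻¹}`. -/
noncomputable def K : Subgroup Gam := invertedBy sigmaMat

/-- `L = {g | τ(g) = g⁻¹}`. -/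
noncomputable def L : Subgroup Gam := invertedBy tauMat

/-- The symmetric space `P = {p | σ(p) = p}`. -/
def P : Set Gam := {p | sigma p = p}

/-- The space `Q`, image of `g ↦ g τ(g)`. -/
def Q : Set Gam := Set.range fun g => g * tau g

/-- The element `h` of `H` extends the function `φ`, given on the subset `S` of the group. -/
def Extends {S : Set Gam} (φ : S → ℚ) (h : H) : Prop := ∀ s : S, ev h s = φ s

/-- The space of regular functions on `S`: the restrictions to `S` of the regular functions on the
group. -/
noncomputable def Reg (S : Set Gam) : Submodule ℚ (S → ℚ) where
  carrier := {φ | ∃ h : H, Extends φ h}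
  add_mem' := by
    rintro φ ψ ⟨h, hh⟩ ⟨k, hk⟩
    refine ⟨h + k, fun s => ?_⟩
    simp only [Pi.add_apply, ← hh s, ← hk s, ev, map_add]
  zero_mem' := ⟨0, fun s => by simp [ev]⟩
  smul_mem' := by
    rintro c φ ⟨h, hh⟩
    refine ⟨c • h, fun s => ?_⟩
    simp only [Pi.smul_apply, ← hh s, ev, map_smul]

/-- The regular function on the group defined by `h` is invariant under right translations by the
elements of `M`. -/
def RightInvariant (M : Subgroup Gam) (h : H) : Prop := ∀ g, ∀ m ∈ M, ev h (g * m) = ev h g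

theorem P_sq_mem (p : P) : (p : Gam) ^ 2 ∈ P := by
  have hp : Gam.act sigmaMat p = p := p.2
  change Gam.act sigmaMat _ = _
  rw [pow_two, act_mul, hp]

theorem Q_mem (q : Q) : (q : Gam) * tau q ∈ Q := ⟨q, rfl⟩

/-- The operator `φ ↦ (p ↦ φ(p²))` on the regular functions on `P`. -/
noncomputable def squareOp (φ : Reg P) : Reg P :=
  ⟨fun p => φ.1 ⟨(p : Gam) ^ 2, P_sq_mem p⟩, by
    obtain ⟨φ, h, hh⟩ := φ
    refine ⟨twist sigmaMat h, fun p => ?_⟩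
    have hp : Gam.act sigmaMat p = p := p.2
    rw [ev_twist, hp, ← pow_two]
    exact hh ⟨_, P_sq_mem p⟩⟩

/-- The operator `ψ ↦ (q ↦ ψ(q τ(q)))` on the regular functions on `Q`. -/
noncomputable def nablaOp (ψ : Reg Q) : Reg Q :=
  ⟨fun q => ψ.1 ⟨(q : Gam) * tau q, Q_mem q⟩, by
    obtain ⟨ψ, h, hh⟩ := ψ
    refine ⟨twist tauMat h, fun q => ?_⟩
    rw [ev_twist]
    exact hh ⟨_, Q_mem q⟩⟩

/-! ### Polylogarithms and polyzeta values -/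

/-- The sequence `(1 + t₁, …, 1 + tₖ)` attached to the word `a b^t₁ a b^t₂ ⋯ a b^tₖ`. -/
def exponents : Word → List ℕ
  | [] => []
  | .a :: w => (1 + (w.takeWhile (· = .b)).length) :: exponents w
  | .b :: w => exponents w

/-- The index set of all `0 < n₁ < ⋯ < nₖ`. -/
abbrev Chain (k : ℕ) := {n : Fin k → ℕ // StrictMono n ∧ ∀ i, 0 < n i}

/-- The series `∑ n₁^(-r₁) ⋯ nₖ^(-rₖ) z^nₖ` over `0 < n₁ < ⋯ < nₖ`, where `(r₁, …, rₖ)` is the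
sequence attached to `w`. The largest index `nₖ` is written as a supremum, which is `0` for
`k = 0`. -/
noncomputable def polylogSeries (w : Word) (z : ℂ) : ℂ :=
  ∑' n : Chain (exponents w).length,
    (∏ i, ((n.1 i : ℂ) ^ (exponents w).get i)⁻¹) * z ^ Finset.univ.sup n.1

/-- The series `∑ n₁^(-r₁) ⋯ nₖ^(-rₖ)` over `0 < n₁ < ⋯ < nₖ`, where `(r₁, …, rₖ)` is the
sequence attached to `w`. -/
noncomputable def zetaSeries (w : Word) : ℂ :=
  ∑' n : Chain (exponents w).length, ∏ i, ((n.1 i : ℂ) ^ (exponents w).get i)⁻¹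

/-- The linear extension to `H` of a function on words. -/
noncomputable def linExt (F : Word → ℂ) : H →ₗ[ℚ] ℂ := Finsupp.linearCombination ℚ F

/-- The components `hₖ` in the expansion `w = ∑ hₖ * xᵏ` (shuffle products with the words
`xᵏ = x ⋯ x`) of a word `w`, where no word in `hₖ` starts with the letter `x`. -/
noncomputable def stripW (x : Letter) (k : ℕ) (w : Word) : H :=
  match w.dropWhile (· = x) with
  | [] => if w.length = k then word [] else 0
  | y :: v =>
    if k ≤ (w.takeWhile (· = x)).length then
      (-1 : ℚ) ^ ((w.takeWhile (· = x)).length - k) •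
        consL y (shW (List.replicate ((w.takeWhile (· = x)).length - k) x) v)
    else 0

/-- Reversal of words. -/
noncomputable def rev : H →ₗ[ℚ] H := Finsupp.lmapDomain ℚ ℚ List.reverse

/-- The components `hₖ` in the expansion `h = ∑ hₖ * xᵏ`, where no word in `hₖ` starts with `x`. -/
noncomputable def stripFirst (x : Letter) (k : ℕ) : H →ₗ[ℚ] H :=
  Finsupp.linearCombination ℚ (stripW x k)

/-- The components `hₖ` in the expansion `h = ∑ hₖ * xᵏ`, where no word in `hₖ` ends with `x`. -/
noncomputable def stripLast (x : Letter) (k : ℕ) : H →ₗ[ℚ] H := rev ∘ₗ stripFirst x k ∘ₗ rev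

/-- The polylogarithmic function `L_h(z)`, on the open unit disc minus `]-1, 0]`: the extension by
`L_b(z) = log z` of the series on words that do not start with `b` to a morphism for the shuffle
product. If `h = ∑ hₖ * bᵏ`, where no word in `hₖ` starts with `b` and `bᵏ` is the word
`b ⋯ b`, then `L_h(z) = ∑ L_{hₖ}(z) (log z)^k / k!`. -/
noncomputable def polylog (z : ℂ) : H →ₗ[ℚ] ℂ :=
  linExt fun w => ∑ k ∈ Finset.range (w.length + 1),
    linExt (fun w => polylogSeries w z) (stripFirst .b k (word w)) *
      (Complex.log z ^ k / k.factorial)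

/-- The regularized value on `h₀ = ∑ hₖ * aᵏ`, where no word in `hₖ` ends with `a`, when `a` has
the value `c`: it is `∑ ζ(hₖ) cᵏ / k!`. -/
noncomputable def zetaRegA (c : ℂ) : H →ₗ[ℚ] ℂ :=
  linExt fun w => ∑ k ∈ Finset.range (w.length + 1),
    linExt zetaSeries (stripLast .a k (word w)) * (c ^ k / k.factorial)

/-- The polyzeta value, regularized by giving to `b` the value `0` and to `a` the value `c`: the
extension of the series on words that neither start with `b` nor end with `a` to a morphism for
the shuffle product. If `h = ∑ hₖ * bᵏ`, where no word in `hₖ` starts with `b`, then the value at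
`h` is the value at `h₀`. -/
noncomputable def zetaReg (c : ℂ) : H →ₗ[ℚ] ℂ := zetaRegA c ∘ₗ stripFirst .b 0

/-- The open unit disc minus `]-1, 0]`. -/
def Omega : Set ℂ := {z | ‖z‖ < 1 ∧ z ∈ Complex.slitPlane}

/-- `ρ = exp(iπ/3)`. -/
noncomputable def rho : ℂ := Complex.exp (Real.pi * Complex.I / 3)

/-- The polyzeta value `ζ(φ)` (for `c = 0`) or `ζ^±(φ)` (for `c = ± iπ`) of a regular function on
`S`: the value at a regular function on the group that extends `φ`. -/
noncomputable def zetaOn {S : Set Gam} (c : ℂ) (φ : Reg S) : ℂ :=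
  zetaReg c (Classical.choose φ.2)

/-- The polylogarithmic function `L_φ` of a regular function on `S`: it is `L_Φ` for the extension
`Φ` of `φ` that is invariant under right translations by `M`. -/
noncomputable def polylogOn {S : Set Gam} (M : Subgroup Gam) (φ : Reg S) (z : ℂ) : ℂ :=
  polylog z (Classical.epsilon fun Φ : H => RightInvariant M Φ ∧ Extends φ.1 Φ)

/-! ### The definitions through expansions give the only possible morphisms -/

theorem linExt_word (F : Word → ℂ) (w : Word) : linExt F (word w) = F w := by
  simp [linExt, word]

theorem stripFirst_word (x : Letter) (k : ℕ) (w : Word) :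
    stripFirst x k (word w) = stripW x k w := by
  simp [stripFirst, word]

theorem rev_word (w : Word) : rev (word w) = word w.reverse := by
  simp [rev, word, Finsupp.lmapDomain_apply]

theorem antiW_neg_replicate (x : Letter) (n : ℕ) :
    antiW negMat (List.replicate n x) = (-1 : ℚ) ^ n • word (List.replicate n x) := by
  induction n with
  | zero => simp [antiW]
  | succ n ih =>
    have a : antiW negMat (x :: List.replicate n x) =
        - snocL x (antiW negMat (List.replicate n x)) := by
      simp [antiW, negMat, ite_smul]
    rw [List.replicate_succ, a, ih, map_smul, snocL_word, ← List.replicate_succ',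
      List.replicate_succ, pow_succ]
    simp

theorem sum_replicate (x : Letter) (n : ℕ) :
    ∑ k ∈ Finset.range (n + 2), (-1 : ℚ) ^ (n + 1 - k) •
      shW (List.replicate k x) (List.replicate (n + 1 - k) x) = 0 := by
  have h := twistW_neg (List.replicate (n + 1) x)
  rw [if_neg (by simp), twistW, List.length_replicate] at h
  rw [← h]
  refine Finset.sum_congr rfl fun k hk => ?_
  have hk : k ≤ n + 1 := by
    have := Finset.mem_range.1 hk
    omega
  rw [List.take_replicate, List.drop_replicate, anti_word, antiW_neg_replicate, map_smul,
    shuffle_word, min_eq_left hk]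

theorem strip_aux (x y : Letter) (v : Word) (n : ℕ) :
    ∑ k ∈ Finset.range (n + 1), (-1 : ℚ) ^ (n - k) •
      shuffle (consL y (shW (List.replicate (n - k) x) v)) (word (List.replicate k x)) =
      word (List.replicate n x ++ y :: v) := by
  induction n with
  | zero => simp
  | succ n ih =>
    have z : ∑ k ∈ Finset.range (n + 2), (-1 : ℚ) ^ (n + 1 - k) •
        consL y (shuffle (shW (List.replicate (n + 1 - k) x) v) (word (List.replicate k x))) = 0 := by
      have e := congrArg (fun h => consL y (shuffle h (word v))) (sum_replicate x n)
      simp only [map_sum, map_smul, LinearMap.sum_apply, LinearMap.smul_apply, map_zero,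
        LinearMap.zero_apply] at e
      rw [← e]
      refine Finset.sum_congr rfl fun k _ => ?_
      rw [shuffle_comm, ← shuffle_word _ v, ← shuffle_assoc, shuffle_word]
    rw [Finset.sum_range_succ'] at z ⊢
    have e : ∀ k, shuffle (consL y (shW (List.replicate (n + 1 - (k + 1)) x) v))
          (word (List.replicate (k + 1) x)) =
        consL y (shuffle (shW (List.replicate (n + 1 - (k + 1)) x) v)
          (word (List.replicate (k + 1) x))) +
        consL x (shuffle (consL y (shW (List.replicate (n - k) x) v))
          (word (List.replicate k x))) := by
      intro k
      rw [List.replicate_succ, ← consL_word, shuffle_consL, Nat.add_sub_add_right]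
    have i := congrArg (consL x) ih
    simp only [map_sum, map_smul] at i
    simp only [e, smul_add, Finset.sum_add_distrib, List.replicate_zero, shuffle_nil_right] at z ⊢
    have r : ∀ k, n + 1 - (k + 1) = n - k := fun k => Nat.add_sub_add_right n 1 k
    simp only [r] at z ⊢
    rw [i, add_right_comm, z, zero_add, consL_word, List.replicate_succ, List.cons_append]

theorem takeWhile_eq_replicate (x : Letter) (w : Word) :
    w.takeWhile (· = x) = List.replicate (w.takeWhile (· = x)).length x := by
  rw [List.eq_replicate_iff]
  exact ⟨rfl, fun y hy => by simpa using List.mem_takeWhile_imp hy⟩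

/-- The expansion `w = ∑ hₖ * xᵏ`. -/
theorem strip_sum (x : Letter) (w : Word) :
    ∑ k ∈ Finset.range (w.length + 1), shuffle (stripW x k w) (word (List.replicate k x)) =
      word w := by
  have hw := List.takeWhile_append_dropWhile (p := (· = x)) (l := w)
  have ht := takeWhile_eq_replicate x w
  unfold stripW
  cases hd : w.dropWhile (· = x) with
  | nil =>
    rw [hd, List.append_nil] at hw
    rw [hw] at ht
    rw [Finset.sum_eq_single w.length]
    · simp [← ht]
    · intro k _ hk
      simp [Ne.symm hk]
    · simp
  | cons y v =>
    rw [hd] at hw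
    set n := (w.takeWhile (· = x)).length with hn
    have hl : n ≤ w.length := by
      have := congrArg List.length hw
      simp only [List.length_append] at this
      omega
    rw [← Finset.sum_subset (Finset.range_mono (Nat.succ_le_succ hl))]
    · rw [ht] at hw
      conv_rhs => rw [← hw]
      rw [← strip_aux x y v n]
      refine Finset.sum_congr rfl fun k hk => ?_
      have hk : k ≤ n := by
        have := Finset.mem_range.1 hk
        omega
      simp [hk]
    · intro k _ hk
      have hk : ¬ k ≤ n := by
        intro h
        exact hk (Finset.mem_range.2 (by omega))
      simp [hk]

theorem shW_letter_replicate (x : Letter) (n : ℕ) :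
    shW [x] (List.replicate n x) = (n + 1 : ℚ) • word (List.replicate (n + 1) x) := by
  induction n with
  | zero => simp
  | succ n ih =>
    rw [List.replicate_succ, shW_cons, shW_nil_left, ih, map_smul]
    simp only [consL_word, ← List.replicate_succ]
    push_cast
    module

theorem morphism_replicate (Φ : H →ₗ[ℚ] ℂ) (one : Φ (word []) = 1)
    (mul : ∀ h k, Φ (shuffle h k) = Φ h * Φ k) (x : Letter) (n : ℕ) :
    Φ (word (List.replicate n x)) = Φ (word [x]) ^ n / n.factorial := by
  induction n with
  | zero => simp [one]
  | succ n ih =>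
    have e := mul (word [x]) (word (List.replicate n x))
    rw [shuffle_word, shW_letter_replicate, map_smul, ih, Rat.smul_def] at e
    push_cast at e
    have h0 : (n : ℂ) + 1 ≠ 0 := by exact_mod_cast Nat.succ_ne_zero n
    have h1 : (n.factorial : ℂ) ≠ 0 := by exact_mod_cast n.factorial_ne_zero
    rw [Nat.factorial_succ]
    push_cast
    field_simp at e ⊢
    linear_combination e

/-- The words in the components of the expansion do not start with `x`. -/
theorem stripW_mem (x : Letter) (k : ℕ) (w : Word) :
    stripW x k w ∈ Submodule.span ℚ {h : H | ∃ w : Word, w.head? ≠ some x ∧ h = word w} := by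
  unfold stripW
  cases hd : w.dropWhile (· = x) with
  | nil =>
    dsimp only
    split_ifs
    · exact Submodule.subset_span ⟨[], by simp, rfl⟩
    · exact Submodule.zero_mem _
  | cons y v =>
    have hy : y ≠ x := by
      have := List.head_dropWhile_not (p := fun z => decide (z = x)) (l := w) (by rw [hd]; simp)
      simpa [hd] using this
    have c : ∀ h : H, consL y h ∈
        Submodule.span ℚ {h : H | ∃ w : Word, w.head? ≠ some x ∧ h = word w} := by
      intro h
      induction h using Finsupp.induction_linear with
      | zero => simp
      | add f g hf hg => rw [map_add]; exact Submodule.add_mem _ hf hg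
      | single u r =>
        have : (Finsupp.single u r : H) = r • word u := by simp [word]
        rw [this, map_smul, consL_word]
        exact Submodule.smul_mem _ _ (Submodule.subset_span ⟨y :: u, by simpa using hy, rfl⟩)
    dsimp only
    split_ifs
    · exact Submodule.smul_mem _ _ (c _)
    · exact Submodule.zero_mem _

/-- A morphism with the prescribed values is `L(z)`. -/
theorem polylog_unique (z : ℂ) (Φ : H →ₗ[ℚ] ℂ) (one : Φ (word []) = 1)
    (mul : ∀ h k, Φ (shuffle h k) = Φ h * Φ k)
    (series : ∀ w : Word, w.head? ≠ some .b → Φ (word w) = polylogSeries w z)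
    (log : Φ (word [.b]) = Complex.log z) : Φ = polylog z := by
  apply H_ext
  intro w
  rw [← strip_sum .b w, map_sum, strip_sum, polylog, linExt_word]
  refine Finset.sum_congr rfl fun k _ => ?_
  rw [mul, morphism_replicate Φ one mul, log, stripFirst_word]
  congr 1
  have := stripW_mem .b k w
  refine LinearMap.eqOn_span (s := _) (g := linExt fun w => polylogSeries w z) ?_ this
  rintro _ ⟨u, hu, rfl⟩
  rw [series u hu, linExt_word]

theorem shuffle_rev (h k : H) : rev (shuffle h k) = shuffle (rev h) (rev k) := by
  have rc : ∀ (x : Letter) (h : H), rev (consL x h) = snocL x (rev h) := by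
    intro x h
    have : rev ∘ₗ consL x = snocL x ∘ₗ rev := H_ext fun w => by simp [rev_word]
    simpa using congrArg (fun F => F h) this
  have e : ∀ u v, rev (shW u v) = shW u.reverse v.reverse := by
    intro u v
    induction u generalizing v with
    | nil => simp [rev_word]
    | cons x u ihu =>
      induction v with
      | nil => simp [rev_word]
      | cons y v ihv =>
        rw [shW_cons, map_add, rc, rc, ihu, ihv]
        simp only [List.reverse_cons, shW_snoc]
  have : shuffle.compr₂ rev = shuffle.compl₁₂ rev rev :=
    H_ext₂ fun u v => by simp [e, rev_word]
  simpa using congrArg (fun F => F h k) this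

theorem shW_mem (y : Letter) (u v : Word) (hu : u = [] ∨ u.getLast? = some y)
    (hv : v.getLast? = some y) :
    shW u v ∈ Submodule.span ℚ {h : H | ∃ w : Word, w.getLast? = some y ∧ h = word w} := by
  have c : ∀ h : H, snocL y h ∈
      Submodule.span ℚ {h : H | ∃ w : Word, w.getLast? = some y ∧ h = word w} := by
    intro h
    induction h using Finsupp.induction_linear with
    | zero => simp
    | add f g hf hg => rw [map_add]; exact Submodule.add_mem _ hf hg
    | single u r =>
      have : (Finsupp.single u r : H) = r • word u := by simp [word]
      rw [this, map_smul, snocL_word]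
      exact Submodule.smul_mem _ _ (Submodule.subset_span ⟨u ++ [y], by simp, rfl⟩)
  rcases hu with rfl | hu
  · rw [shW_nil_left]
    exact Submodule.subset_span ⟨v, hv, rfl⟩
  · obtain ⟨u, rfl⟩ := List.getLast?_eq_some_iff.1 hu
    obtain ⟨v, rfl⟩ := List.getLast?_eq_some_iff.1 hv
    rw [shW_snoc]
    exact Submodule.add_mem _ (c _) (c _)

/-- The words in the components of the second expansion neither start with `b` nor end with `a`. -/
theorem stripLast_mem (k : ℕ) (w : Word) (hw : w.head? ≠ some .b) :
    stripLast .a k (word w) ∈ Submodule.span ℚ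
      {h : H | ∃ w : Word, w.head? ≠ some .b ∧ w.getLast? ≠ some .a ∧ h = word w} := by
  have e : stripLast .a k (word w) = rev (stripW .a k w.reverse) := by
    simp [stripLast, rev_word, stripFirst_word]
  rw [e]
  have hr := List.takeWhile_append_dropWhile (p := (· = Letter.a)) (l := w.reverse)
  rw [← List.getLast?_reverse] at hw
  unfold stripW
  cases hd : w.reverse.dropWhile (· = .a) with
  | nil =>
    dsimp only
    split_ifs
    · rw [rev_word]
      exact Submodule.subset_span ⟨[], by simp, by simp, rfl⟩
    · rw [map_zero]
      exact Submodule.zero_mem _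
  | cons y v =>
    have hy : y = .b := by
      have := List.head_dropWhile_not (p := fun z => decide (z = Letter.a)) (l := w.reverse)
        (by rw [hd]; simp)
      cases y <;> simp_all
    subst hy
    have hv : v.getLast? = some .a := by
      rw [← hr, hd] at hw
      rcases List.eq_nil_or_concat v with rfl | ⟨v, t, rfl⟩
      · simp at hw
      · cases t
        · simp
        · simp [List.getLast?_append, List.getLast?_cons] at hw
    dsimp only
    split_ifs
    · rw [map_smul]
      refine Submodule.smul_mem _ _ ?_
      have m := shW_mem .a (List.replicate
        ((w.reverse.takeWhile (· = Letter.a)).length - k) .a) v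
        (by
          cases (w.reverse.takeWhile (· = Letter.a)).length - k with
          | zero => simp
          | succ n => right; rw [List.replicate_succ']; simp) hv
      generalize shW _ v = h at m
      induction m using Submodule.span_induction with
      | mem h hh =>
        obtain ⟨u, hu, rfl⟩ := hh
        rw [consL_word, rev_word]
        refine Submodule.subset_span ⟨_, ?_, by simp, rfl⟩
        obtain ⟨u, rfl⟩ := List.getLast?_eq_some_iff.1 hu
        simp
      | zero => simp
      | add f g _ _ hf hg => rw [map_add, map_add]; exact Submodule.add_mem _ hf hg
      | smul r f _ hf => rw [map_smul, map_smul]; exact Submodule.smul_mem _ _ hf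
    · rw [map_zero]
      exact Submodule.zero_mem _

/-- A morphism with the prescribed values is the regularized polyzeta value. -/
theorem zetaReg_unique (c : ℂ) (Φ : H →ₗ[ℚ] ℂ) (one : Φ (word []) = 1)
    (mul : ∀ h k, Φ (shuffle h k) = Φ h * Φ k)
    (series : ∀ w : Word, w.head? ≠ some .b → w.getLast? ≠ some .a → Φ (word w) = zetaSeries w)
    (ha : Φ (word [.a]) = c) (hb : Φ (word [.b]) = 0) : Φ = zetaReg c := by
  have second : ∀ w : Word, w.head? ≠ some .b → Φ (word w) = zetaRegA c (word w) := by
    intro w hw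
    have e : ∑ k ∈ Finset.range (w.length + 1),
        shuffle (stripLast .a k (word w)) (word (List.replicate k .a)) = word w := by
      have := congrArg rev (strip_sum .a w.reverse)
      rw [map_sum, rev_word, List.reverse_reverse, List.length_reverse] at this
      refine Eq.trans (Finset.sum_congr rfl fun k _ => ?_) this
      rw [shuffle_rev, rev_word, List.reverse_replicate]
      simp [stripLast, rev_word, stripFirst_word]
    rw [← e, map_sum, e, zetaRegA, linExt_word]
    refine Finset.sum_congr rfl fun k _ => ?_
    rw [mul, morphism_replicate Φ one mul, ha]
    congr 1
    refine LinearMap.eqOn_span (s := _) (g := linExt zetaSeries) ?_ (stripLast_mem k w hw)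
    rintro _ ⟨u, hu, hu', rfl⟩
    rw [series u hu hu', linExt_word]
  apply H_ext
  intro w
  rw [← strip_sum .b w, map_sum, strip_sum, Finset.sum_eq_single 0]
  · rw [List.replicate_zero, shuffle_nil_right, zetaReg, LinearMap.comp_apply, stripFirst_word]
    refine LinearMap.eqOn_span (s := _) (g := zetaRegA c) ?_ (stripW_mem .b 0 w)
    rintro _ ⟨u, hu, rfl⟩
    exact second u hu
  · intro k _ hk
    rw [mul, morphism_replicate Φ one mul, hb, zero_pow hk]
    simp
  · simp

end Polyzeta

open Polyzeta

namespace Polyzeta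

/-! Both identities are one statement about an anti-endomorphism `f` (σ or τ), written g ↦ g^f on
the group, and a Möbius map m: 1 - z with fixed point 1/2 for σ, 1 - 1/z with fixed points ρ and ρ⁻¹
for τ. It has an algebraic half and an analytic half, which meet in `twist f h`, the function g ↦
h(g g^f).

Algebra. Let S be the set of all g g^f (this is P for σ and Q for τ) and M the subgroup where g^f =
g⁻¹. The function `twist f h` is right M-invariant and depends only on the restriction φ of h to S.
At s in S its value is φ(s s^f), which is φ(s²) on P and φ(s τ(s)) on Q. So it is the invariant
extension of the transformed function, as soon as invariant extensions are unique. Uniqueness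
amounts to the factorisation of the group as S·M, that is, to solving q q^f = g g^f with q in S.
This is done degree by degree (`exists_sym_sym`): if F is the action of f on leading terms, the
linearised equation is (1 + F)² d = c, where F = 1 for σ and F² - F + 1 = 0 for τ. Existence follows
since `twist f` is injective on the finite-dimensional spaces of invariant functions of bounded
degree, hence surjective there (`SymDivisible.exists_invariant`).

Analysis. The generating series L(z) = ∑ L_w(z) w satisfies dL = L·ω, where ω is dz/(1 - z) on the
letter a and dz/z on b (`hasDerivAt_polylog_word`). With its asymptotics exp(β log z) at the origin
this also shows that L(z) is group-like (`polylog_shuffle`). The map m turns the f-transformed forms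
into their negatives, so L(z) · L(m(z))^f is locally constant (`hasDerivAt_transport`). At a fixed
point r of m its coefficients are the values of L_{twist f w} at r. For z → 1 one has m(z) → 0, and
the coefficient at a word that neither starts with b nor ends with a tends to ζ(w)
(`StolzFilter.tendsto_transport`). Hence h ↦ L_{twist f h}(r) is a shuffle morphism that extends ζ
from the convergent words, and it is the regularisation given by its values at a and b. These values
are logarithms: 0 and 0 at 1/2, and ±iπ and 0 at ρ^{±1}. Independence of the chosen extension of φ
comes for free, because `twist f h` does not see it. -/

/-! ### Supports of shuffle products -/

/-- The span of the words with the property `p`. -/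
noncomputable def spanW (p : Word → Prop) : Submodule ℚ H := Submodule.span ℚ (word '' {w | p w})

theorem word_mem_spanW {p : Word → Prop} {w : Word} (h : p w) : word w ∈ spanW p :=
  Submodule.subset_span ⟨w, h, rfl⟩

theorem spanW_mono {p q : Word → Prop} (h : ∀ w, p w → q w) : spanW p ≤ spanW q :=
  Submodule.span_mono (Set.image_mono h)

theorem map_mem_spanW {M : Type*} [AddCommGroup M] [Module ℚ M] (F : H →ₗ[ℚ] M)
    (N : Submodule ℚ M) {p : Word → Prop} (hF : ∀ w, p w → F (word w) ∈ N) {h : H}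
    (hh : h ∈ spanW p) : F h ∈ N := by
  have : spanW p ≤ N.comap F := by
    rw [spanW, Submodule.span_le]
    rintro _ ⟨w, hw, rfl⟩
    exact hF w hw
  exact this hh

theorem eqOn_spanW {M : Type*} [AddCommGroup M] [Module ℚ M] {F G : H →ₗ[ℚ] M}
    {p : Word → Prop} (hF : ∀ w, p w → F (word w) = G (word w)) {h : H}
    (hh : h ∈ spanW p) : F h = G h := by
  refine LinearMap.eqOn_span (s := word '' {w | p w}) ?_ hh
  rintro _ ⟨w, hw, rfl⟩
  exact hF w hw

theorem consL_mem_spanW {p q : Word → Prop} (x : Letter) (hpq : ∀ w, p w → q (x :: w)) {h : H}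
    (hh : h ∈ spanW p) : consL x h ∈ spanW q :=
  map_mem_spanW (consL x) _ (fun w hw => by
    rw [consL_word]; exact word_mem_spanW (hpq w hw)) hh

theorem snocL_mem_spanW {p q : Word → Prop} (x : Letter) (hpq : ∀ w, p w → q (w ++ [x])) {h : H}
    (hh : h ∈ spanW p) : snocL x h ∈ spanW q :=
  map_mem_spanW (snocL x) _ (fun w hw => by
    rw [snocL_word]; exact word_mem_spanW (hpq w hw)) hh

theorem shW_mem_perm (u v : Word) : shW u v ∈ spanW fun w => w.Perm (u ++ v) := by
  induction u generalizing v with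
  | nil => simpa using word_mem_spanW (p := fun w => w.Perm v) (List.Perm.refl v)
  | cons x u ihu =>
    induction v with
    | nil => simpa using word_mem_spanW (p := fun w => w.Perm (x :: u)) (List.Perm.refl _)
    | cons y v ihv =>
      rw [shW_cons]
      refine Submodule.add_mem _ (consL_mem_spanW x (fun w hw => ?_) (ihu (y :: v)))
        (consL_mem_spanW y (fun w hw => ?_) ihv)
      · exact hw.cons x
      · exact (hw.cons y).trans List.perm_middle.symm

theorem shW_mem_length (u v : Word) :
    shW u v ∈ spanW fun w => w.length = u.length + v.length :=
  spanW_mono (fun w hw => by simpa using hw.length_eq) (shW_mem_perm u v)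

theorem shuffle_mem_length {m n : ℕ} {h k : H} (hh : h ∈ spanW fun w => w.length = m)
    (hk : k ∈ spanW fun w => w.length = n) :
    shuffle h k ∈ spanW fun w => w.length = m + n := by
  have : ∀ u : Word, u.length = m → shuffle (word u) k ∈ spanW fun w => w.length = m + n := by
    intro u hu
    refine map_mem_spanW (shuffle (word u)) _ (fun v hv => ?_) hk
    rw [shuffle_word, ← hu, ← hv]
    exact shW_mem_length u v
  exact map_mem_spanW (shuffle.flip k) _ (fun u hu => this u hu) hh

theorem antiW_mem_length (f : Letter → Letter → ℚ) (w : Word) :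
    antiW f w ∈ spanW fun v => v.length = w.length := by
  induction w with
  | nil => exact word_mem_spanW rfl
  | cons x w ih =>
    refine Submodule.sum_mem _ fun y _ => Submodule.smul_mem _ _ (snocL_mem_spanW y ?_ ih)
    intro v hv
    simp [hv]

theorem twistW_mem_length (f : Letter → Letter → ℚ) (w : Word) :
    twistW f w ∈ spanW fun v => v.length = w.length := by
  refine Submodule.sum_mem _ fun i _ => ?_
  rw [anti_word]
  have := shuffle_mem_length (word_mem_spanW (p := fun v => v.length = (w.take i).length) rfl)
    (antiW_mem_length f (w.drop i))
  rwa [← List.length_append, List.take_append_drop] at this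

theorem twist_word (f : Letter → Letter → ℚ) (w : Word) : twist f (word w) = twistW f w := by
  simp [twist, word]

/-! ### Powers of a letter -/

theorem shW_replicate (x : Letter) (m n : ℕ) :
    shW (List.replicate m x) (List.replicate n x) =
      ((m + n).choose m : ℚ) • word (List.replicate (m + n) x) := by
  induction m generalizing n with
  | zero => simp
  | succ m ihm =>
    induction n with
    | zero => simp
    | succ n ihn =>
      rw [List.replicate_succ, List.replicate_succ, shW_cons, ← List.replicate_succ,
        ← List.replicate_succ, ihn, ihm, map_smul, map_smul, consL_word, consL_word,
        ← List.replicate_succ, ← List.replicate_succ]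
      have e1 : m + (n + 1) + 1 = m + 1 + (n + 1) := by ring
      have e2 : m + 1 + n + 1 = m + 1 + (n + 1) := by ring
      rw [e1, e2, ← add_smul]
      congr 1
      have : (m + 1 + (n + 1)).choose (m + 1) =
          (m + (n + 1)).choose m + (m + 1 + n).choose (m + 1) := by
        rw [← e1, Nat.choose_succ_succ]
        congr 2
        ring
      exact_mod_cast this.symm

/-- The coefficients of the series `exp (t x)`. -/
noncomputable def expW {R : Type*} [Field R] (x : Letter) (t : R) (w : Word) : R :=
  if w = List.replicate w.length x then t ^ w.length / (w.length.factorial : R) else 0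

theorem expW_replicate {R : Type*} [Field R] (x : Letter) (t : R) (n : ℕ) :
    expW x t (List.replicate n x) = t ^ n / (n.factorial : R) := by
  simp [expW]

/-- The binomial coefficient in the shuffle of two powers of `x` turns the product of inverse
factorials into a single one; if another letter occurs, it occurs in every interleaving and both
sides vanish. The field is general because t is rational for `Gam.exp`, and the complex number log z
in the asymptotics at the origin. -/
theorem expW_shW {R : Type*} [Field R] [Algebra ℚ R] (x : Letter) (t : R) (u v : Word) :
    Finsupp.linearCombination ℚ (expW x t) (shW u v) = expW x t u * expW x t v := by
  have : CharZero R := algebraRat.charZero R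
  by_cases h : u = List.replicate u.length x ∧ v = List.replicate v.length x
  · rw [h.1, h.2, shW_replicate, map_smul]
    simp only [word, Finsupp.linearCombination_single, expW_replicate, Algebra.smul_def,
      map_natCast, map_one, one_mul]
    have h1 := Nat.choose_mul_factorial_mul_factorial (Nat.le_add_right u.length v.length)
    rw [Nat.add_sub_cancel_left] at h1
    have h2 : ((u.length + v.length).choose u.length * u.length.factorial * v.length.factorial : R) =
      (u.length + v.length).factorial := by exact_mod_cast h1
    have n1 : (u.length.factorial : R) ≠ 0 := by exact_mod_cast Nat.factorial_ne_zero _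
    have n2 : (v.length.factorial : R) ≠ 0 := by exact_mod_cast Nat.factorial_ne_zero _
    have n3 : ((u.length + v.length).factorial : R) ≠ 0 := by
      exact_mod_cast Nat.factorial_ne_zero _
    rw [pow_add]
    field_simp
    linear_combination t ^ u.length * t ^ v.length * h2
  · have hz : expW x t u * expW x t v = 0 := by
      rcases not_and_or.1 h with h | h <;> simp [expW, h]
    rw [hz]
    refine (eqOn_spanW (F := Finsupp.linearCombination ℚ (expW x t)) (G := 0) ?_
      (shW_mem_perm u v)).trans rfl
    intro w hw
    simp only [word, Finsupp.linearCombination_single, one_smul, LinearMap.zero_apply, expW]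
    rw [if_neg]
    intro hr
    apply h
    rw [List.eq_replicate_iff, List.eq_replicate_iff]
    have hx : ∀ y ∈ w, y = x := (List.eq_replicate_iff.1 hr).2
    exact ⟨⟨rfl, fun y hy => hx y (hw.mem_iff.2 (by simp [hy]))⟩,
      ⟨rfl, fun y hy => hx y (hw.mem_iff.2 (by simp [hy]))⟩⟩

/-- The group element `exp (t x)`. -/
noncomputable def Gam.exp (x : Letter) (t : ℚ) : Gam where
  coeff := expW x t
  coeff_nil := by simp [expW]
  coeff_shuffle := expW_shW x t

/-! ### Regular functions are determined by their values -/

/-- The coefficient of `w` in `exp (X x) g`, as a polynomial in `X`. -/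
noncomputable def expPoly (x : Letter) (g : Gam) : H →ₗ[ℚ] Polynomial ℚ :=
  Finsupp.linearCombination ℚ fun w => ∑ i ∈ Finset.range (w.length + 1),
    Polynomial.monomial i (if w.take i = List.replicate i x then
      g.coeff (w.drop i) / (i.factorial : ℚ) else 0)

theorem eval_expPoly (x : Letter) (g : Gam) (t : ℚ) (h : H) :
    (expPoly x g h).eval t = ev h (Gam.exp x t * g) := by
  have : (Polynomial.leval t).restrictScalars ℚ ∘ₗ expPoly x g =
      pair (Gam.exp x t * g).coeff := by
    apply H_ext
    intro w
    simp only [expPoly, word, LinearMap.comp_apply, Finsupp.linearCombination_single, one_smul,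
      LinearMap.restrictScalars_apply, Polynomial.leval_apply, pair, Polynomial.eval_finsetSum,
      Polynomial.eval_monomial, mul_coeff, conv]
    refine Finset.sum_congr rfl fun i hi => ?_
    have hl : (w.take i).length = i := by
      have := Finset.mem_range.1 hi
      rw [List.length_take]; omega
    simp only [Gam.exp, expW, hl]
    split_ifs <;> ring
  exact congrArg (fun F => F h) this

/-- The transpose of left multiplication by the letter `x`. -/
noncomputable def delL (x : Letter) : H →ₗ[ℚ] H := Finsupp.lcomapDomain (fun w => x :: w)
  (fun _ _ h => (List.cons.inj h).2)

theorem delL_apply (x : Letter) (h : H) (w : Word) : delL x h w = h (x :: w) := rfl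

/-- The derivative at t = 0 of h(exp(t x) g) comes from the cut after the first letter, and so
removes a leading `x` from the words of h. -/
theorem coeff_expPoly (x : Letter) (g : Gam) (h : H) :
    (expPoly x g h).coeff 1 = ev (delL x h) g := by
  have : Polynomial.lcoeff ℚ 1 ∘ₗ expPoly x g = pair g.coeff ∘ₗ delL x := by
    apply H_ext
    intro w
    simp only [expPoly, word, LinearMap.comp_apply, Finsupp.linearCombination_single, one_smul,
      Polynomial.lcoeff_apply, Polynomial.finsetSum_coeff, Polynomial.coeff_monomial]
    rw [Finset.sum_ite_eq' (Finset.range (w.length + 1)) 1]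
    cases w with
    | nil =>
      have : delL x (Finsupp.single [] 1) = 0 := by
        ext v; simp [delL_apply]
      simp [this]
    | cons y w =>
      by_cases hy : y = x
      · subst hy
        have : delL y (Finsupp.single (y :: w) 1) = word w := by
          ext v; simp [delL_apply, Finsupp.single_apply, word]
        rw [this]
        simp
      · have : delL x (Finsupp.single (y :: w) 1) = 0 := by
          ext v; simp [delL_apply, hy]
        rw [this]
        simp [hy]
  exact congrArg (fun F => F h) this

theorem ev_one (h : H) : ev h 1 = h [] := by
  have : pair (1 : Gam).coeff = Finsupp.lapply [] := by
    apply H_ext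
    intro w
    rw [pair_word, one_coeff]
    simp [word, Finsupp.single_apply]
  exact congrArg (fun F => F h) this

/-- The rational points of the group are dense. -/
theorem eq_zero_of_ev {h : H} (hh : ∀ g, ev h g = 0) : h = 0 := by
  ext w
  rw [Finsupp.zero_apply]
  induction w generalizing h with
  | nil => rw [← ev_one, hh]
  | cons x w ih =>
    rw [← delL_apply]
    refine ih fun g => ?_
    -- A polynomial that vanishes at all rational numbers is zero; its linear coefficient is the
    -- function h with a leading `x` removed, to which the induction on the word applies.
    have : expPoly x g h = 0 := by
      apply Polynomial.funext
      intro t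
      rw [eval_expPoly, hh, Polynomial.eval_zero]
    rw [← coeff_expPoly, this, Polynomial.coeff_zero]

theorem ev_sub (h k : H) (g : Gam) : ev (h - k) g = ev h g - ev k g := map_sub _ h k

theorem eq_of_ev {h k : H} (hh : ∀ g, ev h g = ev k g) : h = k :=
  sub_eq_zero.1 (eq_zero_of_ev fun g => by rw [ev_sub, hh, sub_self])

/-- At every point g both sides are the product of the values of h and k at g g^f, and rational
points separate regular functions. -/
theorem twist_shuffle (f : Letter → Letter → ℚ) (h k : H) :
    twist f (shuffle h k) = shuffle (twist f h) (twist f k) :=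
  eq_of_ev fun g => by simp only [ev_twist, ev_shuffle]

/-! ### Comparison of group elements degree by degree -/

/-- The coefficients of `g` and `h` at the words of length less than `n` agree, and at the words of
length `n` they differ by `c`. -/
def Differ (n : ℕ) (g h : Gam) (c : Word → ℚ) : Prop :=
  (∀ w, w.length < n → g.coeff w = h.coeff w) ∧ ∀ w, w.length = n → g.coeff w - h.coeff w = c w

/-- The coefficients of `g` and `h` at the words of length less than `n` agree. -/
def Agree (n : ℕ) (g h : Gam) : Prop := ∀ w, w.length < n → g.coeff w = h.coeff w

theorem Agree.differ {n : ℕ} {g h : Gam} (H : Agree n g h) :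
    Differ n g h fun w => g.coeff w - h.coeff w := ⟨H, fun _ _ => rfl⟩

theorem Differ.refl (n : ℕ) (g : Gam) : Differ n g g 0 := ⟨fun _ _ => rfl, fun _ _ => by simp⟩

theorem Differ.congr {n : ℕ} {g h : Gam} {c d : Word → ℚ} (H : Differ n g h c)
    (e : ∀ w, w.length = n → c w = d w) : Differ n g h d :=
  ⟨H.1, fun w hw => by rw [← e w hw, H.2 w hw]⟩

theorem Differ.unique {n : ℕ} {g h : Gam} {c d : Word → ℚ} (H : Differ n g h c)
    (H' : Differ n g h d) (w : Word) (hw : w.length = n) : c w = d w := by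
  rw [← H.2 w hw, ← H'.2 w hw]

theorem Agree.mul {n : ℕ} {g h g' h' : Gam} (H : Agree n g h) (H' : Agree n g' h') :
    Agree n (g * g') (h * h') := by
  intro w hw
  rw [mul_coeff, mul_coeff, conv, conv]
  refine Finset.sum_congr rfl fun i _ => ?_
  rw [H _ (by rw [List.length_take]; omega), H' _ (by rw [List.length_drop]; omega)]

/-- Leading terms add up: in the deconcatenations of a word of length n all cuts but the two extreme
ones involve only shorter words, where the coefficients agree, and at the extreme cuts the other
factor is the constant term 1. The condition n ≠ 0 keeps the two extreme cuts apart. -/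
theorem Differ.mul {n : ℕ} {g h g' h' : Gam} {c c' : Word → ℚ} (hn : n ≠ 0)
    (H : Differ n g h c) (H' : Differ n g' h' c') : Differ n (g * g') (h * h') (c + c') := by
  refine ⟨Agree.mul H.1 H'.1, fun w hw => ?_⟩
  rw [mul_coeff, mul_coeff, conv, conv, ← Finset.sum_sub_distrib]
  have : ∀ i ∈ Finset.range (w.length + 1),
      g.coeff (w.take i) * g'.coeff (w.drop i) - h.coeff (w.take i) * h'.coeff (w.drop i) =
        (if i = n then c w else 0) + if i = 0 then c' w else 0 := by
    intro i hi
    have hi := Finset.mem_range.1 hi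
    by_cases h0 : i = 0
    · subst h0
      rw [List.take_zero, List.drop_zero, g.coeff_nil, h.coeff_nil, one_mul, one_mul, H'.2 w hw,
        if_neg (Ne.symm hn), if_pos rfl, zero_add]
    · by_cases h1 : i = n
      · subst h1
        rw [← hw, List.take_length, List.drop_length, g'.coeff_nil, h'.coeff_nil, mul_one, mul_one,
          H.2 w hw, if_pos rfl, if_neg (by omega), add_zero]
      · rw [H.1 _ (by rw [List.length_take]; omega), H'.1 _ (by rw [List.length_drop]; omega),
          if_neg h0, if_neg h1, sub_self, add_zero]
  rw [Finset.sum_congr rfl this, Finset.sum_add_distrib, Finset.sum_ite_eq', Finset.sum_ite_eq',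
    if_pos (by simp [hw]), if_pos (by simp)]
  rfl

/-- The action of an anti-endomorphism on coefficients. -/
noncomputable def actL (f : Letter → Letter → ℚ) : (Word → ℚ) →ₗ[ℚ] (Word → ℚ) where
  toFun c w := pair c (antiW f w)
  map_add' c d := by
    have : pair (c + d) = pair c + pair d := H_ext fun w => by simp
    funext w
    simp [this]
  map_smul' r c := by
    have : pair (r • c) = r • pair c := H_ext fun w => by simp
    funext w
    simp [this]

theorem actL_congr (f : Letter → Letter → ℚ) {n : ℕ} {c d : Word → ℚ}
    (e : ∀ w, w.length = n → c w = d w) (w : Word) (hw : w.length = n) :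
    actL f c w = actL f d w :=
  eqOn_spanW (F := pair c) (G := pair d)
    (fun v hv => by rw [pair_word, pair_word, e v (hv.trans hw)]) (antiW_mem_length f w)

theorem Agree.act {n : ℕ} {g h : Gam} (f : Letter → Letter → ℚ) (H : Agree n g h) :
    Agree n (g.act f) (h.act f) := fun w hw =>
  eqOn_spanW (F := pair g.coeff) (G := pair h.coeff)
    (fun v hv => by rw [pair_word, pair_word, H v (hv ▸ hw)]) (antiW_mem_length f w)

theorem Differ.act {n : ℕ} {g h : Gam} {c : Word → ℚ} (f : Letter → Letter → ℚ)
    (H : Differ n g h c) : Differ n (g.act f) (h.act f) (actL f c) := by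
  refine ⟨Agree.act f H.1, fun w hw => ?_⟩
  exact eqOn_spanW (F := pair g.coeff - pair h.coeff) (G := pair c)
    (fun v hv => by simp [H.2 v (hv.trans hw)]) (antiW_mem_length f w)

/-- Forced by additivity of leading terms applied to g g⁻¹ = 1 = h h⁻¹. -/
theorem Differ.inv {n : ℕ} {g h : Gam} {c : Word → ℚ} (hn : n ≠ 0) (H : Differ n g h c) :
    Differ n g⁻¹ h⁻¹ (-c) := by
  have H' : Agree n g⁻¹ h⁻¹ := Agree.act negMat H.1
  have e := H.mul hn H'.differ
  rw [mul_inv_cancel, mul_inv_cancel] at e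
  refine H'.differ.congr fun w hw => ?_
  have := (Differ.refl n 1).unique e w hw
  simp only [Pi.zero_apply, Pi.add_apply, Pi.neg_apply] at this ⊢
  linarith

theorem Differ.pow {n : ℕ} {g : Gam} {c : Word → ℚ} (hn : n ≠ 0) (H : Differ n g 1 c) (m : ℕ) :
    Differ n (g ^ m) 1 ((m : ℚ) • c) := by
  induction m with
  | zero => simpa using Differ.refl n 1
  | succ m ih =>
    have := ih.mul hn H
    rw [← pow_succ, mul_one] at this
    refine this.congr fun w _ => ?_
    simp
    ring

/-- The automorphism of the group that multiplies both letters by `r`. -/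
noncomputable def Gam.scale (r : ℚ) (g : Gam) : Gam where
  coeff w := r ^ w.length * g.coeff w
  coeff_nil := by simp [g.coeff_nil]
  coeff_shuffle u v := by
    have := eqOn_spanW (F := pair fun w => r ^ w.length * g.coeff w)
      (G := r ^ (u.length + v.length) • pair g.coeff) (fun w hw => by simp [hw])
      (shW_mem_length u v)
    rw [this, LinearMap.smul_apply, g.coeff_shuffle, pow_add, smul_eq_mul]
    ring

/-- A substitute for dividing a Lie element by m that needs neither logarithm nor exponential:
scaling the letters by 1/m divides the leading term by mⁿ, and the power with exponent m^(n-1)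
multiplies it by m^(n-1). -/
theorem Differ.exists_div {n : ℕ} {g : Gam} {c : Word → ℚ} (hn : n ≠ 0) (H : Differ n g 1 c)
    (m : ℕ) (hm : m ≠ 0) : ∃ g' : Gam, Differ n g' 1 ((m : ℚ)⁻¹ • c) := by
  have hs : Differ n (g.scale (m : ℚ)⁻¹) 1 (((m : ℚ)⁻¹) ^ n • c) := by
    constructor
    · intro w hw
      change _ * g.coeff w = _
      rw [H.1 w hw, one_coeff]
      split_ifs with h <;> simp [h]
    · intro w hw
      change _ * g.coeff w - _ = _
      have hne : w ≠ [] := by rintro rfl; exact hn hw.symm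
      have := H.2 w hw
      rw [one_coeff, if_neg hne, sub_zero] at this ⊢
      rw [this, hw]
      rfl
  refine ⟨_, (hs.pow hn (m ^ (n - 1))).congr fun w _ => ?_⟩
  obtain ⟨k, rfl⟩ := Nat.exists_eq_succ_of_ne_zero hn
  have : (m : ℚ) ≠ 0 := by exact_mod_cast hm
  simp only [Nat.succ_eq_add_one, Nat.add_sub_cancel, Nat.cast_pow, Pi.smul_apply, smul_eq_mul,
    pow_succ, inv_pow]
  field_simp

/-- Completeness for the degree filtration. The coefficient at a word is final from the step
numbered by its length on. The limit is again group-like because the shuffle product of u and v only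
has words of length |u| + |v|, so the condition can be read off from one term of the sequence. -/
theorem Agree.exists_limit {s : ℕ → Gam} (hs : ∀ n, Agree (n + 1) (s (n + 1)) (s n)) :
    ∃ g : Gam, ∀ n, Agree (n + 1) g (s n) := by
  have h : ∀ n k, Agree (n + 1) (s (n + k)) (s n) := by
    intro n k
    induction k with
    | zero => exact fun _ _ => rfl
    | succ k ih =>
      intro w hw
      rw [← ih w hw]
      exact hs (n + k) w (by omega)
  have h' : ∀ n w, w.length < n + 1 → (s w.length).coeff w = (s n).coeff w := by
    intro n w hw
    have := h w.length (n - w.length) w (by omega)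
    rw [← this]
    congr 2
    omega
  refine ⟨⟨fun w => (s w.length).coeff w, (s 0).coeff_nil, fun u v => ?_⟩, h'⟩
  have e := eqOn_spanW (F := pair fun w => (s w.length).coeff w)
    (G := pair (s (u.length + v.length)).coeff)
    (fun w hw => by rw [pair_word, pair_word, hw]) (shW_mem_length u v)
  rw [e, Gam.coeff_shuffle, h' (u.length + v.length) u (by omega),
    h' (u.length + v.length) v (by omega)]

theorem eq_of_agree {g h : Gam} (H : ∀ n, Agree (n + 1) g h) : g = h := by
  ext w
  exact H w.length w (Nat.lt_succ_self _)

/-! ### The symmetric space attached to an anti-endomorphism -/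

/-- The map `g ↦ g g^f`. -/
noncomputable def Gam.sym (f : Letter → Letter → ℚ) (g : Gam) : Gam := g * g.act f

theorem Agree.sym {n : ℕ} {g h : Gam} (f : Letter → Letter → ℚ) (H : Agree n g h) :
    Agree n (g.sym f) (h.sym f) := H.mul (H.act f)

theorem Differ.sym {n : ℕ} {g h : Gam} {c : Word → ℚ} (f : Letter → Letter → ℚ) (hn : n ≠ 0)
    (H : Differ n g h c) : Differ n (g.sym f) (h.sym f) (c + actL f c) := H.mul hn (H.act f)

/-- Surjectivity of the square of `g ↦ g g^f` onto a closed set `C` follows from surjectivity in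
each degree. -/
theorem exists_sym_sym (f : Letter → Letter → ℚ) (C : Set Gam) (hC : ∀ g : Gam, g.sym f ∈ C)
    (step : ∀ n ≠ 0, ∀ x ∈ C, ∀ y ∈ C, ∀ c, Differ n x y c →
      ∃ u d, Differ n u 1 d ∧
        ∀ w, w.length = n → d w + 2 * actL f d w + actL f (actL f d) w = c w)
    (x : Gam) (hx : x ∈ C) : ∃ g : Gam, (g.sym f).sym f = x := by
  have next : ∀ n (s : Gam), Agree (n + 1) ((s.sym f).sym f) x →
      ∃ s' : Gam, Agree (n + 1) s' s ∧ Agree (n + 2) ((s'.sym f).sym f) x := by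
    intro n s hs
    have hs' : Agree (n + 1) x ((s.sym f).sym f) := fun w hw => (hs w hw).symm
    -- Correction in degree n + 1: multiplying s by u = 1 + d + ⋯ changes the leading term of the
    -- iterated symmetrisation by (1 + F)² d with F = `actL f`. The hypothesis `step` provides d
    -- with this equal to the defect.
    obtain ⟨u, d, hu, hd⟩ := step (n + 1) n.succ_ne_zero x hx _ (hC _) _ hs'.differ
    have h1 := (Differ.refl (n + 1) s).mul n.succ_ne_zero hu
    rw [mul_one, zero_add] at h1
    refine ⟨s * u, h1.1, fun w hw => ?_⟩
    have h2 := (h1.sym f n.succ_ne_zero).sym f n.succ_ne_zero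
    rcases Nat.lt_succ_iff_lt_or_eq.1 hw with hw | hw
    · rw [h2.1 w hw, hs w hw]
    · have e1 := h2.2 w hw
      have e2 := hd w hw
      simp only [Pi.add_apply, map_add] at e1
      linarith
  choose! S hS using next
  -- The iteration can start at 1, since below length 1 there is only the constant term.
  let s : ℕ → Gam := fun n => Nat.rec 1 (fun n t => S n t) n
  have hs : ∀ n, Agree (n + 1) (((s n).sym f).sym f) x := by
    intro n
    induction n with
    | zero =>
      intro w hw
      rw [List.length_eq_zero_iff.1 (Nat.lt_one_iff.1 hw), Gam.coeff_nil, Gam.coeff_nil]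
    | succ n ih => exact (hS n (s n) ih).2
  obtain ⟨g, hg⟩ := Agree.exists_limit (s := s) fun n => (hS n (s n) (hs n)).1
  refine ⟨g, eq_of_agree fun n w hw => ?_⟩
  rw [((hg n).sym f).sym f w hw, hs n w hw]

/-- For m with m^f = m⁻¹ one has (g m)(g m)^f = g m m⁻¹ g^f = g g^f. -/
theorem rightInvariant_twist (f : Letter → Letter → ℚ) (h : H) :
    RightInvariant (invertedBy f) (twist f h) := by
  intro g m hm
  have hm : m.act f = m⁻¹ := hm
  rw [ev_twist, ev_twist, act_mul, hm]
  congr 1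
  group

/-- The property of an anti-endomorphism that every element `g g^f` of the group has the form
`q q^f` with `q = s s^f`. -/
def SymDivisible (f : Letter → Letter → ℚ) : Prop :=
  ∀ g : Gam, ∃ s : Gam, (s.sym f).sym f = g.sym f

/-- This is the factorisation of the group as S·M. If q = s s^f satisfies q q^f = g g^f, then (q⁻¹
g)^f = g^f (q^f)⁻¹ = g⁻¹ q = (q⁻¹ g)⁻¹, so g lies in q M, and an invariant function has the same
value at g as at the point q of the symmetric space. -/
theorem SymDivisible.eq_zero {f : Letter → Letter → ℚ} (hf : SymDivisible f) {h : H}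
    (hi : RightInvariant (invertedBy f) h) (hv : ∀ g : Gam, ev h (g.sym f) = 0) : h = 0 := by
  refine eq_zero_of_ev fun g => ?_
  obtain ⟨s, hs⟩ := hf g
  have hl : (s.sym f)⁻¹ * g ∈ invertedBy f := by
    change Gam.act f _ = _
    rw [act_mul, act_inv, mul_inv_rev, inv_inv]
    have hs : s.sym f * (s.sym f).act f = g * g.act f := hs
    rw [mul_inv_eq_iff_eq_mul, mul_assoc, hs, inv_mul_cancel_left]
  have := hi (s.sym f) _ hl
  rw [mul_inv_cancel_left, hv] at this
  exact this

theorem finite_spanW_length (n : ℕ) :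
    FiniteDimensional ℚ (spanW fun w => w.length ≤ n) :=
  FiniteDimensional.span_of_finite ℚ ((List.finite_length_le Letter n).image _)

theorem exists_mem_spanW_length (h : H) : ∃ n, h ∈ spanW fun w => w.length ≤ n := by
  induction h using Finsupp.induction_linear with
  | zero => exact ⟨0, Submodule.zero_mem _⟩
  | add f g hf hg =>
    obtain ⟨m, hm⟩ := hf
    obtain ⟨n, hn⟩ := hg
    exact ⟨max m n, Submodule.add_mem _
      (spanW_mono (fun w hw => hw.trans (le_max_left _ _)) hm)
      (spanW_mono (fun w hw => hw.trans (le_max_right _ _)) hn)⟩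
  | single w r =>
    have : (Finsupp.single w r : H) = r • word w := by simp [word]
    rw [this]
    exact ⟨w.length, Submodule.smul_mem _ _ (word_mem_spanW le_rfl)⟩

/-- The right invariant functions. -/
noncomputable def invariants (M : Subgroup Gam) : Submodule ℚ H where
  carrier := {h | RightInvariant M h}
  add_mem' := by
    intro h k hh hk g m hm
    have e : ∀ g, ev (h + k) g = ev h g + ev k g := fun g => map_add _ h k
    rw [e, e, hh g m hm, hk g m hm]
  zero_mem' := fun g m _ => by simp [ev]
  smul_mem' := by
    intro r h hh g m hm
    have e : ∀ g, ev (r • h) g = r * ev h g := fun g => map_smul _ r h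
    rw [e, e, hh g m hm]

/-- The restriction of a regular function to the symmetric space extends to a right invariant
function. -/
theorem SymDivisible.exists_invariant {f : Letter → Letter → ℚ} (hf : SymDivisible f) (h : H) :
    ∃ Φ, RightInvariant (invertedBy f) Φ ∧ ∀ g : Gam, ev Φ (g.sym f) = ev h (g.sym f) := by
  obtain ⟨n, hn⟩ := exists_mem_spanW_length h
  have := finite_spanW_length n
  -- The map `twist f` does not raise lengths and has invariant values, so it sends all functions of
  -- degree at most n, invariant or not, into the finite-dimensional space W.
  let W := (spanW fun w => w.length ≤ n) ⊓ invariants (invertedBy f)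
  have hW : ∀ k ∈ (spanW fun w => w.length ≤ n), twist f k ∈ W := by
    intro k hk
    refine ⟨map_mem_spanW (twist f) _ (fun w hw => ?_) hk, rightInvariant_twist f k⟩
    rw [twist_word]
    exact spanW_mono (fun v hv => hv.le.trans hw) (twistW_mem_length f w)
  have : FiniteDimensional ℚ W := Submodule.finiteDimensional_of_le inf_le_left
  let T : W →ₗ[ℚ] W := (twist f).restrict fun k hk => hW k hk.1
  have hT : Function.Injective T := by
    rw [← LinearMap.ker_eq_bot, LinearMap.ker_eq_bot']
    rintro ⟨k, hk⟩ e
    have e : twist f k = 0 := congrArg Subtype.val e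
    ext1
    refine hf.eq_zero hk.2 fun g => ?_
    have := ev_twist f k g
    rw [e] at this
    rw [Gam.sym, ← this]
    exact map_zero _
  -- An element of the kernel in W is invariant and vanishes on all g g^f, so it is 0. Thus T is
  -- bijective on W, and `twist f h`, which lies in W, is also `twist f Φ` with Φ invariant; equal
  -- twists mean equal restrictions.
  obtain ⟨⟨Φ, hΦ⟩, e⟩ := LinearMap.injective_iff_surjective.1 hT ⟨_, hW h hn⟩
  have e : twist f Φ = twist f h := congrArg Subtype.val e
  refine ⟨Φ, hΦ.2, fun g => ?_⟩
  rw [Gam.sym, ← ev_twist, ← ev_twist, e]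

/-! ### Extensions of regular functions from the symmetric space to the group. -/

section extension

variable {f : Letter → Letter → ℚ} {S : Set Gam}

theorem extends_iff (hS : ∀ g, g ∈ S ↔ ∃ s : Gam, s.sym f = g) {φ : S → ℚ} {h : H}
    (hh : Extends φ h) (k : H) :
    Extends φ k ↔ ∀ g : Gam, ev k (g.sym f) = ev h (g.sym f) := by
  constructor
  · intro hk g
    have hg := (hS _).2 ⟨g, rfl⟩
    rw [hk ⟨_, hg⟩, hh ⟨_, hg⟩]
  · rintro hk ⟨s, hs⟩
    obtain ⟨g, rfl⟩ := (hS s).1 hs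
    rw [hk, hh ⟨_, hs⟩]

/-- Only the values of h at the points g g^f of S enter `twist f h`. This is the source of the
independence of ζ(φ) and ζ^±(ψ) of the extension. -/
theorem twist_eq_of_extends (hS : ∀ g, g ∈ S ↔ ∃ s : Gam, s.sym f = g) {φ : S → ℚ} {h k : H}
    (hh : Extends φ h) (hk : Extends φ k) : twist f h = twist f k :=
  eq_of_ev fun g => by
    rw [ev_twist, ev_twist]
    exact ((extends_iff hS hh k).1 hk g).symm

theorem existsUnique_invariant (hf : SymDivisible f)
    (hS : ∀ g, g ∈ S ↔ ∃ s : Gam, s.sym f = g) (φ : Reg S) :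
    ∃! Φ : H, RightInvariant (invertedBy f) Φ ∧ Extends φ.1 Φ := by
  obtain ⟨φ, h, hh⟩ := φ
  obtain ⟨Φ, hi, hΦ⟩ := hf.exists_invariant h
  refine ⟨Φ, ⟨hi, (extends_iff hS hh Φ).2 hΦ⟩, ?_⟩
  rintro Ψ ⟨hi', hΨ⟩
  rw [extends_iff hS hh] at hΨ
  have hm : Ψ - Φ ∈ invariants (invertedBy f) := Submodule.sub_mem _ hi' hi
  refine sub_eq_zero.1 (hf.eq_zero hm fun g => ?_)
  rw [ev_sub, hΨ, hΦ, sub_self]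

/-- The extension chosen in `polylogOn` is unique, so it may be replaced by `twist f h`, which is
invariant and has at s in S the value φ(s s^f) = χ(s). The hypothesis on χ is the common form of the
two operators; on P it reads χ(p) = φ(p²). -/
theorem polylogOn_eq (hf : SymDivisible f) (hS : ∀ g, g ∈ S ↔ ∃ s : Gam, s.sym f = g)
    {φ χ : Reg S} (hχ : ∀ (s : S) (hs : (s : Gam).sym f ∈ S), χ.1 s = φ.1 ⟨_, hs⟩)
    {h : H} (hh : Extends φ.1 h) (z : ℂ) :
    polylogOn (invertedBy f) χ z = polylog z (twist f h) := by
  have e := existsUnique_invariant hf hS χ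
  have h1 := Classical.epsilon_spec e.exists
  have h2 : RightInvariant (invertedBy f) (twist f h) ∧ Extends χ.1 (twist f h) := by
    refine ⟨rightInvariant_twist f h, fun s => ?_⟩
    have hs := (hS _).2 ⟨(s : Gam), rfl⟩
    rw [ev_twist, hχ s hs, ← hh ⟨_, hs⟩]
    rfl
  rw [polylogOn, e.unique h1 h2]

end extension

/-! ### The anti-automorphisms `σ` and `τ` -/

theorem anti_snocL (f : Letter → Letter → ℚ) (x : Letter) (h : H) :
    anti f (snocL x h) = ∑ y, f x y • consL y (anti f h) := by
  have e : ∀ w, antiW f (w ++ [x]) = ∑ y, f x y • consL y (antiW f w) := by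
    intro w
    induction w with
    | nil => simp [antiW]
    | cons z w ih =>
      simp only [List.cons_append, antiW, ih, map_sum, map_smul, consL_snocL, Finset.smul_sum]
      rw [Finset.sum_comm]
      exact Finset.sum_congr rfl fun _ _ => Finset.sum_congr rfl fun _ _ => smul_comm _ _ _
  have : anti f ∘ₗ snocL x = ∑ y, f x y • (consL y ∘ₗ anti f) :=
    H_ext fun w => by simp [e]
  simpa using congrArg (fun F => F h) this

theorem anti_consL (f : Letter → Letter → ℚ) (x : Letter) (h : H) :
    anti f (consL x h) = ∑ y, f x y • snocL y (anti f h) := by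
  have : anti f ∘ₗ consL x = ∑ y, f x y • (snocL y ∘ₗ anti f) :=
    H_ext fun w => by simp [antiW]
  simpa using congrArg (fun F => F h) this

theorem sum_letter {M : Type*} [AddCommMonoid M] (F : Letter → M) :
    ∑ x, F x = F .a + F .b := by
  change ∑ x ∈ {Letter.a, Letter.b}, F x = _
  simp

theorem anti_sigma_sigma (h : H) : anti sigmaMat (anti sigmaMat h) = h := by
  have : anti sigmaMat ∘ₗ anti sigmaMat = LinearMap.id := by
    apply H_ext
    intro w
    induction w with
    | nil => simp [antiW]
    | cons x w ih =>
      simp only [LinearMap.comp_apply, LinearMap.id_apply, anti_word] at ih ⊢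
      rw [← anti_word, ← consL_word, anti_consL]
      cases x <;> simp [sum_letter, sigmaMat, anti_snocL, ih]
  exact congrArg (fun F => F h) this

theorem anti_tau_tau_tau (h : H) : anti tauMat (anti tauMat (anti tauMat h)) = anti negMat h := by
  have : anti tauMat ∘ₗ anti tauMat ∘ₗ anti tauMat = anti negMat := by
    apply H_ext
    intro w
    induction w with
    | nil => simp [antiW]
    | cons x w ih =>
      simp only [LinearMap.comp_apply, anti_word] at ih ⊢
      rw [← anti_word, ← anti_word, ← consL_word, anti_consL, anti_consL]
      cases x <;> simp [sum_letter, tauMat, negMat, anti_snocL, anti_consL, ih]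
  exact congrArg (fun F => F h) this

theorem act_sigma_sigma (g : Gam) : (g.act sigmaMat).act sigmaMat = g := by
  ext w
  rw [act_coeff, ev_act, ← anti_word, anti_sigma_sigma, ev_word]

theorem act_tau_tau_tau (g : Gam) : ((g.act tauMat).act tauMat).act tauMat = g⁻¹ := by
  ext w
  rw [act_coeff, ev_act, ev_act, ← anti_word, anti_tau_tau_tau, anti_word]
  rfl

/-- On the difference of two σ-fixed elements the linearisation F of σ is the identity, so that (1 +
F)² = 4 and the correction is a quarter of the defect. -/
theorem exists_sym_sym_sigma (x : Gam) (hx : x.act sigmaMat = x) :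
    ∃ g : Gam, (g.sym sigmaMat).sym sigmaMat = x := by
  refine exists_sym_sym sigmaMat {x | x.act sigmaMat = x} ?_ ?_ x hx
  · intro g
    change Gam.act _ _ = _
    rw [Gam.sym, act_mul, act_sigma_sigma]
  · intro n hn x hx y hy c hc
    have hx : x.act sigmaMat = x := hx
    have hy : y.act sigmaMat = y := hy
    have h1 : ∀ w, w.length = n → actL sigmaMat c w = c w := by
      have := hc.act sigmaMat
      rw [hx, hy] at this
      exact this.unique hc
    have h2 := actL_congr sigmaMat h1
    have hu := hc.mul hn (Differ.refl n y⁻¹)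
    rw [mul_inv_cancel, add_zero] at hu
    obtain ⟨u, hu⟩ := hu.exists_div hn 4 (by norm_num)
    refine ⟨u, _, hu, fun w hw => ?_⟩
    simp only [map_smul, Pi.smul_apply, smul_eq_mul, h1 w hw, h2 w hw]
    norm_num
    ring

/-- The closed condition on x holds for x = g g^τ because x^τ = g^{ττ} g^τ and, as τ³ is inversion,
x^{ττ} = g^{ττ} g⁻¹. Linearised, it says 1 - F + F² = 0, whence (1 + F)² = 3F, and F is inverted by
1 - F. -/
theorem exists_sym_sym_tau (x : Gam)
    (hx : x * (x.act tauMat)⁻¹ * (x.act tauMat).act tauMat = 1) :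
    ∃ g : Gam, (g.sym tauMat).sym tauMat = x := by
  refine exists_sym_sym tauMat
    {x | x * (x.act tauMat)⁻¹ * (x.act tauMat).act tauMat = 1} ?_ ?_ x hx
  · intro g
    change _ * _ * _ = _
    rw [Gam.sym, act_mul, act_mul, act_tau_tau_tau]
    group
  · intro n hn x hx y hy c hc
    have hx : x * (x.act tauMat)⁻¹ * (x.act tauMat).act tauMat = 1 := hx
    have hy : y * (y.act tauMat)⁻¹ * (y.act tauMat).act tauMat = 1 := hy
    have h1 : ∀ w, w.length = n → actL tauMat (actL tauMat c) w = actL tauMat c w - c w := by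
      have := (hc.mul hn ((hc.act tauMat).inv hn)).mul hn ((hc.act tauMat).act tauMat)
      rw [hx, hy] at this
      intro w hw
      have := this.unique (Differ.refl n 1) w hw
      simp only [Pi.add_apply, Pi.neg_apply, Pi.zero_apply] at this
      linarith
    have h2 := actL_congr tauMat (d := actL tauMat c - c) h1
    have hu := hc.mul hn (Differ.refl n y⁻¹)
    rw [mul_inv_cancel, add_zero] at hu
    obtain ⟨v, hv⟩ := hu.exists_div hn 3 (by norm_num)
    -- With v of leading term c/3, the element v (v^τ)⁻¹ has the leading term d = (c - F c)/3, and
    -- 3F d = F c - F² c = c.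
    have hu := hv.mul hn ((hv.act tauMat).inv hn)
    rw [act_one, inv_one, mul_one] at hu
    refine ⟨_, _, hu, fun w hw => ?_⟩
    have e1 := h1 w hw
    have e2 := h2 w hw
    simp only [map_smul, map_add, map_neg, map_sub, Pi.smul_apply, Pi.add_apply, Pi.neg_apply,
      Pi.sub_apply, smul_eq_mul] at e1 e2 ⊢
    rw [e2, e1]
    norm_num
    ring

theorem symDivisible_sigma : SymDivisible sigmaMat := by
  refine fun g => exists_sym_sym_sigma _ ?_
  rw [Gam.sym, act_mul, act_sigma_sigma]

theorem symDivisible_tau : SymDivisible tauMat := by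
  refine fun g => exists_sym_sym_tau _ ?_
  rw [Gam.sym, act_mul, act_mul, act_tau_tau_tau]
  group

theorem mem_P_iff (g : Gam) : g ∈ P ↔ ∃ s : Gam, s.sym sigmaMat = g := by
  constructor
  · intro hg
    obtain ⟨s, hs⟩ := exists_sym_sym_sigma g hg
    exact ⟨_, hs⟩
  · rintro ⟨s, rfl⟩
    change Gam.act _ _ = _
    rw [Gam.sym, act_mul, act_sigma_sigma]

theorem mem_Q_iff (g : Gam) : g ∈ Q ↔ ∃ s : Gam, s.sym tauMat = g := Iff.rfl

/-! ### The coefficients of the polylogarithmic series -/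

/-- The sum of `n₁^(-r₁) ⋯ nₖ^(-rₖ)` over all `0 < n₁ < ⋯ < nₖ = n`, for the list
`[rₖ, …, r₁]`. -/
noncomputable def coefR : List ℕ → ℕ → ℝ
  | [], n => if n = 0 then 1 else 0
  | m :: r, n => ((n : ℝ) ^ m)⁻¹ * ∑ j ∈ Finset.range n, coefR r j

theorem coefR_nonneg (r : List ℕ) (n : ℕ) : 0 ≤ coefR r n := by
  induction r generalizing n with
  | nil => rw [coefR]; split_ifs <;> norm_num
  | cons m r ih => exact mul_nonneg (by positivity) (Finset.sum_nonneg fun j _ => ih j)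

theorem coefR_cons_le (m : ℕ) (r : List ℕ) (hm : 1 ≤ m) (n : ℕ) :
    coefR (m :: r) n ≤ (n : ℝ)⁻¹ * ∑ j ∈ Finset.range n, coefR r j := by
  rcases Nat.eq_zero_or_pos n with rfl | hn
  · simp [coefR]
  · refine mul_le_mul_of_nonneg_right ?_ (Finset.sum_nonneg fun j _ => coefR_nonneg r j)
    have h1 : (1 : ℝ) ≤ n := by exact_mod_cast hn
    exact inv_anti₀ (by linarith) (le_self_pow₀ h1 (by omega))

theorem coefR_le_one (r : List ℕ) (hr : ∀ m ∈ r, 1 ≤ m) (n : ℕ) : coefR r n ≤ 1 := by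
  induction r generalizing n with
  | nil => rw [coefR]; split_ifs <;> norm_num
  | cons m r ih =>
    refine (coefR_cons_le m r (hr m (by simp)) n).trans ?_
    have h : ∑ j ∈ Finset.range n, coefR r j ≤ ∑ j ∈ Finset.range n, (1 : ℝ) :=
      Finset.sum_le_sum fun j _ => ih (fun k hk => hr k (by simp [hk])) j
    rw [Finset.sum_const, Finset.card_range, nsmul_eq_mul, mul_one] at h
    rcases Nat.eq_zero_or_pos n with rfl | hn
    · simp
    · have h1 : (0 : ℝ) < n := by exact_mod_cast hn
      rw [inv_mul_le_iff₀ h1, mul_one]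
      exact h

/-- Telescoping comparison of each term with 2√(n+1) - 2√n; the term j = 0 is 0, being the inverse
of 0. -/
theorem sum_inv_sqrt_le (n : ℕ) :
    ∑ j ∈ Finset.range (n + 1), (Real.sqrt j)⁻¹ ≤ 2 * Real.sqrt n := by
  induction n with
  | zero => simp
  | succ n ih =>
    rw [Finset.sum_range_succ]
    have h1 : 0 < Real.sqrt (n + 1 : ℝ) := Real.sqrt_pos.2 (by positivity)
    have h2 : Real.sqrt n ^ 2 = n := Real.sq_sqrt (by positivity)
    have h3 : Real.sqrt (n + 1 : ℝ) ^ 2 = n + 1 := Real.sq_sqrt (by positivity)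
    push_cast
    have h4 : (Real.sqrt (n + 1 : ℝ))⁻¹ ≤ 2 * Real.sqrt (n + 1 : ℝ) - 2 * Real.sqrt n := by
      rw [inv_le_iff_one_le_mul₀' h1]
      nlinarith [sq_nonneg (Real.sqrt (n + 1 : ℝ) - Real.sqrt n)]
    linarith

/-- A bound of order n^(-1/2) replaces the true one by powers of log n divided by n, because it
reproduces itself: its sum below n is O(n^(1/2)), and the next exponent contributes at least one
factor 1/n. It makes the coefficients tend to 0, and for a last exponent of at least 2 a further
factor 1/n gives the summable bound n^(-3/2). -/
theorem coefR_le_sqrt (m : ℕ) (r : List ℕ) (hm : 1 ≤ m) (hr : ∀ k ∈ r, 1 ≤ k) :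
    ∃ C, 0 ≤ C ∧ ∀ n, coefR (m :: r) n ≤ C * (Real.sqrt n)⁻¹ := by
  induction r generalizing m with
  | nil =>
    refine ⟨1, zero_le_one, fun n => ?_⟩
    refine (coefR_cons_le m [] hm n).trans ?_
    rcases Nat.eq_zero_or_pos n with rfl | hn
    · simp
    · have h1 : (1 : ℝ) ≤ n := by exact_mod_cast hn
      have h2 : ∑ j ∈ Finset.range n, coefR [] j = 1 := by
        simp [coefR, hn]
      rw [h2, mul_one, one_mul]
      refine inv_anti₀ (Real.sqrt_pos.2 (by linarith)) ?_
      rw [Real.sqrt_le_left (by linarith)]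
      nlinarith
  | cons k r ih =>
    obtain ⟨C, hC, h⟩ := ih k (hr k (by simp)) (fun l hl => hr l (by simp [hl]))
    refine ⟨C * 2, by positivity, fun n => ?_⟩
    refine (coefR_cons_le m _ hm n).trans ?_
    have h2 : ∑ j ∈ Finset.range n, coefR (k :: r) j ≤ C * (2 * Real.sqrt n) := by
      refine (Finset.sum_le_sum fun j _ => h j).trans ?_
      rw [← Finset.mul_sum]
      refine mul_le_mul_of_nonneg_left ((Finset.sum_le_sum_of_subset_of_nonneg
        (Finset.range_mono n.le_succ) fun _ _ _ => ?_).trans (sum_inv_sqrt_le n)) hC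
      positivity
    refine (mul_le_mul_of_nonneg_left h2 (by positivity)).trans (le_of_eq ?_)
    rcases Nat.eq_zero_or_pos n with rfl | hn
    · simp
    · have hn' : (0 : ℝ) < n := by exact_mod_cast hn
      have h1 : 0 < Real.sqrt n := Real.sqrt_pos.2 hn'
      have h2 : Real.sqrt n ^ 2 = n := Real.sq_sqrt hn'.le
      field_simp
      rw [h2, mul_comm]

theorem tendsto_coefR (m : ℕ) (r : List ℕ) (hm : 1 ≤ m) (hr : ∀ k ∈ r, 1 ≤ k) :
    Filter.Tendsto (coefR (m :: r)) Filter.atTop (nhds 0) := by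
  obtain ⟨C, _, h⟩ := coefR_le_sqrt m r hm hr
  have : Filter.Tendsto (fun n : ℕ => C * (Real.sqrt n)⁻¹) Filter.atTop (nhds (C * 0)) :=
    ((tendsto_inv_atTop_zero.comp
      (Real.tendsto_sqrt_atTop.comp tendsto_natCast_atTop_atTop)).const_mul C)
  rw [mul_zero] at this
  exact squeeze_zero (coefR_nonneg _) h this

theorem summable_coefR (m : ℕ) (r : List ℕ) (hm : 2 ≤ m) (hr : ∀ k ∈ r, 1 ≤ k) :
    Summable (coefR (m :: r)) := by
  obtain ⟨C, hC, h⟩ := coefR_le_sqrt 1 r le_rfl hr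
  have hs : Summable fun n : ℕ => C * ((n : ℝ) ^ (3 / 2 : ℝ))⁻¹ :=
    (Real.summable_nat_rpow_inv.2 (by norm_num)).mul_left C
  refine Summable.of_nonneg_of_le (coefR_nonneg _) (fun n => ?_) hs
  rcases Nat.eq_zero_or_pos n with rfl | hn
  · simp [coefR]
  · have hn' : (0 : ℝ) < n := by exact_mod_cast hn
    have h1 : (1 : ℝ) ≤ n := by exact_mod_cast hn
    have e : coefR (m :: r) n ≤ (n : ℝ)⁻¹ * coefR (1 :: r) n := by
      rw [coefR, coefR, ← mul_assoc]
      refine mul_le_mul_of_nonneg_right ?_ (Finset.sum_nonneg fun j _ => coefR_nonneg r j)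
      rw [← mul_inv, pow_one, ← pow_two]
      exact inv_anti₀ (by positivity) (pow_le_pow_right₀ h1 hm)
    refine e.trans ((mul_le_mul_of_nonneg_left (h n) (by positivity)).trans (le_of_eq ?_))
    have : (n : ℝ) ^ (3 / 2 : ℝ) = n * Real.sqrt n := by
      rw [Real.sqrt_eq_rpow, ← Real.rpow_one_add' hn'.le (by norm_num)]
      norm_num
    rw [this, mul_inv]
    ring

/-! ### Sums over chains -/

theorem sup_chain {k : ℕ} {c : Fin (k + 1) → ℕ} (hc : StrictMono c) :
    Finset.univ.sup c = c (Fin.last k) :=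
  le_antisymm (Finset.sup_le fun i _ => hc.monotone (Fin.le_last i))
    (Finset.le_sup (Finset.mem_univ _))

/-- Chains with a given last element correspond to shorter chains that end earlier. -/
def chainEquiv (k n : ℕ) :
    {c : Chain (k + 1) | Finset.univ.sup c.1 = n} ≃ {c : Chain k | Finset.univ.sup c.1 < n} where
  toFun c := ⟨⟨fun i => c.1.1 i.castSucc, fun _ _ h => c.1.2.1 (Fin.castSucc_lt_castSucc_iff.2 h),
      fun i => c.1.2.2 _⟩, by
    have h := sup_chain c.1.2.1
    have h' : Finset.univ.sup c.1.1 = n := c.2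
    change Finset.univ.sup (fun i : Fin k => c.1.1 i.castSucc) < n
    rw [Finset.sup_lt_iff]
    · intro i _
      exact (c.1.2.1 (Fin.castSucc_lt_last i)).trans_eq (h.symm.trans h')
    · exact (c.1.2.2 _).trans_eq (h.symm.trans h')⟩
  invFun c := ⟨⟨Fin.snoc (α := fun _ => ℕ) c.1.1 n, by
      intro i j hij
      have hc : Finset.univ.sup c.1.1 < n := c.2
      induction j using Fin.lastCases with
      | last =>
        induction i using Fin.lastCases with
        | last => exact absurd hij (lt_irrefl _)
        | cast i =>
          rw [Fin.snoc_castSucc, Fin.snoc_last]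
          exact (Finset.le_sup (f := c.1.1) (Finset.mem_univ i)).trans_lt hc
      | cast j =>
        induction i using Fin.lastCases with
        | last => exact absurd (hij.trans (Fin.castSucc_lt_last j)) (lt_irrefl _)
        | cast i =>
          rw [Fin.snoc_castSucc, Fin.snoc_castSucc]
          exact c.1.2.1 (Fin.castSucc_lt_castSucc_iff.1 hij), by
      intro i
      have hc : Finset.univ.sup c.1.1 < n := c.2
      induction i using Fin.lastCases with
      | last =>
        rw [Fin.snoc_last]
        exact (Nat.zero_le _).trans_lt hc
      | cast i =>
        rw [Fin.snoc_castSucc]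
        exact c.1.2.2 i⟩, by
    have hc : Finset.univ.sup c.1.1 < n := c.2
    change Finset.univ.sup (Fin.snoc (α := fun _ => ℕ) c.1.1 n) = n
    refine le_antisymm (Finset.sup_le fun i _ => ?_) ?_
    · induction i using Fin.lastCases with
      | last => rw [Fin.snoc_last]
      | cast i =>
        rw [Fin.snoc_castSucc]
        exact (Finset.le_sup (f := c.1.1) (Finset.mem_univ i)).trans hc.le
    · exact (Fin.snoc_last (α := fun _ => ℕ) n c.1.1).symm.le.trans
        (Finset.le_sup (f := Fin.snoc (α := fun _ => ℕ) c.1.1 n) (Finset.mem_univ _))⟩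
  left_inv c := by
    ext i
    have h := sup_chain c.1.2.1
    have h' : Finset.univ.sup c.1.1 = n := c.2
    change Fin.snoc (α := fun _ => ℕ) (fun i : Fin k => c.1.1 i.castSucc) n i = c.1.1 i
    induction i using Fin.lastCases with
    | last => rw [Fin.snoc_last]; exact h'.symm.trans h
    | cast i => rw [Fin.snoc_castSucc]
  right_inv c := by
    ext i
    exact Fin.snoc_castSucc (α := fun _ => ℕ) _ _ _

/-- The summand of a multiple zeta series. -/
noncomputable def chainTerm {k : ℕ} (e : Fin k → ℕ) (c : Chain k) : ℝ :=
  ∏ i, ((c.1 i : ℝ) ^ e i)⁻¹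

theorem chainTerm_nonneg {k : ℕ} (e : Fin k → ℕ) (c : Chain k) : 0 ≤ chainTerm e c :=
  Finset.prod_nonneg fun _ _ => by positivity

/-- Removing the largest index n splits off its factor, and sorting the remaining chains by their
own largest index j < n gives the recursion of `coefR`. The list is reversed because the recursion
begins with the last exponent. The empty chain has supremum 0, which accounts for the coefficient 1
at n = 0. -/
theorem hasSum_chainTerm_fiber {k : ℕ} (e : Fin k → ℕ) (n : ℕ) :
    HasSum (chainTerm e ∘ ((↑) : {c : Chain k | Finset.univ.sup c.1 = n} → Chain k))
      (coefR (List.ofFn e).reverse n) := by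
  induction k generalizing n with
  | zero =>
    rw [List.ofFn_zero, List.reverse_nil, coefR]
    split_ifs with h
    · subst h
      let c₀ : {c : Chain 0 | Finset.univ.sup c.1 = 0} :=
        ⟨⟨Fin.elim0, fun i => i.elim0, fun i => i.elim0⟩, by simp⟩
      have : chainTerm e c₀.1 = 1 := by simp [chainTerm]
      rw [← this]
      refine hasSum_single c₀ fun c hc => absurd (Subtype.ext (Subtype.ext ?_)) hc
      exact Subsingleton.elim _ _
    · have : IsEmpty {c : Chain 0 | Finset.univ.sup c.1 = n} := by
        refine ⟨fun c => h ?_⟩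
        have := c.2
        simpa using this.symm
      exact hasSum_empty
  | succ k ih =>
    have h1 : HasSum (chainTerm (fun i : Fin k => e i.castSucc) ∘
        ((↑) : {c : Chain k | Finset.univ.sup c.1 < n} → Chain k))
        (∑ j ∈ Finset.range n, coefR (List.ofFn fun i : Fin k => e i.castSucc).reverse j) := by
      have hU : {c : Chain k | Finset.univ.sup c.1 < n} =
          ⋃ j ∈ Finset.range n, {c : Chain k | Finset.univ.sup c.1 = j} := by
        ext c
        simp
      rw [hU]
      refine hasSum_sum_disjoint _ ?_ fun j _ => ih _ j
      intro i _ j _ hij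
      rw [Function.onFun, Set.disjoint_left]
      intro c hc hc'
      exact hij (hc.symm.trans hc')
    have h2 := ((chainEquiv k n).hasSum_iff.2 h1).mul_left (((n : ℝ) ^ e (Fin.last k))⁻¹)
    rw [List.ofFn_succ_last, List.reverse_append, List.reverse_singleton, List.singleton_append,
      coefR]
    refine Eq.subst (motive := fun F => HasSum F _) (funext fun c => ?_) h2
    have h := sup_chain c.1.2.1
    have h' : Finset.univ.sup c.1.1 = n := c.2
    simp only [Function.comp_apply, chainTerm, Fin.prod_univ_castSucc]
    rw [mul_comm, ← h, h']
    rfl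

/-- Absolute convergence allows the sum over all chains to be taken along the fibres of the largest
index, which turns the multiple series into a power series in one variable. -/
theorem hasSum_chain {k : ℕ} (e : Fin k → ℕ) (z : ℂ)
    (hz : Summable fun n => coefR (List.ofFn e).reverse n * ‖z‖ ^ n) :
    HasSum (fun c : Chain k => (chainTerm e c : ℂ) * z ^ Finset.univ.sup c.1)
      (∑' n, (coefR (List.ofFn e).reverse n : ℂ) * z ^ n) := by
  let E := Equiv.sigmaFiberEquiv fun c : Chain k => Finset.univ.sup c.1
  have hsum : Summable fun n => (coefR (List.ofFn e).reverse n : ℂ) * z ^ n := by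
    refine Summable.of_norm (hz.congr fun n => ?_)
    rw [norm_mul, norm_pow, Complex.norm_real, Real.norm_of_nonneg (coefR_nonneg _ _)]
  have hf : ∀ n, HasSum (fun c : {c : Chain k // Finset.univ.sup c.1 = n} =>
      chainTerm e c) (coefR (List.ofFn e).reverse n) := hasSum_chainTerm_fiber e
  rw [← E.hasSum_iff]
  refine HasSum.sigma_of_hasSum hsum.hasSum (fun n => ?_) ?_
  · have := (Complex.hasSum_ofReal.2 (hf n)).mul_right (z ^ n)
    refine Eq.subst (motive := fun F => HasSum F _) (funext fun c => ?_) this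
    have hc := c.2
    simp only [Function.comp_apply]
    change _ = _ * z ^ Finset.univ.sup c.1.1
    rw [hc]
    rfl
  · refine Summable.of_norm ?_
    have hn : ∀ n, HasSum (fun c : {c : Chain k // Finset.univ.sup c.1 = n} =>
        ‖((fun c : Chain k => (chainTerm e c : ℂ) * z ^ Finset.univ.sup c.1) ∘ E) ⟨n, c⟩‖)
        (coefR (List.ofFn e).reverse n * ‖z‖ ^ n) := by
      intro n
      have := (hf n).mul_right (‖z‖ ^ n)
      refine Eq.subst (motive := fun F => HasSum F _) (funext fun c => ?_) this
      have hc := c.2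
      simp only [Function.comp_apply]
      change _ = ‖_ * z ^ Finset.univ.sup c.1.1‖
      rw [hc, norm_mul, norm_pow, Complex.norm_real, Real.norm_of_nonneg (chainTerm_nonneg _ _)]
      rfl
    rw [summable_sigma_of_nonneg (fun _ => norm_nonneg _)]
    refine ⟨fun n => (hn n).summable, ?_⟩
    simp only [fun n => (hn n).tsum_eq]
    exact hz

/-! ### Polylogarithmic series as power series -/

/-- The coefficients of the power series attached to a word. -/
noncomputable def cw (w : Word) : ℕ → ℝ := coefR (exponents w).reverse

theorem one_le_of_mem_exponents (w : Word) : ∀ m ∈ (exponents w).reverse, 1 ≤ m := by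
  intro m hm
  rw [List.mem_reverse] at hm
  induction w with
  | nil => simp [exponents] at hm
  | cons x w ih =>
    cases x
    · rw [exponents, List.mem_cons] at hm
      rcases hm with rfl | hm
      · omega
      · exact ih hm
    · exact ih hm

theorem cw_nonneg (w : Word) (n : ℕ) : 0 ≤ cw w n := coefR_nonneg _ n

theorem cw_le_one (w : Word) (n : ℕ) : cw w n ≤ 1 :=
  coefR_le_one _ (one_le_of_mem_exponents w) n

theorem summable_cw {x : ℝ} (hx : 0 ≤ x) (hx1 : x < 1) (w : Word) :
    Summable fun n => cw w n * x ^ n := by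
  refine Summable.of_nonneg_of_le (fun n => mul_nonneg (cw_nonneg w n) (pow_nonneg hx n))
    (fun n => ?_) (summable_geometric_of_lt_one hx hx1)
  exact mul_le_of_le_one_left (pow_nonneg hx n) (cw_le_one w n)

theorem polylogSeries_eq_tsum_of_summable (w : Word) (z : ℂ)
    (hz : Summable fun n => cw w n * ‖z‖ ^ n) :
    polylogSeries w z = ∑' n, (cw w n : ℂ) * z ^ n := by
  have h := hasSum_chain (fun i => (exponents w).get i) z (by rwa [List.ofFn_get])
  rw [List.ofFn_get] at h
  rw [cw, ← h.tsum_eq, polylogSeries]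
  congr 1
  funext c
  simp [chainTerm]

theorem polylogSeries_eq_tsum (w : Word) {z : ℂ} (hz : ‖z‖ < 1) :
    polylogSeries w z = ∑' n, (cw w n : ℂ) * z ^ n :=
  polylogSeries_eq_tsum_of_summable w z (summable_cw (norm_nonneg z) hz w)

theorem zetaSeries_eq_polylogSeries (w : Word) : zetaSeries w = polylogSeries w 1 := by
  simp [zetaSeries, polylogSeries]

theorem zetaSeries_eq_tsum (w : Word) (hw : Summable (cw w)) :
    zetaSeries w = ∑' n, (cw w n : ℂ) := by
  rw [zetaSeries_eq_polylogSeries, polylogSeries_eq_tsum_of_summable w 1 (by simpa using hw)]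
  simp

theorem exponents_append_a (w : Word) : exponents (w ++ [.a]) = exponents w ++ [1] := by
  induction w with
  | nil => simp [exponents]
  | cons x w ih =>
    cases x
    · rw [List.cons_append, exponents, ih, exponents, List.cons_append]
      congr 2
      rw [List.takeWhile_append]
      split_ifs with h
      · simp [h]
      · rfl
    · rw [List.cons_append, exponents, ih, exponents]

theorem exponents_eq_nil_iff (w : Word) : exponents w = [] ↔ ∀ x ∈ w, x = .b := by
  induction w with
  | nil => simp [exponents]
  | cons x w ih => cases x <;> simp [exponents, ih]

theorem exponents_append_b (w : Word) :
    (exponents (w ++ [.b])).reverse = match (exponents w).reverse with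
      | [] => []
      | m :: r => (m + 1) :: r := by
  induction w with
  | nil => simp [exponents]
  | cons x w ih =>
    cases x
    · rw [List.cons_append, exponents, List.reverse_cons, ih, exponents, List.reverse_cons,
        List.takeWhile_append]
      -- Either w is a power of b, and the run after the leading a reaches the new letter and grows,
      -- or an a stops that run before the end of w and the first exponent stays the same.
      cases h : (exponents w).reverse with
      | nil =>
        have h' := (exponents_eq_nil_iff w).1 (List.reverse_eq_nil_iff.1 h)
        have h'' : w.takeWhile (· = Letter.b) = w := by
          rw [List.takeWhile_eq_self_iff]
          simpa using h'
        simp [h'']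
        omega
      | cons m r =>
        have h' : ¬ ∀ x ∈ w, x = Letter.b := by
          rw [← exponents_eq_nil_iff, ← List.reverse_eq_nil_iff, h]
          simp
        rw [if_neg]
        · simp
        · intro hl
          apply h'
          have := (List.takeWhile_prefix (l := w) (· = Letter.b)).eq_of_length hl
          rw [List.takeWhile_eq_self_iff] at this
          simpa using this
    · rw [List.cons_append, exponents, ih, exponents]

theorem cw_nil (n : ℕ) : cw [] n = if n = 0 then 1 else 0 := by
  simp [cw, exponents, coefR]

theorem cw_append_a (w : Word) (n : ℕ) :
    cw (w ++ [.a]) n = (n : ℝ)⁻¹ * ∑ j ∈ Finset.range n, cw w j := by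
  simp [cw, exponents_append_a, coefR]

theorem exists_exponents {w : Word} (hw : .a ∈ w) :
    ∃ m r, (exponents w).reverse = m :: r := by
  cases h : (exponents w).reverse with
  | nil =>
    have := (exponents_eq_nil_iff w).1 (List.reverse_eq_nil_iff.1 h) _ hw
    exact absurd this (by simp)
  | cons m r => exact ⟨m, r, rfl⟩

/-- Together with `cw_append_a` this is the differential equation at the level of coefficients. For
a power of b it would fail at n = 0, where the coefficient is 1 but the right-hand side is 0. -/
theorem cw_append_b {w : Word} (hw : .a ∈ w) (n : ℕ) :
    cw (w ++ [.b]) n = (n : ℝ)⁻¹ * cw w n := by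
  obtain ⟨m, r, h⟩ := exists_exponents hw
  simp only [cw, exponents_append_b, h, coefR, pow_succ, mul_inv]
  ring

theorem cw_zero {w : Word} (hw : .a ∈ w) : cw w 0 = 0 := by
  obtain ⟨m, r, h⟩ := exists_exponents hw
  simp [cw, h, coefR]

theorem tendsto_cw {w : Word} (hw : .a ∈ w) :
    Filter.Tendsto (cw w) Filter.atTop (nhds 0) := by
  obtain ⟨m, r, h⟩ := exists_exponents hw
  have h1 := one_le_of_mem_exponents w
  rw [h] at h1
  rw [cw, h]
  exact tendsto_coefR m r (h1 m (by simp)) fun k hk => h1 k (by simp [hk])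

theorem summable_cw_append_b {w : Word} (hw : .a ∈ w) : Summable (cw (w ++ [.b])) := by
  obtain ⟨m, r, h⟩ := exists_exponents hw
  have h1 := one_le_of_mem_exponents w
  rw [h] at h1
  simp only [cw, exponents_append_b, h]
  have := h1 m (by simp)
  exact summable_coefR _ _ (by omega) fun k hk => h1 k (by simp [hk])

/-! ### The differential equation for the series -/

theorem hasDerivAt_tsum_powerSeries {c : ℕ → ℂ} (hc : ∀ n, ‖c n‖ ≤ 1) {z : ℂ} (hz : ‖z‖ < 1) :
    HasDerivAt (fun z => ∑' n, c n * z ^ n) (∑' n : ℕ, ((n + 1 : ℕ) * c (n + 1)) * z ^ n) z := by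
  obtain ⟨r, hr, hr1⟩ := exists_between hz
  have hr0 : 0 ≤ r := (norm_nonneg z).trans hr.le
  have hs : Summable fun n : ℕ => (n : ℝ) * r ^ (n - 1) := by
    rw [← summable_nat_add_iff 1]
    have h1 := summable_pow_mul_geometric_of_norm_lt_one (R := ℝ) 1
      (r := r) (by rwa [Real.norm_of_nonneg hr0])
    have h2 := summable_geometric_of_lt_one hr0 hr1
    refine (h1.add h2).congr fun n => ?_
    simp
    ring
  have hb : ∀ n, ∀ y ∈ Metric.ball (0 : ℂ) r, ‖c n * (n * y ^ (n - 1))‖ ≤ n * r ^ (n - 1) := by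
    intro n y hy
    rw [mem_ball_zero_iff] at hy
    rw [norm_mul, norm_mul, norm_pow, Complex.norm_natCast]
    refine (mul_le_of_le_one_left (by positivity) (hc n)).trans ?_
    exact mul_le_mul_of_nonneg_left (pow_le_pow_left₀ (norm_nonneg _) hy.le _) (by positivity)
  have hz' : z ∈ Metric.ball (0 : ℂ) r := by rwa [mem_ball_zero_iff]
  have h0 : (0 : ℂ) ∈ Metric.ball (0 : ℂ) r := by
    rw [mem_ball_zero_iff, norm_zero]
    exact (norm_nonneg z).trans_lt hr
  have hd := hasDerivAt_tsum_of_isPreconnected (g := fun n z => c n * z ^ n) hs Metric.isOpen_ball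
    (convex_ball (0 : ℂ) r).isPreconnected
    (fun n y _ => (hasDerivAt_pow n y).const_mul (c n)) hb h0
    (summable_of_ne_finset_zero (s := {0}) fun n hn => by
      simp [zero_pow (by simpa using hn : n ≠ 0)]) hz'
  refine hd.congr_deriv ?_
  have hsum : Summable fun n : ℕ => c n * (n * z ^ (n - 1)) :=
    Summable.of_norm_bounded hs fun n => hb n z hz'
  rw [hsum.tsum_eq_zero_add]
  simp only [Nat.cast_zero, zero_mul, mul_zero, zero_add, Nat.add_sub_cancel]
  exact tsum_congr fun n => by ring

theorem summable_cw_mul (w : Word) {z : ℂ} (hz : ‖z‖ < 1) :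
    Summable fun n => (cw w n : ℂ) * z ^ n := by
  refine Summable.of_norm ((summable_cw (norm_nonneg z) hz w).congr fun n => ?_)
  rw [norm_mul, norm_pow, Complex.norm_real, Real.norm_of_nonneg (cw_nonneg _ _)]

theorem hasDerivAt_polylogSeries (w : Word) {z : ℂ} (hz : ‖z‖ < 1) :
    HasDerivAt (polylogSeries w) (∑' n : ℕ, ((n + 1 : ℕ) * (cw w (n + 1) : ℂ)) * z ^ n) z := by
  refine (hasDerivAt_tsum_powerSeries (c := fun n => (cw w n : ℂ)) (fun n => ?_)
    hz).congr_of_eventuallyEq ?_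
  · rw [Complex.norm_real, Real.norm_of_nonneg (cw_nonneg _ _)]
    exact cw_le_one w n
  · filter_upwards [Metric.isOpen_ball.mem_nhds (mem_ball_zero_iff.2 hz)] with y hy
    exact polylogSeries_eq_tsum w (mem_ball_zero_iff.1 hy)

/-- The coefficients of the derivative are the partial sums of those of w, and the generating
function of partial sums is the original one divided by 1 - z. -/
theorem hasDerivAt_polylogSeries_append_a (w : Word) {z : ℂ} (hz : ‖z‖ < 1) :
    HasDerivAt (polylogSeries (w ++ [.a])) ((1 - z)⁻¹ * polylogSeries w z) z := by
  convert hasDerivAt_polylogSeries (w ++ [.a]) hz using 1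
  have h1 : (1 - z) ≠ 0 := by
    intro h
    rw [← sub_eq_zero.1 h, norm_one] at hz
    exact lt_irrefl _ hz
  have hc : ∀ n : ℕ, ((n + 1 : ℕ) * (cw (w ++ [.a]) (n + 1) : ℂ)) =
      ((∑ j ∈ Finset.range (n + 1), cw w j : ℝ) : ℂ) := by
    intro n
    rw [cw_append_a, Complex.ofReal_mul, ← mul_assoc]
    have : ((n + 1 : ℕ) : ℂ) ≠ 0 := by exact_mod_cast n.succ_ne_zero
    push_cast at this ⊢
    rw [mul_inv_cancel₀ this, one_mul]
  simp only [hc]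
  set s : ℕ → ℂ := fun n => ((∑ j ∈ Finset.range n, cw w j : ℝ) : ℂ) with hs
  have hle : ∀ n, ‖s n‖ ≤ n := by
    intro n
    rw [hs, Complex.norm_real, Real.norm_of_nonneg (Finset.sum_nonneg fun j _ => cw_nonneg w j)]
    refine (Finset.sum_le_sum fun j _ => cw_le_one w j).trans ?_
    simp
  have hs0 : Summable fun n => s n * z ^ n := by
    have := summable_norm_pow_mul_geometric_of_norm_lt_one (R := ℂ) 1 hz
    refine Summable.of_norm_bounded this fun n => ?_
    rw [norm_mul, norm_mul, pow_one, Complex.norm_natCast]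
    exact mul_le_mul_of_nonneg_right (hle n) (norm_nonneg _)
  have hs1 : Summable fun n => s (n + 1) * z ^ n := by
    refine (hs0.add (summable_cw_mul w hz)).congr fun n => ?_
    simp only [hs, Finset.sum_range_succ]
    push_cast
    ring
  have e : (1 - z) * ∑' n, s (n + 1) * z ^ n = polylogSeries w z := by
    have e1 : z * ∑' n, s (n + 1) * z ^ n = ∑' n, s n * z ^ n := by
      rw [hs0.tsum_eq_zero_add, ← tsum_mul_left]
      simp only [hs, Finset.sum_range_zero, Complex.ofReal_zero, zero_mul, zero_add]
      exact tsum_congr fun n => by ring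
    rw [sub_mul, one_mul, e1, ← hs1.tsum_sub hs0, polylogSeries_eq_tsum w hz]
    refine tsum_congr fun n => ?_
    simp only [hs, Finset.sum_range_succ]
    push_cast
    ring
  rw [← e, inv_mul_cancel_left₀ h1]

/-- Differentiation cancels the factor 1/n, and division by z is harmless since a word containing a
has constant coefficient 0. -/
theorem hasDerivAt_polylogSeries_append_b {w : Word} (hw : .a ∈ w) {z : ℂ} (hz : ‖z‖ < 1)
    (hz0 : z ≠ 0) :
    HasDerivAt (polylogSeries (w ++ [.b])) (z⁻¹ * polylogSeries w z) z := by
  convert hasDerivAt_polylogSeries (w ++ [.b]) hz using 1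
  have hc : ∀ n : ℕ, ((n + 1 : ℕ) * (cw (w ++ [.b]) (n + 1) : ℂ)) = cw w (n + 1) := by
    intro n
    rw [cw_append_b hw, Complex.ofReal_mul, ← mul_assoc]
    have : ((n + 1 : ℕ) : ℂ) ≠ 0 := by exact_mod_cast n.succ_ne_zero
    push_cast at this ⊢
    rw [mul_inv_cancel₀ this, one_mul]
  simp only [hc]
  rw [polylogSeries_eq_tsum w hz, (summable_cw_mul w hz).tsum_eq_zero_add, cw_zero hw]
  simp only [Complex.ofReal_zero, zero_mul, zero_add]
  rw [← tsum_mul_left]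
  refine tsum_congr fun n => ?_
  field_simp
  ring

theorem norm_polylogSeries_le {w : Word} (hw : .a ∈ w) {z : ℂ} (hz : ‖z‖ ≤ 1 / 2) :
    ‖polylogSeries w z‖ ≤ 2 * ‖z‖ := by
  have hz1 : ‖z‖ < 1 := by linarith
  rw [polylogSeries_eq_tsum w hz1, (summable_cw_mul w hz1).tsum_eq_zero_add, cw_zero hw]
  simp only [Complex.ofReal_zero, zero_mul, zero_add]
  have h := ((hasSum_geometric_of_lt_one (norm_nonneg z) hz1).mul_left ‖z‖)
  refine (tsum_of_norm_bounded h fun n => ?_).trans ?_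
  · rw [norm_mul, norm_pow, Complex.norm_real, Real.norm_of_nonneg (cw_nonneg _ _), pow_succ']
    exact mul_le_of_le_one_left (by positivity) (cw_le_one _ _)
  · rw [mul_comm]
    refine mul_le_mul_of_nonneg_right ?_ (norm_nonneg z)
    rw [inv_le_comm₀ (by linarith) (by norm_num)]
    linarith

/-! ### The differential equation for polylogarithms -/

/-- The linear extension of the polylogarithmic series. -/
noncomputable def seriesL (z : ℂ) : H →ₗ[ℚ] ℂ := linExt fun w => polylogSeries w z

/-- The coefficients of the forms `dz / (1 - z)` and `dz / z`. -/
noncomputable def om (x : Letter) (z : ℂ) : ℂ :=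
  match x with
  | .a => (1 - z)⁻¹
  | .b => z⁻¹

theorem hasDerivAt_linear {F G : ℂ → H →ₗ[ℚ] ℂ} {z : ℂ} (A : H →ₗ[ℚ] H) (c : ℂ)
    (hw : ∀ w, HasDerivAt (fun z => F z (A (word w))) (c * G z (word w)) z) (h : H) :
    HasDerivAt (fun z => F z (A h)) (c * G z h) z := by
  induction h using Finsupp.induction_linear with
  | zero => simpa using hasDerivAt_const z (0 : ℂ)
  | add f g hf hg =>
    simp only [map_add, mul_add]
    exact hf.add hg
  | single w r =>
    have e : (Finsupp.single w r : H) = r • word w := by simp [word]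
    rw [e]
    simp only [map_smul, Rat.smul_def]
    have := (hw w).const_mul (r : ℂ)
    refine this.congr_deriv ?_
    ring

theorem seriesL_word (z : ℂ) (w : Word) : seriesL z (word w) = polylogSeries w z := linExt_word _ _

theorem hasDerivAt_seriesL (x : Letter) (h : H) {z : ℂ} (hz : ‖z‖ < 1) (hz0 : z ≠ 0) :
    HasDerivAt (fun z => seriesL z (consL .a (snocL x h)))
      (om x z * seriesL z (consL .a h)) z := by
  refine hasDerivAt_linear (G := fun z => seriesL z ∘ₗ consL .a) (consL .a ∘ₗ snocL x) _
    (fun w => ?_) h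
  simp only [LinearMap.comp_apply, snocL_word, consL_word, seriesL_word]
  cases x
  · exact hasDerivAt_polylogSeries_append_a (.a :: w) hz
  · exact hasDerivAt_polylogSeries_append_b (w := .a :: w) (by simp) hz hz0

/-- The series attached to `a (bⁿ * v)`. -/
noncomputable def seriesB (n : ℕ) (v : Word) (z : ℂ) : ℂ :=
  seriesL z (consL .a (shW (List.replicate n .b) v))

/-- The sequence that starts with `0` and goes on with the values of `f`. -/
def shiftR (f : ℕ → ℂ) : ℕ → ℂ
  | 0 => 0
  | n + 1 => f n

/-- Moving the shift from one factor to the other changes the sign, so the terms cancel in pairs. In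
the expansion of L for a word b^n a v, this cancels the derivatives of the powers of the logarithm
against those of the letters b shuffled into v. -/
theorem sum_antidiagonal_shiftR (T l : ℕ → ℂ) (n : ℕ) :
    ∑ p ∈ Finset.HasAntidiagonal.antidiagonal n,
      (-1) ^ p.1 * (shiftR T p.1 * l p.2 + T p.1 * shiftR l p.2) = 0 := by
  cases n with
  | zero => simp [shiftR]
  | succ n =>
    simp only [mul_add, Finset.sum_add_distrib]
    rw [Finset.Nat.sum_antidiagonal_succ, Finset.Nat.sum_antidiagonal_succ']
    simp only [shiftR, zero_mul, mul_zero, zero_add]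
    rw [← Finset.sum_add_distrib]
    refine Finset.sum_eq_zero fun p _ => ?_
    ring

/-- The last letter of an interleaving of b^n and v x is either the x, leaving b^n * v, or a b,
leaving b^(n-1) * v x; the latter is absent for n = 0, whence `shiftR`. -/
theorem hasDerivAt_seriesB (n : ℕ) (v : Word) (x : Letter) {z : ℂ} (hz : ‖z‖ < 1) (hz0 : z ≠ 0) :
    HasDerivAt (seriesB n (v ++ [x]))
      (om x z * seriesB n v z + z⁻¹ * shiftR (fun m => seriesB m (v ++ [x]) z) n) z := by
  cases n with
  | zero =>
    have := hasDerivAt_seriesL x (word v) hz hz0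
    have e : seriesB 0 (v ++ [x]) = fun z => seriesL z (consL .a (snocL x (word v))) := by
      funext y
      simp [seriesB]
    rw [e]
    simpa [seriesB, shiftR] using this
  | succ n =>
    have := (hasDerivAt_seriesL x (shW (List.replicate (n + 1) .b) v) hz hz0).add
      (hasDerivAt_seriesL .b (shW (List.replicate n .b) (v ++ [x])) hz hz0)
    refine this.congr_of_eventuallyEq (Filter.Eventually.of_forall fun y => ?_)
    simp only [seriesB, List.replicate_succ' (n := n), shW_snoc, map_add, Pi.add_apply]
    ring

theorem hasDerivAt_seriesB_nil (n : ℕ) {z : ℂ} (hz : ‖z‖ < 1) (hz0 : z ≠ 0) :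
    HasDerivAt (seriesB n [])
      ((if n = 0 then (1 - z)⁻¹ else 0) + z⁻¹ * shiftR (fun m => seriesB m [] z) n) z := by
  cases n with
  | zero =>
    have := hasDerivAt_polylogSeries_append_a [] hz
    have e : polylogSeries [] z = 1 := by
      rw [polylogSeries_eq_tsum _ hz, tsum_eq_single 0]
      · simp [cw_nil]
      · intro n hn
        simp [cw_nil, hn]
    rw [e, mul_one] at this
    have e : seriesB 0 [] = polylogSeries ([] ++ [.a]) := by
      funext y
      simp [seriesB, seriesL_word]
    rw [e]
    simpa [shiftR] using this
  | succ n =>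
    have := hasDerivAt_seriesL .b (word (List.replicate n .b)) hz hz0
    have e : seriesB (n + 1) [] =
        fun z => seriesL z (consL .a (snocL .b (word (List.replicate n .b)))) := by
      funext y
      simp [seriesB, List.replicate_succ' (n := n)]
    rw [e]
    simpa [seriesB, shiftR, om] using this

/-- The function `log(z)^k / k!`. -/
noncomputable def logPow (k : ℕ) (z : ℂ) : ℂ := Complex.log z ^ k / k.factorial

theorem hasDerivAt_logPow (k : ℕ) {z : ℂ} (hz : z ∈ Complex.slitPlane) :
    HasDerivAt (logPow k) (z⁻¹ * shiftR (fun m => logPow m z) k) z := by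
  cases k with
  | zero =>
    have : logPow 0 = fun _ => 1 := by
      funext z
      simp [logPow]
    rw [this]
    simpa [shiftR] using hasDerivAt_const z (1 : ℂ)
  | succ k =>
    have := ((Complex.hasDerivAt_log hz).pow (k + 1)).div_const ((k + 1).factorial : ℂ)
    refine HasDerivAt.congr_deriv this ?_
    have h1 : ((k : ℂ) + 1) ≠ 0 := by exact_mod_cast k.succ_ne_zero
    have h2 : (k.factorial : ℂ) ≠ 0 := by exact_mod_cast k.factorial_ne_zero
    simp only [shiftR, logPow, Nat.factorial_succ, Nat.add_sub_cancel]
    push_cast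
    field_simp

theorem word_cases (w : Word) :
    (∃ n, w = List.replicate n .b) ∨ ∃ n v, w = List.replicate n .b ++ .a :: v := by
  induction w with
  | nil => exact Or.inl ⟨0, rfl⟩
  | cons x w ih =>
    cases x
    · exact Or.inr ⟨0, w, rfl⟩
    · rcases ih with ⟨n, rfl⟩ | ⟨n, v, rfl⟩
      · exact Or.inl ⟨n + 1, rfl⟩
      · exact Or.inr ⟨n + 1, v, rfl⟩

theorem polylog_replicate (z : ℂ) (n : ℕ) :
    polylog z (word (List.replicate n .b)) = logPow n z := by
  have hd : (List.replicate n Letter.b).dropWhile (· = .b) = [] := by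
    rw [List.dropWhile_eq_nil_iff]
    intro x hx
    simpa using List.eq_of_mem_replicate hx
  rw [polylog, linExt_word, Finset.sum_eq_single n]
  -- Here z is arbitrary, so the value is read off from the one-element index set and not from the
  -- power series on the disc.
  · have : polylogSeries [] z = 1 := by
      have h0 : ∀ c : Chain (exponents []).length, c = ⟨Fin.elim0, fun i => i.elim0,
        fun i => i.elim0⟩ := fun c => Subtype.ext (Subsingleton.elim (α := Fin 0 → ℕ) _ _)
      rw [polylogSeries, tsum_eq_single _ fun c hc => absurd (h0 c) hc]
      have : IsEmpty (Fin (exponents []).length) := Fin.isEmpty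
      rw [Finset.univ_eq_empty, Finset.prod_empty, Finset.sup_empty]
      simp
    rw [stripFirst_word, stripW, hd]
    simp [linExt_word, this, logPow]
  · intro k _ hk
    rw [stripFirst_word, stripW, hd]
    simp [Ne.symm hk]
  · simp

theorem polylog_replicate_append (z : ℂ) (n : ℕ) (v : Word) :
    polylog z (word (List.replicate n .b ++ .a :: v)) =
      ∑ p ∈ Finset.HasAntidiagonal.antidiagonal n, (-1) ^ p.1 * (seriesB p.1 v z * logPow p.2 z) := by
  have ht : (List.replicate n Letter.b ++ .a :: v).takeWhile (· = .b) = List.replicate n .b := by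
    rw [List.takeWhile_append_of_pos]
    · simp
    · intro x hx
      simpa using List.eq_of_mem_replicate hx
  have hd : (List.replicate n Letter.b ++ .a :: v).dropWhile (· = .b) = .a :: v := by
    rw [List.dropWhile_append_of_pos]
    · simp
    · intro x hx
      simpa using List.eq_of_mem_replicate hx
  have hs : ∀ k, stripFirst .b k (word (List.replicate n .b ++ .a :: v)) =
      if k ≤ n then (-1 : ℚ) ^ (n - k) • consL .a (shW (List.replicate (n - k) .b) v) else 0 := by
    intro k
    rw [stripFirst_word, stripW, hd, ht]
    simp
  rw [← Finset.Nat.sum_antidiagonal_swap, Finset.Nat.sum_antidiagonal_eq_sum_range_succ_mk, polylog,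
    linExt_word]
  have hl : n.succ ≤ (List.replicate n Letter.b ++ .a :: v).length + 1 := by
    simp
  rw [← Finset.sum_subset (Finset.range_mono hl)]
  · refine Finset.sum_congr rfl fun k hk => ?_
    have hk : k ≤ n := Nat.lt_succ_iff.1 (Finset.mem_range.1 hk)
    rw [hs, if_pos hk, map_smul, Rat.smul_def]
    simp only [Prod.swap, seriesB, seriesL, logPow]
    push_cast
    rw [mul_assoc]
  · intro k _ hk
    have hk : ¬ k ≤ n := fun h => hk (Finset.mem_range.2 (Nat.lt_succ_iff.2 h))
    rw [hs, if_neg hk, map_zero, zero_mul]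

theorem Omega_ne_zero {z : ℂ} (hz : z ∈ Omega) : z ≠ 0 := Complex.slitPlane_ne_zero hz.2

/-- The differential equation dL = L·ω. For a word b^n a v it is the product rule in the expansion
by powers of log z, the shifted terms cancelling by `sum_antidiagonal_shiftR`. For b^n followed by a
only the summand without b in the series yields the form dz/(1 - z), and for b^n followed by b it is
the derivative of a power of the logarithm. -/
theorem hasDerivAt_polylog_word (w : Word) (x : Letter) {z : ℂ} (hz : z ∈ Omega) :
    HasDerivAt (fun z => polylog z (word (w ++ [x]))) (om x z * polylog z (word w)) z := by
  have hz0 := Omega_ne_zero hz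
  rcases word_cases w with ⟨n, rfl⟩ | ⟨n, v, rfl⟩
  · cases x
    · simp only [polylog_replicate_append, polylog_replicate]
      have := HasDerivAt.fun_sum fun p (_ : p ∈ Finset.HasAntidiagonal.antidiagonal n) =>
        ((hasDerivAt_seriesB_nil p.1 hz.1 hz0).mul (hasDerivAt_logPow p.2 hz.2)).const_mul
          ((-1) ^ p.1 : ℂ)
      refine this.congr_deriv ?_
      have e := sum_antidiagonal_shiftR (fun m => seriesB m [] z) (fun m => logPow m z) n
      have e' : ∑ p ∈ Finset.HasAntidiagonal.antidiagonal n,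
          (-1) ^ p.1 * ((if p.1 = 0 then (1 - z)⁻¹ else 0) * logPow p.2 z) =
            (1 - z)⁻¹ * logPow n z := by
        rw [Finset.sum_eq_single (0, n)]
        · simp
        · rintro ⟨i, j⟩ hp hne
          rw [Finset.HasAntidiagonal.mem_antidiagonal] at hp
          have : i ≠ 0 := by
            rintro rfl
            apply hne
            simpa using hp
          simp [this]
        · intro h
          exact absurd (by simp) h
      refine Eq.trans ?_ ((congrArg₂ (fun s t => s + z⁻¹ * t) e' e).trans (by simp [om]))
      rw [Finset.mul_sum, ← Finset.sum_add_distrib]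
      exact Finset.sum_congr rfl fun p _ => by ring
    · rw [← List.replicate_succ']
      simp only [polylog_replicate]
      exact hasDerivAt_logPow (n + 1) hz.2
  · rw [List.append_assoc, List.cons_append]
    simp only [polylog_replicate_append]
    have := HasDerivAt.fun_sum fun p (_ : p ∈ Finset.HasAntidiagonal.antidiagonal n) =>
      ((hasDerivAt_seriesB p.1 v x hz.1 hz0).mul (hasDerivAt_logPow p.2 hz.2)).const_mul
        ((-1) ^ p.1 : ℂ)
    refine this.congr_deriv ?_
    have e := sum_antidiagonal_shiftR (fun m => seriesB m (v ++ [x]) z) (fun m => logPow m z) n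
    rw [← add_zero (om x z * _), ← mul_zero z⁻¹, ← e, Finset.mul_sum, Finset.mul_sum,
      ← Finset.sum_add_distrib]
    exact Finset.sum_congr rfl fun p _ => by ring

theorem hasDerivAt_polylog (x : Letter) (h : H) {z : ℂ} (hz : z ∈ Omega) :
    HasDerivAt (fun z => polylog z (snocL x h)) (om x z * polylog z h) z :=
  hasDerivAt_linear (snocL x) _
    (fun w => by simpa only [snocL_word] using hasDerivAt_polylog_word w x hz) h

theorem polylog_nil (z : ℂ) : polylog z (word []) = 1 := by
  simpa [logPow] using polylog_replicate z 0

theorem polylog_cons_a (z : ℂ) (v : Word) :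
    polylog z (word (.a :: v)) = polylogSeries (.a :: v) z := by
  have := polylog_replicate_append z 0 v
  simpa [seriesB, seriesL_word, logPow] using this

/-! ### Behaviour at the origin and multiplicativity -/

theorem isOpen_Omega : IsOpen Omega :=
  (isOpen_lt continuous_norm continuous_const).inter Complex.isOpen_slitPlane

theorem isPreconnected_Omega : IsPreconnected Omega := by
  have h : StarConvex ℝ ((1 / 2 : ℝ) : ℂ) Omega := by
    have h1 := (convex_ball (0 : ℂ) 1).starConvex (x := ((1 / 2 : ℝ) : ℂ))
      (by rw [mem_ball_zero_iff, Complex.norm_real]; norm_num)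
    have h2 := h1.inter (Complex.starConvex_ofReal_slitPlane (x := 1 / 2) (by norm_num))
    have e : Omega = Metric.ball 0 1 ∩ Complex.slitPlane := by
      ext z
      simp [Omega]
    rwa [e]
  refine (h.isPathConnected ⟨?_, ?_⟩).isConnected.isPreconnected
  · rw [Complex.norm_real]; norm_num
  · exact Complex.ofReal_mem_slitPlane.2 (by norm_num)

open Filter Topology

theorem eventually_ofReal_mem_Omega : ∀ᶠ t : ℝ in 𝓝[>] 0, (t : ℂ) ∈ Omega := by
  filter_upwards [Ioo_mem_nhdsGT (show (0 : ℝ) < 1 by norm_num)] with t ht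
  refine ⟨?_, Complex.ofReal_mem_slitPlane.2 ht.1⟩
  rw [Complex.norm_real, Real.norm_of_nonneg ht.1.le]
  exact ht.2

theorem tendsto_mul_log_pow (k : ℕ) :
    Tendsto (fun t : ℝ => t * |Real.log t| ^ k) (𝓝[>] 0) (𝓝 0) := by
  have h := (isLittleO_abs_log_rpow_rpow_nhdsGT_zero (s := -1) k (by norm_num)).tendsto_div_nhds_zero
  refine h.congr' ?_
  filter_upwards [self_mem_nhdsWithin] with t ht
  rw [Real.rpow_neg_one, Real.rpow_natCast, div_inv_eq_mul, mul_comm]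

theorem tendsto_seriesL_mul_log (h : H) (k : ℕ) :
    Tendsto (fun t : ℝ => seriesL t (consL .a h) * Complex.log t ^ k) (𝓝[>] 0) (𝓝 0) := by
  induction h using Finsupp.induction_linear with
  | zero => simp
  | add f g hf hg =>
    have := hf.add hg
    rw [add_zero] at this
    refine this.congr fun t => ?_
    rw [map_add, map_add, add_mul]
  | single w r =>
    have e : (Finsupp.single w r : H) = r • word w := by simp [word]
    have h1 : Tendsto (fun t : ℝ => |(r : ℝ)| * 2 * (t * |Real.log t| ^ k)) (𝓝[>] 0) (𝓝 0) := by
      have := (tendsto_mul_log_pow k).const_mul (|(r : ℝ)| * 2)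
      rwa [mul_zero] at this
    refine squeeze_zero_norm' ?_ h1
    filter_upwards [Ioo_mem_nhdsGT (show (0 : ℝ) < 1 / 2 by norm_num)] with t ht
    rw [e, map_smul, map_smul, consL_word, seriesL_word, Rat.smul_def, norm_mul, norm_mul, norm_pow,
      ← Complex.ofReal_log ht.1.le, Complex.norm_real, Real.norm_eq_abs]
    have ht' : ‖(t : ℂ)‖ = t := by rw [Complex.norm_real, Real.norm_of_nonneg ht.1.le]
    have h2 := norm_polylogSeries_le (w := .a :: w) (by simp) (z := t) (by rw [ht']; exact ht.2.le)
    rw [ht'] at h2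
    have h3 : ‖(r : ℂ)‖ = |(r : ℝ)| := by
      rw [← Complex.ofReal_ratCast, Complex.norm_real, Real.norm_eq_abs]
    rw [h3]
    have h4 : 0 ≤ |Real.log t| ^ k := by positivity
    calc _ ≤ |(r : ℝ)| * (2 * t) * |Real.log t| ^ k := by gcongr
      _ = _ := by ring

/-- The difference between the polylogarithm and its leading behaviour at the origin. -/
theorem tendsto_polylog_sub_mul_log (h : H) (k : ℕ) :
    Tendsto (fun t : ℝ => (polylog t h - linExt (expW .b (Complex.log t)) h) *
      Complex.log t ^ k) (𝓝[>] 0) (𝓝 0) := by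
  induction h using Finsupp.induction_linear with
  | zero => simp
  | add f g hf hg =>
    have := hf.add hg
    rw [add_zero] at this
    refine this.congr fun t => ?_
    simp only [map_add]
    ring
  | single w r =>
    have e : (Finsupp.single w r : H) = r • word w := by simp [word]
    suffices hw : Tendsto (fun t : ℝ => (polylog t (word w) -
        linExt (expW .b (Complex.log t)) (word w)) * Complex.log t ^ k) (𝓝[>] 0) (𝓝 0) by
      have := hw.const_mul (r : ℂ)
      rw [mul_zero] at this
      refine this.congr fun t => ?_
      rw [e, map_smul, map_smul, Rat.smul_def, Rat.smul_def]
      ring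
    -- On powers of b the two functions coincide. On other words the leading term is 0, and each
    -- summand of the polylogarithm contains a series that starts with a, which is O(t) and absorbs
    -- every power of log t.
    rcases word_cases w with ⟨n, rfl⟩ | ⟨n, v, rfl⟩
    · simp [polylog_replicate, linExt_word, expW_replicate, logPow]
    · have h0 : ∀ t : ℂ, expW .b (Complex.log t) (List.replicate n .b ++ .a :: v) = 0 := by
        intro t
        rw [expW, if_neg]
        intro h
        have := (List.eq_replicate_iff.1 h).2 .a (by simp)
        exact absurd this (by simp)
      have h1 : Tendsto (fun t : ℝ => ∑ p ∈ Finset.HasAntidiagonal.antidiagonal n,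
          (-1 : ℂ) ^ p.1 * (p.2.factorial : ℂ)⁻¹ *
            (seriesL t (consL .a (shW (List.replicate p.1 .b) v)) * Complex.log t ^ (p.2 + k)))
          (𝓝[>] 0) (𝓝 (∑ p ∈ Finset.HasAntidiagonal.antidiagonal n,
            (-1 : ℂ) ^ p.1 * (p.2.factorial : ℂ)⁻¹ * 0)) :=
        tendsto_finsetSum _ fun p _ => (tendsto_seriesL_mul_log _ _).const_mul _
      simp only [mul_zero, Finset.sum_const_zero] at h1
      refine h1.congr fun t => ?_
      rw [linExt_word, h0, sub_zero, polylog_replicate_append, Finset.sum_mul]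
      refine Finset.sum_congr rfl fun p _ => ?_
      simp only [seriesB, logPow]
      ring

/-- Near the origin L(t) is exp(β log t) up to an error that stays negligible after multiplication
with any power of log t. Since the exponential is group-like, multiplicativity holds in the limit;
the extra powers are needed for the cross terms `key`. -/
theorem tendsto_polylog_mul_sub (u v : Word) :
    Tendsto (fun t : ℝ => polylog t (word u) * polylog t (word v) - polylog t (shW u v))
      (𝓝[>] 0) (𝓝 0) := by
  have key : ∀ u v : Word, Tendsto (fun t : ℝ => (polylog t (word u) -
      linExt (expW .b (Complex.log t)) (word u)) * linExt (expW .b (Complex.log t)) (word v))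
      (𝓝[>] 0) (𝓝 0) := by
    intro u v
    by_cases hv : v = List.replicate v.length .b
    · have := (tendsto_polylog_sub_mul_log (word u) v.length).mul_const
        ((v.length.factorial : ℂ)⁻¹)
      rw [zero_mul] at this
      refine this.congr fun t => ?_
      rw [linExt_word _ v, expW, if_pos hv]
      ring
    · have : ∀ t : ℝ, linExt (expW .b (Complex.log t)) (word v) = 0 := by
        intro t
        rw [linExt_word, expW, if_neg hv]
      simp [this]
  have rem : ∀ h : H, Tendsto (fun t : ℝ => polylog t h -
      linExt (expW .b (Complex.log t)) h) (𝓝[>] 0) (𝓝 0) := by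
    intro h
    simpa using tendsto_polylog_sub_mul_log h 0
  have := (((key u v).add (key v u)).add ((rem (word u)).mul (rem (word v)))).sub (rem (shW u v))
  simp only [mul_zero, add_zero, sub_zero] at this
  refine this.congr fun t => ?_
  have e : linExt (expW .b (Complex.log t)) (shW u v) =
      linExt (expW .b (Complex.log t)) (word u) * linExt (expW .b (Complex.log t)) (word v) := by
    rw [linExt_word, linExt_word]
    exact expW_shW .b (Complex.log t) u v
  rw [e]
  ring

/-- By the recursion of the shuffle product through last letters and induction on the total length,
the difference of the two sides has derivative 0 on the connected set `Omega`, and it tends to 0 at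
the origin. -/
theorem polylog_shW (u v : Word) {z : ℂ} (hz : z ∈ Omega) :
    polylog z (shW u v) = polylog z (word u) * polylog z (word v) := by
  suffices H : ∀ n, ∀ u v : Word, u.length + v.length = n → ∀ z ∈ Omega,
      polylog z (shW u v) = polylog z (word u) * polylog z (word v) from H _ u v rfl z hz
  intro n
  induction n using Nat.strong_induction_on with
  | _ n ih =>
    intro u v hn z hz
    rcases List.eq_nil_or_concat' u with rfl | ⟨u, x, rfl⟩
    · rw [shW_nil_left, polylog_nil, one_mul]
    rcases List.eq_nil_or_concat' v with rfl | ⟨v, y, rfl⟩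
    · rw [shW_nil_right, polylog_nil, mul_one]
    simp only [List.length_append, List.length_singleton] at hn
    let F : ℂ → ℂ := fun z => polylog z (word (u ++ [x])) * polylog z (word (v ++ [y])) -
      polylog z (shW (u ++ [x]) (v ++ [y]))
    have hF : ∀ z ∈ Omega, HasDerivAt F 0 z := by
      intro z hz
      have h1 := ((hasDerivAt_polylog_word u x hz).mul (hasDerivAt_polylog_word v y hz)).sub
        ((hasDerivAt_polylog x (shW u (v ++ [y])) hz).add
          (hasDerivAt_polylog y (shW (u ++ [x]) v) hz))
      rw [ih _ (by simp; omega) u (v ++ [y]) rfl z hz,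
        ih _ (by simp; omega) (u ++ [x]) v rfl z hz] at h1
      refine (h1.congr_deriv (by ring)).congr_of_eventuallyEq
        (Filter.Eventually.of_forall fun t => ?_)
      simp only [F, shW_snoc, map_add, Pi.sub_apply, Pi.add_apply, Pi.mul_apply]
    have hc : ∀ t ∈ Omega, F t = F z := fun t ht =>
      isOpen_Omega.is_const_of_deriv_eq_zero isPreconnected_Omega
        (fun w hw => (hF w hw).differentiableAt.differentiableWithinAt)
        (fun w hw => (hF w hw).deriv) ht hz
    have h1 : Tendsto (fun t : ℝ => F t) (𝓝[>] 0) (𝓝 (F z)) :=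
      tendsto_const_nhds.congr' (eventually_ofReal_mem_Omega.mono fun t ht => (hc t ht).symm)
    have h2 := tendsto_nhds_unique h1 (tendsto_polylog_mul_sub (u ++ [x]) (v ++ [y]))
    exact (sub_eq_zero.1 h2).symm

/-- The polylogarithms at `z` form a morphism for the shuffle product. -/
theorem polylog_shuffle {z : ℂ} (hz : z ∈ Omega) (h k : H) :
    polylog z (shuffle h k) = polylog z h * polylog z k := by
  have : shuffle.compr₂ (polylog z) =
      (LinearMap.mul ℚ ℂ).compl₁₂ (polylog z) (polylog z) :=
    H_ext₂ fun u v => by simp [polylog_shW u v hz]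
  simpa using congrArg (fun F => F h k) this

/-! ### Products of transports along paths -/

/-- The coefficients of the product of two series with complex coefficients. -/
noncomputable def convC (A B : Word → ℂ) (w : Word) : ℂ :=
  ∑ i ∈ Finset.range (w.length + 1), A (w.take i) * B (w.drop i)

/-- If dA = A·ω and dB = -ω·B, then d(A B) = 0. Coefficientwise, differentiating the last letter of
the prefix cancels against differentiating that same letter as the first one of the suffix of the
preceding cut, so the sum over cuts telescopes. -/
theorem hasDerivAt_convC {A B : ℂ → Word → ℂ} {ω : Letter → ℂ} {z : ℂ}
    (hA0 : HasDerivAt (fun z => A z []) 0 z)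
    (hA : ∀ w x, HasDerivAt (fun z => A z (w ++ [x])) (ω x * A z w) z)
    (hB0 : HasDerivAt (fun z => B z []) 0 z)
    (hB : ∀ w x, HasDerivAt (fun z => B z (x :: w)) (-ω x * B z w) z) (w : Word) :
    HasDerivAt (fun z => convC (A z) (B z) w) 0 z := by
  -- The value at i + 1 is the term in which the letter with index i lies in the form ω, between
  -- prefix and suffix; it vanishes at 0 and beyond the length, the two ends of the telescope.
  let g : ℕ → ℂ := fun i => match i with
    | 0 => 0
    | i + 1 => if h : i < w.length then A z (w.take i) * ω w[i] * B z (w.drop (i + 1)) else 0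
  have hg : ∀ i ∈ Finset.range (w.length + 1),
      HasDerivAt (fun z => A z (w.take i) * B z (w.drop i)) (g i - g (i + 1)) z := by
    intro i hi
    have hi : i ≤ w.length := Nat.lt_succ_iff.1 (Finset.mem_range.1 hi)
    obtain ⟨a', ha, ea⟩ : ∃ a', HasDerivAt (fun z => A z (w.take i)) a' z ∧
        a' * B z (w.drop i) = g i := by
      cases i with
      | zero => exact ⟨0, hA0, by simp [g]⟩
      | succ i =>
        have hi' : i < w.length := hi
        rw [List.take_succ_eq_append_getElem hi']
        refine ⟨_, hA _ _, ?_⟩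
        simp only [g, dif_pos hi']
        ring
    obtain ⟨b', hb, eb⟩ : ∃ b', HasDerivAt (fun z => B z (w.drop i)) b' z ∧
        A z (w.take i) * b' = - g (i + 1) := by
      rcases hi.lt_or_eq with hi' | rfl
      · rw [List.drop_eq_getElem_cons hi']
        refine ⟨_, hB _ _, ?_⟩
        simp only [g, dif_pos hi']
        ring
      · rw [List.drop_length]
        exact ⟨0, hB0, by simp [g]⟩
    refine (ha.mul hb).congr_deriv ?_
    rw [ea, eb, sub_eq_add_neg]
  refine (HasDerivAt.fun_sum hg).congr_deriv ?_
  rw [Finset.sum_range_sub']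
  simp [g]

/-- The product of the transport from `0` to `z` with the image under an anti-endomorphism of the
transport from `0` to `y`. -/
noncomputable def transport (f : Letter → Letter → ℚ) (z y : ℂ) (w : Word) : ℂ :=
  convC (fun w => polylog z (word w)) (fun w => polylog y (antiW f w)) w

/-- The hypothesis `hf` says that the pullback by m of the f-transformed forms is -ω. As f reverses
words, the differential equation of L at m(z), which concerns last letters, becomes one for first
letters, as `hasDerivAt_convC` requires. -/
theorem hasDerivAt_transport (f : Letter → Letter → ℚ) {m : ℂ → ℂ} {m' z : ℂ} (hz : z ∈ Omega)
    (hm : m z ∈ Omega) (hd : HasDerivAt m m' z)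
    (hf : ∀ x, m' * ∑ y, (f x y : ℂ) * om y (m z) = -om x z) (w : Word) :
    HasDerivAt (fun z => transport f z (m z) w) 0 z := by
  refine hasDerivAt_convC (A := fun z w => polylog z (word w))
    (B := fun z w => polylog (m z) (antiW f w)) (ω := fun x => om x z) ?_ ?_ ?_ ?_ w
  · simp only [polylog_nil]
    exact hasDerivAt_const z 1
  · exact fun w x => hasDerivAt_polylog_word w x hz
  · simp only [antiW, polylog_nil]
    exact hasDerivAt_const z 1
  · intro w x
    simp only [antiW, map_sum, map_smul, Rat.smul_def]
    have := HasDerivAt.fun_sum fun y (_ : y ∈ Finset.univ) =>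
      ((hasDerivAt_polylog y (antiW f w) hm).comp z hd).const_mul (f x y : ℂ)
    refine this.congr_deriv ?_
    rw [← hf x, Finset.mul_sum, Finset.sum_mul]
    exact Finset.sum_congr rfl fun y _ => by ring

theorem polylog_twistW (f : Letter → Letter → ℚ) {z : ℂ} (hz : z ∈ Omega) (w : Word) :
    polylog z (twistW f w) = transport f z z w := by
  rw [twistW, map_sum, transport, convC]
  exact Finset.sum_congr rfl fun i _ => by rw [polylog_shuffle hz, anti_word]

/-! ### Behaviour at the point `1` -/

theorem tendsto_cw' (w : Word) : Tendsto (cw w) atTop (𝓝 0) := by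
  by_cases hw : .a ∈ w
  · exact tendsto_cw hw
  · have h : exponents w = [] := by
      rw [exponents_eq_nil_iff]
      intro x hx
      cases x
      · exact absurd hx hw
      · rfl
    refine tendsto_const_nhds.congr' ?_
    filter_upwards [eventually_ne_atTop 0] with n hn
    simp [cw, h, coefR, hn]

/-- Abel's theorem: multiplication by 1 - x replaces the coefficients by their differences, whose
partial sums are the coefficients themselves and tend to 0. The resulting growth o(1/(1 - x)) is
enough, as it will be paired with a factor O(|1 - z|). -/
theorem tendsto_one_sub_mul_tsum (w : Word) :
    Tendsto (fun x : ℝ => (1 - x) * ∑' n, cw w n * x ^ n) (𝓝[<] 1) (𝓝 0) := by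
  let f : ℕ → ℝ := fun n => match n with
    | 0 => cw w 0
    | n + 1 => cw w (n + 1) - cw w n
  have hs : ∀ n, ∑ i ∈ Finset.range (n + 1), f i = cw w n := by
    intro n
    induction n with
    | zero => simp [f]
    | succ n ih =>
      rw [Finset.sum_range_succ, ih]
      simp [f]
  have h := Real.tendsto_tsum_powerSeries_nhdsWithin_lt (f := f) (l := 0) (by
    rw [← tendsto_add_atTop_iff_nat 1]
    simpa only [hs] using tendsto_cw' w)
  refine h.congr' ?_
  filter_upwards [Ioo_mem_nhdsLT (show (0 : ℝ) < 1 by norm_num)] with x hx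
  have s0 := summable_cw hx.1.le hx.2 w
  have s1 : Summable fun n => cw w (n + 1) * x ^ (n + 1) := (summable_nat_add_iff 1).2 s0
  have s2 : Summable fun n => cw w n * x ^ (n + 1) :=
    (s0.mul_left x).congr fun n => by ring
  have e : ∀ n, f (n + 1) * x ^ (n + 1) = cw w (n + 1) * x ^ (n + 1) - cw w n * x ^ (n + 1) :=
    fun n => by simp only [f]; ring
  have s3 : Summable fun n => f n * x ^ n := by
    rw [← summable_nat_add_iff 1]
    simp only [e]
    exact s1.sub s2
  have e1 : ∑' n, cw w n * x ^ (n + 1) = x * ∑' n, cw w n * x ^ n := by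
    rw [← tsum_mul_left]
    exact tsum_congr fun n => by ring
  have e2 := s0.tsum_eq_zero_add
  rw [s3.tsum_eq_zero_add]
  simp only [e]
  rw [s1.tsum_sub s2, e1]
  simp only [f]
  linear_combination -e2

theorem norm_polylogSeries_le_tsum (w : Word) {z : ℂ} (hz : ‖z‖ < 1) :
    ‖polylogSeries w z‖ ≤ ∑' n, cw w n * ‖z‖ ^ n := by
  rw [polylogSeries_eq_tsum w hz]
  refine tsum_of_norm_bounded (summable_cw (norm_nonneg z) hz w).hasSum fun n => ?_
  rw [norm_mul, norm_pow, Complex.norm_real, Real.norm_of_nonneg (cw_nonneg _ _)]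

/-- A filter converges to `1` inside a Stolz sector of the unit disc. -/
structure StolzFilter (l : Filter ℂ) : Prop where
  le_nhds : l ≤ 𝓝 1
  sector : ∃ C : ℝ, ∀ᶠ z in l, ‖z‖ < 1 ∧ ‖1 - z‖ ≤ C * (1 - ‖z‖)

theorem StolzFilter.tendsto_mul_polylogSeries {l : Filter ℂ} (hl : StolzFilter l) (w : Word) :
    Tendsto (fun z => ‖1 - z‖ * ‖polylogSeries w z‖) l (𝓝 0) := by
  obtain ⟨C, hC⟩ := hl.sector
  have h1 : Tendsto (fun z : ℂ => ‖z‖) l (𝓝[<] 1) := by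
    rw [tendsto_nhdsWithin_iff]
    refine ⟨?_, hC.mono fun z hz => hz.1⟩
    simpa using (continuous_norm.tendsto (1 : ℂ)).mono_left hl.le_nhds
  have h2 := ((tendsto_one_sub_mul_tsum w).comp h1).const_mul C
  rw [mul_zero] at h2
  refine squeeze_zero' (Eventually.of_forall fun z => by positivity) ?_ h2
  filter_upwards [hC] with z hz
  refine (mul_le_mul hz.2 (norm_polylogSeries_le_tsum w hz.1) (norm_nonneg _)
    ((norm_nonneg _).trans hz.2)).trans (le_of_eq ?_)
  simp only [Function.comp_apply]
  ring

/-- With a final b the coefficients are summable and dominate the series on the whole disc. -/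
theorem StolzFilter.tendsto_polylogSeries {l : Filter ℂ} (hl : StolzFilter l) {w : Word}
    (hw : .a ∈ w) :
    Tendsto (polylogSeries (w ++ [.b])) l (𝓝 (zetaSeries (w ++ [.b]))) := by
  obtain ⟨C, hC⟩ := hl.sector
  have hs := summable_cw_append_b hw
  rw [zetaSeries_eq_tsum _ hs]
  have h := tendsto_tsum_of_dominated_convergence (𝓕 := l)
    (f := fun z n => (cw (w ++ [.b]) n : ℂ) * z ^ n) (g := fun n => (cw (w ++ [.b]) n : ℂ)) hs
    (fun n => by
      have : Tendsto (fun z : ℂ => (cw (w ++ [.b]) n : ℂ) * z ^ n) (𝓝 1)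
          (𝓝 ((cw (w ++ [.b]) n : ℂ) * 1 ^ n)) :=
        Continuous.tendsto (by fun_prop) 1
      rw [one_pow, mul_one] at this
      exact this.mono_left hl.le_nhds)
    (hC.mono fun z hz n => by
      rw [norm_mul, norm_pow, Complex.norm_real, Real.norm_of_nonneg (cw_nonneg _ _)]
      exact mul_le_of_le_one_right (cw_nonneg _ _) (pow_le_one₀ (norm_nonneg z) hz.1.le))
  exact h.congr' (hC.mono fun z hz => (polylogSeries_eq_tsum _ hz.1).symm)

theorem exists_norm_polylog_consL_le (h : H) :
    ∃ C : ℝ, ∀ z : ℂ, ‖z‖ ≤ 1 / 2 → ‖polylog z (consL .a h)‖ ≤ C * ‖z‖ := by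
  induction h using Finsupp.induction_linear with
  | zero => exact ⟨0, fun z _ => by simp⟩
  | add f g hf hg =>
    obtain ⟨C, hC⟩ := hf
    obtain ⟨D, hD⟩ := hg
    refine ⟨C + D, fun z hz => ?_⟩
    rw [map_add, map_add, add_mul]
    exact (norm_add_le _ _).trans (add_le_add (hC z hz) (hD z hz))
  | single w r =>
    have e : (Finsupp.single w r : H) = r • word w := by simp [word]
    refine ⟨‖(r : ℂ)‖ * 2, fun z hz => ?_⟩
    rw [e, map_smul, map_smul, consL_word, polylog_cons_a, Rat.smul_def, norm_mul, mul_assoc]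
    exact mul_le_mul_of_nonneg_left (norm_polylogSeries_le (by simp) hz) (norm_nonneg _)

/-- Since f(b) is a multiple of a and f reverses words, a final b becomes an initial a. The
corresponding polylogarithm is then O(|z|) at the origin, without logarithms. -/
theorem exists_antiW_append_b {f : Letter → Letter → ℚ} (hf : f .b .b = 0) (w : Word) :
    ∃ h, antiW f (w ++ [.b]) = consL .a h := by
  refine ⟨f .b .a • anti f (word w), ?_⟩
  rw [← anti_word, ← snocL_word, anti_snocL, sum_letter, hf, zero_smul, add_zero, map_smul]

/-- In each product with a non-empty suffix, the suffix ends with b, so its factor at m(z) is O(|1 -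
z|), while the factor of the prefix, empty or starting with a, is o(1/|1 - z|). Only the cut at the
end survives; it contributes L_w(z), which tends to ζ(w). -/
theorem StolzFilter.tendsto_transport {l : Filter ℂ} (hl : StolzFilter l)
    {f : Letter → Letter → ℚ} (hf : f .b .b = 0) {m : ℂ → ℂ}
    (hm : ∃ C : ℝ, ∀ᶠ z in l, ‖m z‖ ≤ C * ‖1 - z‖) (w : Word) (hw : w.head? ≠ some .b)
    (hw' : w.getLast? ≠ some .a) :
    Tendsto (fun z => transport f z (m z) w) l (𝓝 (zetaSeries w)) := by
  have h1 : Tendsto (fun z : ℂ => ‖1 - z‖) l (𝓝 0) := by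
    have : Tendsto (fun z : ℂ => ‖1 - z‖) (𝓝 1) (𝓝 ‖(1 : ℂ) - 1‖) :=
      Continuous.tendsto (by fun_prop) 1
    rw [sub_self, norm_zero] at this
    exact this.mono_left hl.le_nhds
  obtain ⟨C, hC⟩ := hm
  have hm2 : ∀ᶠ z in l, ‖m z‖ ≤ 1 / 2 := by
    have := h1.const_mul C
    rw [mul_zero] at this
    filter_upwards [hC, this.eventually (Iio_mem_nhds (show (0 : ℝ) < 1 / 2 by norm_num))]
      with z h h'
    exact h.trans (le_of_lt h')
  have series : ∀ v : Word, v.head? ≠ some .b → ∀ z, polylog z (word v) = polylogSeries v z ∨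
      polylog z (word v) = 1 ∧ v = [] := by
    intro v hv z
    cases v with
    | nil => exact Or.inr ⟨polylog_nil z, rfl⟩
    | cons x v =>
      cases x
      · exact Or.inl (polylog_cons_a z v)
      · simp at hv
  rcases List.eq_nil_or_concat' w with rfl | ⟨v, x, rfl⟩
  · have e1 : ∀ z, transport f z (m z) [] = 1 := by
      intro z
      simp [transport, convC, polylog_nil, antiW]
    have e2 : zetaSeries [] = 1 := by
      rw [zetaSeries_eq_polylogSeries, polylogSeries_eq_tsum_of_summable]
      · rw [tsum_eq_single 0]
        · simp [cw_nil]
        · intro n hn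
          simp [cw_nil, hn]
      · refine summable_of_ne_finset_zero (s := {0}) fun n hn => ?_
        have hn : n ≠ 0 := by simpa using hn
        simp [cw_nil, hn]
    simp only [e1, e2]
    exact tendsto_const_nhds
  · have hx : x = .b := by cases x <;> simp_all
    subst hx
    have hv : ∃ u, v = .a :: u := by
      cases v with
      | nil => simp at hw
      | cons y u =>
        cases y
        · exact ⟨u, rfl⟩
        · simp at hw
    obtain ⟨u, rfl⟩ := hv
    have e : ∀ z, transport f z (m z) (.a :: u ++ [.b]) =
        ∑ i ∈ Finset.range ((Letter.a :: u).length + 1),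
          polylog z (word ((Letter.a :: u).take i)) *
            polylog (m z) (antiW f ((Letter.a :: u).drop i ++ [.b])) +
        polylogSeries (.a :: u ++ [.b]) z := by
      intro z
      rw [transport, convC, List.length_append, List.length_singleton, Finset.sum_range_succ]
      congr 1
      · refine Finset.sum_congr rfl fun i hi => ?_
        have hi : i ≤ (Letter.a :: u).length := Nat.lt_succ_iff.1 (Finset.mem_range.1 hi)
        rw [List.take_append_of_le_length hi, List.drop_append_of_le_length hi]
      · have hl : (Letter.a :: u).length + 1 = (Letter.a :: u ++ [Letter.b]).length := by simp
        rw [hl, List.take_length, List.drop_length, antiW, polylog_nil, mul_one, List.cons_append,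
          polylog_cons_a]
    simp only [e]
    rw [← zero_add (zetaSeries _)]
    refine Tendsto.add ?_ (hl.tendsto_polylogSeries (by simp))
    rw [← Finset.sum_const_zero (s := Finset.range ((Letter.a :: u).length + 1))]
    refine tendsto_finsetSum _ fun i _ => ?_
    obtain ⟨h, hh⟩ := exists_antiW_append_b hf ((Letter.a :: u).drop i)
    obtain ⟨D, hD⟩ := exists_norm_polylog_consL_le h
    rw [hh]
    have hvi : ((Letter.a :: u).take i).head? ≠ some .b := by
      cases i <;> simp
    have hs : Tendsto (fun z => ‖1 - z‖ * ‖polylog z (word ((Letter.a :: u).take i))‖) l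
        (𝓝 0) := by
      by_cases hnil : (Letter.a :: u).take i = []
      · simpa [hnil, polylog_nil] using h1
      · refine (hl.tendsto_mul_polylogSeries ((Letter.a :: u).take i)).congr fun z => ?_
        rcases series _ hvi z with e | e
        · rw [e]
        · exact absurd e.2 hnil
    have hs' := hs.const_mul (|D| * |C|)
    rw [mul_zero] at hs'
    refine squeeze_zero_norm' ?_ hs'
    filter_upwards [hC, hm2] with z hz hz2
    rw [norm_mul]
    calc _ ≤ ‖polylog z (word ((Letter.a :: u).take i))‖ * (|D| * (|C| * ‖1 - z‖)) := by
          refine mul_le_mul_of_nonneg_left ((hD _ hz2).trans ?_) (norm_nonneg _)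
          refine mul_le_mul (le_abs_self D) (hz.trans ?_) (norm_nonneg _) (abs_nonneg D)
          exact mul_le_mul_of_nonneg_right (le_abs_self C) (norm_nonneg _)
      _ = _ := by ring

/-- A morphism that is given by a locally constant product of transports is a regularized polyzeta
value. -/
theorem eq_zetaReg_of_transport {f : Letter → Letter → ℚ} (hf : f .b .b = 0) {U : Set ℂ}
    (hU : IsOpen U) (hU' : IsPreconnected U) (hUO : U ⊆ Omega) {m m' : ℂ → ℂ}
    (hm : ∀ z ∈ U, m z ∈ Omega) (hd : ∀ z ∈ U, HasDerivAt m (m' z) z)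
    (hfm : ∀ z ∈ U, ∀ x, m' z * ∑ y, (f x y : ℂ) * om y (m z) = -om x z)
    {l l' : Filter ℂ} [l.NeBot] [l'.NeBot] (hl : StolzFilter l) (hlU : ∀ᶠ z in l, z ∈ U)
    (hlm : ∃ C : ℝ, ∀ᶠ z in l, ‖m z‖ ≤ C * ‖1 - z‖) (hlU' : ∀ᶠ z in l', z ∈ U)
    (Φ : H →ₗ[ℚ] ℂ) (hΦ : ∀ w, Tendsto (fun z => transport f z (m z) w) l' (𝓝 (Φ (word w))))
    (mul : ∀ h k, Φ (shuffle h k) = Φ h * Φ k) {c : ℂ} (ha : Φ (word [.a]) = c)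
    (hb : Φ (word [.b]) = 0) : Φ = zetaReg c := by
  -- The transport is constant on the connected set U; the limit along `l'`, near the fixed point of
  -- m, identifies the constant as Φ.
  have hconst : ∀ w, ∀ z ∈ U, transport f z (m z) w = Φ (word w) := by
    intro w z hz
    have hD : ∀ t ∈ U, HasDerivAt (fun z => transport f z (m z) w) 0 t := fun t ht =>
      hasDerivAt_transport f (hUO ht) (hm t ht) (hd t ht) (hfm t ht) w
    have hc : ∀ t ∈ U, transport f t (m t) w = transport f z (m z) w := fun t ht =>
      hU.is_const_of_deriv_eq_zero hU'
        (fun s hs => (hD s hs).differentiableAt.differentiableWithinAt)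
        (fun s hs => (hD s hs).deriv) ht hz
    exact tendsto_nhds_unique (tendsto_const_nhds.congr' (hlU'.mono fun t ht => (hc t ht).symm))
      (hΦ w)
  -- The same constant is computed along `l`, near the point 1, which gives the values of Φ at the
  -- convergent words.
  refine zetaReg_unique c Φ ?_ mul (fun w hw hw' => ?_) ha hb
  · refine tendsto_nhds_unique (hΦ []) ?_
    simp [transport, convC, polylog_nil, antiW]
  · exact tendsto_nhds_unique
      (tendsto_const_nhds.congr' (hlU.mono fun t ht => (hconst w t ht).symm))
      (hl.tendsto_transport hf hlm w hw hw')

theorem polylog_a {z : ℂ} (hz : ‖z‖ < 1) : polylog z (word [.a]) = -Complex.log (1 - z) := by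
  rw [polylog_cons_a, polylogSeries_eq_tsum _ hz, ← (Complex.hasSum_taylorSeries_neg_log hz).tsum_eq]
  refine tsum_congr fun n => ?_
  have := cw_append_a [] n
  rw [List.nil_append] at this
  rw [this]
  rcases Nat.eq_zero_or_pos n with rfl | hn
  · simp
  · have e : ∑ j ∈ Finset.range n, cw [] j = 1 := by simp [cw_nil, hn]
    rw [e]
    push_cast
    field_simp

theorem polylog_b (z : ℂ) : polylog z (word [.b]) = Complex.log z := by
  simpa [logPow] using polylog_replicate z 1

/-! ### The value at `1/2` -/

theorem twistW_letter (f : Letter → Letter → ℚ) (x : Letter) :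
    twistW f [x] = f x .a • word [.a] + f x .b • word [.b] + word [x] := by
  simp [twistW, Finset.sum_range_succ, antiW, sum_letter]

theorem half_mem_Omega : (1 / 2 : ℂ) ∈ Omega := by
  refine ⟨by norm_num, Or.inl (by norm_num)⟩

theorem mem_Omega_of_mem_ball {z : ℂ} (h : ‖z‖ < 1) (h' : ‖1 - z‖ < 1) : z ∈ Omega := by
  refine ⟨h, Or.inl ?_⟩
  have := (Complex.abs_re_le_norm (1 - z)).trans_lt h'
  rw [abs_lt, Complex.sub_re, Complex.one_re] at this
  linarith [this.2]

/-- The map z ↦ 1 - z exchanges dz/(1 - z) and dz/z up to sign and fixes 1/2. The values at a and at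
b are both log(1/2) - log(1/2) = 0. In particular the regularisation with c = 0 is itself a
morphism. -/
theorem polylog_half_twist : polylog (1 / 2) ∘ₗ twist sigmaMat = zetaReg 0 := by
  have hmem : ∀ z : ℂ, z ∈ Metric.ball (0 : ℂ) 1 ∩ Metric.ball 1 1 ↔ ‖z‖ < 1 ∧ ‖1 - z‖ < 1 := by
    intro z
    rw [Set.mem_inter_iff, mem_ball_zero_iff, Metric.mem_ball, dist_comm, dist_eq_norm]
  have hev : ∀ᶠ t : ℝ in 𝓝[>] 0, ‖(1 - t : ℂ)‖ = 1 - t ∧ ‖1 - (1 - t : ℂ)‖ = t ∧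
      t ∈ Set.Ioo (0 : ℝ) 1 := by
    filter_upwards [Ioo_mem_nhdsGT (show (0 : ℝ) < 1 by norm_num)] with t ht
    refine ⟨?_, ?_, ht⟩
    · rw [← Complex.ofReal_one, ← Complex.ofReal_sub, Complex.norm_real,
        Real.norm_of_nonneg (by linarith [ht.2])]
    · rw [sub_sub_cancel, Complex.norm_real, Real.norm_of_nonneg ht.1.le]
  -- The lens U is stable under 1 - z and avoids the cut. The point 1 is approached along real z = 1
  -- - t, where |1 - z| = 1 - |z| and hence the Stolz constant is 1; at the fixed point 1/2,
  -- interior to U, the principal filter suffices.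
  refine eq_zetaReg_of_transport (f := sigmaMat) rfl (U := Metric.ball 0 1 ∩ Metric.ball 1 1)
    (Metric.isOpen_ball.inter Metric.isOpen_ball)
    ((convex_ball _ _).inter (convex_ball _ _)).isPreconnected
    (fun z hz => mem_Omega_of_mem_ball ((hmem z).1 hz).1 ((hmem z).1 hz).2)
    (m := fun z => 1 - z) (m' := fun _ => -1)
    (fun z hz => mem_Omega_of_mem_ball ((hmem z).1 hz).2
      (by rw [sub_sub_cancel]; exact ((hmem z).1 hz).1))
    (fun z _ => by simpa using (hasDerivAt_id z).const_sub 1) (fun z _ x => ?_)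
    (l := Filter.map (fun t : ℝ => (1 - t : ℂ)) (𝓝[>] 0)) (l' := pure (1 / 2)) ⟨?_, 1, ?_⟩ ?_
    ⟨1, Eventually.of_forall fun z => by simp⟩ ?_ _ (fun w => ?_) (fun h k => ?_) ?_ ?_
  · cases x <;> simp [sum_letter, sigmaMat, om]
  · have : Tendsto (fun t : ℝ => (1 - t : ℂ)) (𝓝 0) (𝓝 (1 - (0 : ℝ) : ℂ)) :=
      Continuous.tendsto (by fun_prop) 0
    rw [Complex.ofReal_zero, sub_zero] at this
    exact this.mono_left nhdsWithin_le_nhds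
  · rw [eventually_map]
    filter_upwards [hev] with t ht
    rw [ht.1, ht.2.1]
    exact ⟨by linarith [ht.2.2.1], by linarith⟩
  · rw [eventually_map]
    filter_upwards [hev] with t ht
    rw [hmem, ht.1, ht.2.1]
    exact ⟨by linarith [ht.2.2.1], ht.2.2.2⟩
  · rw [eventually_pure, hmem]
    norm_num
  · rw [LinearMap.comp_apply, twist_word, polylog_twistW _ half_mem_Omega]
    have := tendsto_pure_nhds (fun z => transport sigmaMat z (1 - z) w) (1 / 2)
    norm_num at this ⊢
    exact this
  · simp only [LinearMap.comp_apply, twist_shuffle, polylog_shuffle half_mem_Omega]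
  · rw [LinearMap.comp_apply, twist_word, twistW_letter]
    simp only [sigmaMat, zero_smul, one_smul, zero_add, map_add, polylog_b,
      polylog_a half_mem_Omega.1]
    norm_num
  · rw [LinearMap.comp_apply, twist_word, twistW_letter]
    simp only [sigmaMat, zero_smul, one_smul, add_zero, map_add, polylog_b,
      polylog_a half_mem_Omega.1]
    norm_num

/-! ### The values at `ρ` and `ρ⁻¹` -/

/-- The point `r` is `ρ` or `ρ⁻¹`: it lies on the unit circle and is fixed by `z ↦ 1 - z⁻¹`. -/
structure IsCorner (r : ℂ) : Prop where
  norm_eq : ‖r‖ = 1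
  one_sub : 1 - r = r⁻¹

namespace IsCorner

variable {r : ℂ}

theorem re_eq (hr : IsCorner r) : r.re = 1 / 2 := by
  have h := hr.one_sub
  rw [Complex.inv_eq_conj hr.norm_eq] at h
  have := congrArg Complex.re h
  simp at this
  linarith

theorem im_sq (hr : IsCorner r) : r.im * r.im = 3 / 4 := by
  have h : r.re * r.re + r.im * r.im = ‖r‖ ^ 2 := by
    rw [← Complex.normSq_eq_norm_sq, Complex.normSq_apply]
  rw [hr.re_eq, hr.norm_eq] at h
  linarith

theorem norm_one_sub (hr : IsCorner r) : ‖1 - r‖ = 1 := by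
  rw [hr.one_sub, norm_inv, hr.norm_eq, inv_one]

theorem mem_slitPlane (hr : IsCorner r) : r ∈ Complex.slitPlane :=
  Or.inl (by rw [hr.re_eq]; norm_num)

theorem one_sub_mem_slitPlane (hr : IsCorner r) : 1 - r ∈ Complex.slitPlane :=
  Or.inl (by rw [Complex.sub_re, hr.re_eq]; norm_num)

/-- The part of the unit disc between the segments from `1` and from `1 / 2` to `r`. -/
def sector (r : ℂ) : Set ℂ := {z | ‖z‖ < 1 ∧ 1 / 2 < z.re ∧ 0 < z.im * r.im}

theorem isOpen_sector (r : ℂ) : IsOpen (sector r) :=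
  (isOpen_lt continuous_norm continuous_const).inter
    ((isOpen_lt continuous_const Complex.continuous_re).inter
      (isOpen_lt continuous_const (Complex.continuous_im.mul continuous_const)))

theorem convex_sector (r : ℂ) : Convex ℝ (sector r) := by
  have h1 : Convex ℝ {z : ℂ | ‖z‖ < 1} := by
    have e : {z : ℂ | ‖z‖ < 1} = Metric.ball 0 1 := by
      ext z
      simp
    rw [e]
    exact convex_ball _ _
  have h3 : Convex ℝ {z : ℂ | 0 < z.im * r.im} :=
    convex_halfSpace_gt (f := fun z : ℂ => z.im * r.im)
      ⟨fun x y => by rw [Complex.add_im, add_mul], fun c x => by simp [mul_assoc]⟩ 0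
  exact h1.inter ((convex_halfSpace_re_gt (1 / 2)).inter h3)

theorem sector_subset (r : ℂ) : sector r ⊆ Omega := fun _ hz =>
  ⟨hz.1, Or.inl (by linarith [hz.2.1])⟩

/-- The condition Re z > 1/2 means |z - 1| < |z|, that is |1 - 1/z| < 1. Real z in ]1/2, 1[ would be
sent into the cut, which is why the sector stays on one side of the real axis. -/
theorem map_mem_Omega {z : ℂ} (hz : z ∈ sector r) : 1 - z⁻¹ ∈ Omega := by
  have hz0 : z ≠ 0 := Omega_ne_zero (sector_subset r hz)
  have him : z.im ≠ 0 := by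
    intro h
    have := hz.2.2
    rw [h, zero_mul] at this
    exact lt_irrefl _ this
  constructor
  · have e : 1 - z⁻¹ = (z - 1) / z := by field_simp
    have hp : 0 < ‖z‖ := norm_pos_iff.2 hz0
    rw [e, norm_div, div_lt_one hp]
    refine lt_of_pow_lt_pow_left₀ 2 hp.le ?_
    rw [← Complex.normSq_eq_norm_sq, ← Complex.normSq_eq_norm_sq, Complex.normSq_apply,
      Complex.normSq_apply, Complex.sub_re, Complex.sub_im, Complex.one_re, Complex.one_im]
    nlinarith [hz.2.1]
  · refine Or.inr ?_
    rw [Complex.sub_im, Complex.one_im, Complex.inv_im, zero_sub, neg_div, neg_neg]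
    exact div_ne_zero him (Complex.normSq_pos.2 hz0).ne'

/-- The points of the segment between `1` and `r`. -/
theorem chord (hr : IsCorner r) {t : ℝ} (ht : t ∈ Set.Ioo (0 : ℝ) 1) :
    1 + t * (r - 1) ∈ sector r ∧ ‖1 - (1 + t * (r - 1))‖ = t ∧
      ‖1 + t * (r - 1)‖ ^ 2 = 1 - t + t ^ 2 := by
  have e1 : (1 + t * (r - 1)).re = 1 - t / 2 := by
    simp [hr.re_eq]
    ring
  have e2 : (1 + t * (r - 1)).im = t * r.im := by simp
  have e3 : ‖1 + t * (r - 1)‖ ^ 2 = 1 - t + t ^ 2 := by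
    rw [← Complex.normSq_eq_norm_sq, Complex.normSq_apply, e1, e2]
    linear_combination t ^ 2 * hr.im_sq
  refine ⟨⟨?_, ?_, ?_⟩, ?_, e3⟩
  · refine lt_of_pow_lt_pow_left₀ 2 zero_le_one ?_
    rw [e3]
    nlinarith [ht.1, ht.2]
  · rw [e1]
    linarith [ht.2]
  · rw [e2, mul_assoc, hr.im_sq]
    linarith [ht.1]
  · have e : 1 - (1 + t * (r - 1)) = t * (1 - r) := by ring
    rw [e, norm_mul, hr.norm_one_sub, mul_one, Complex.norm_real, Real.norm_of_nonneg ht.1.le]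

theorem neBot (hr : IsCorner r) : (𝓝[sector r] r).NeBot := by
  have h : Tendsto (fun t : ℝ => 1 + t * (r - 1)) (𝓝[<] 1) (𝓝[sector r] r) := by
    refine tendsto_nhdsWithin_iff.2 ⟨?_, ?_⟩
    · have : Tendsto (fun t : ℝ => 1 + t * (r - 1)) (𝓝 1) (𝓝 (1 + (1 : ℝ) * (r - 1))) :=
        Continuous.tendsto (by fun_prop) 1
      rw [Complex.ofReal_one, one_mul, add_sub_cancel] at this
      exact this.mono_left nhdsWithin_le_nhds
    · filter_upwards [Ioo_mem_nhdsLT (show (0 : ℝ) < 1 by norm_num)] with t ht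
      exact (hr.chord ht).1
  exact h.neBot

theorem neBot_Omega (hr : IsCorner r) : (𝓝[Omega] r).NeBot :=
  hr.neBot.mono (nhdsWithin_mono _ (sector_subset r))

/-- Induction on the length: the point r is neither 0 nor 1, so near r the derivative of the
polylogarithm is bounded as soon as the one for the shorter word has a limit. On a convex set this
makes the function Lipschitz, and it maps the Cauchy filter at r to a Cauchy filter. -/
theorem exists_tendsto_word (hr : IsCorner r) (w : Word) :
    ∃ x, Tendsto (fun z => polylog z (word w)) (𝓝[Omega] r) (𝓝 x) := by
  have := hr.neBot_Omega
  induction w using List.reverseRecOn with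
  | nil =>
    refine ⟨1, ?_⟩
    simp only [polylog_nil]
    exact tendsto_const_nhds
  | append_singleton w x ih =>
    obtain ⟨y, hy⟩ := ih
    have hb : ∀ᶠ z in 𝓝[Omega] r, ‖polylog z (word w)‖ < ‖y‖ + 1 :=
      hy.norm.eventually (Iio_mem_nhds (lt_add_one _))
    obtain ⟨δ, hδ, hbδ⟩ := Metric.mem_nhdsWithin_iff.1 hb
    -- Since |r| = |1 - r| = 1, the radius 1/2 keeps z at distance at least 1/2 from 0 and from 1,
    -- so both forms are bounded by 2; as Re r = 1/2, it also keeps Re z positive, away from the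
    -- cut.
    let V := Metric.ball (0 : ℂ) 1 ∩ Metric.ball r (min δ (1 / 2))
    have hV : Convex ℝ V := (convex_ball _ _).inter (convex_ball _ _)
    have hV1 : ∀ z ∈ V, ‖z - r‖ < δ ∧ ‖z - r‖ < 1 / 2 := by
      intro z hz
      have := hz.2
      rw [Metric.mem_ball, dist_eq_norm, lt_min_iff] at this
      exact this
    have hVO : V ⊆ Omega := by
      intro z hz
      refine ⟨mem_ball_zero_iff.1 hz.1, Or.inl ?_⟩
      have := (Complex.abs_re_le_norm (z - r)).trans_lt (hV1 z hz).2
      rw [Complex.sub_re, hr.re_eq, abs_lt] at this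
      linarith [this.1]
    have hom : ∀ z ∈ V, ‖om x z‖ ≤ 2 := by
      intro z hz
      have hd := (hV1 z hz).2
      cases x
      · rw [om, norm_inv]
        have h1 : (1 : ℝ) / 2 ≤ ‖1 - z‖ := by
          have h2 := norm_sub_norm_le (1 - r) (z - r)
          rw [hr.norm_one_sub, sub_sub_sub_cancel_right] at h2
          linarith
        rw [inv_le_comm₀ (by linarith) (by norm_num)]
        linarith
      · rw [om, norm_inv]
        have h1 : (1 : ℝ) / 2 ≤ ‖z‖ := by
          have h2 := norm_sub_norm_le r (r - z)
          rw [hr.norm_eq, sub_sub_cancel, norm_sub_rev] at h2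
          linarith
        rw [inv_le_comm₀ (by linarith) (by norm_num)]
        linarith
    have hbound : ∀ z ∈ V, ‖om x z * polylog z (word w)‖₊ ≤ (2 * (‖y‖₊ + 1) : NNReal) := by
      intro z hz
      have h1 : ‖polylog z (word w)‖ < ‖y‖ + 1 :=
        hbδ ⟨by rw [Metric.mem_ball, dist_eq_norm]; exact (hV1 z hz).1, hVO hz⟩
      rw [← NNReal.coe_le_coe]
      push_cast
      rw [norm_mul]
      exact mul_le_mul (hom z hz) h1.le (norm_nonneg _) (by norm_num)
    have hLip := hV.lipschitzOnWith_of_nnnorm_hasDerivWithin_le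
      (f := fun z => polylog z (word (w ++ [x])))
      (fun z hz => (hasDerivAt_polylog_word w x (hVO hz)).hasDerivWithinAt) hbound
    have hVn : V ∈ 𝓝[Omega] r := by
      have h1 : Metric.ball r (min δ (1 / 2)) ∈ 𝓝[Omega] r :=
        mem_nhdsWithin_of_mem_nhds (Metric.ball_mem_nhds r (by positivity))
      filter_upwards [h1, self_mem_nhdsWithin] with z h1 h2
      exact ⟨mem_ball_zero_iff.2 h2.1, h1⟩
    have hc : Cauchy (𝓝[Omega] r) := cauchy_nhds.mono nhdsWithin_le_nhds
    exact cauchy_map_iff_exists_tendsto.1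
      (hc.map_of_le hLip.uniformContinuousOn (le_principal_iff.2 hVn))

theorem exists_tendsto (hr : IsCorner r) (h : H) :
    ∃ x, Tendsto (fun z => polylog z h) (𝓝[Omega] r) (𝓝 x) := by
  induction h using Finsupp.induction_linear with
  | zero => exact ⟨0, by simp only [map_zero]; exact tendsto_const_nhds⟩
  | add f g hf hg =>
    obtain ⟨x, hx⟩ := hf
    obtain ⟨y, hy⟩ := hg
    exact ⟨x + y, by simpa only [map_add] using hx.add hy⟩
  | single w c =>
    obtain ⟨x, hx⟩ := hr.exists_tendsto_word w
    refine ⟨c * x, ?_⟩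
    have e : (Finsupp.single w c : H) = c • word w := by simp [word]
    simp only [e, map_smul, Rat.smul_def]
    exact hx.const_mul _

theorem exists_boundary_value (hr : IsCorner r) :
    ∃ Λ : H →ₗ[ℚ] ℂ, ∀ h, Tendsto (fun z => polylog z h) (𝓝[Omega] r) (𝓝 (Λ h)) := by
  have := hr.neBot_Omega
  choose Λ hΛ using hr.exists_tendsto
  refine ⟨⟨⟨Λ, fun h k => ?_⟩, fun c h => ?_⟩, hΛ⟩
  · refine tendsto_nhds_unique (hΛ (h + k)) ?_
    simpa only [map_add] using (hΛ h).add (hΛ k)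
  · refine tendsto_nhds_unique (hΛ (c • h)) ?_
    simpa only [map_smul, Rat.smul_def, RingHom.id_apply] using (hΛ h).const_mul (c : ℂ)

theorem tendsto_polylog_a (hr : IsCorner r) :
    Tendsto (fun z => polylog z (word [.a])) (𝓝[Omega] r) (𝓝 (-Complex.log (1 - r))) := by
  have h : ContinuousAt (fun z => -Complex.log (1 - z)) r :=
    ((continuousAt_const.sub continuousAt_id).clog hr.one_sub_mem_slitPlane).neg
  refine (h.tendsto.mono_left nhdsWithin_le_nhds).congr' ?_
  filter_upwards [self_mem_nhdsWithin] with z hz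
  exact (polylog_a hz.1).symm

theorem tendsto_polylog_b (hr : IsCorner r) :
    Tendsto (fun z => polylog z (word [.b])) (𝓝[Omega] r) (𝓝 (Complex.log r)) := by
  simp only [polylog_b]
  exact (continuousAt_id.clog hr.mem_slitPlane).tendsto.mono_left nhdsWithin_le_nhds

/-- The map 1 - 1/z sends 1 to 0, fixes r, and transforms the forms as τ prescribes. At r both L_a
and L_b have the value θ, so that a gets the regularised value 2θ + θ and b gets -θ + θ = 0. -/
theorem tendsto_polylog_twist (hr : IsCorner r) {θ : ℂ} (hθ : Complex.log r = θ)
    (hθ' : Complex.log (1 - r) = -θ) (h : H) :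
    Tendsto (fun z => polylog z (twist tauMat h)) (𝓝[Omega] r) (𝓝 (zetaReg (3 * θ) h)) := by
  have := hr.neBot_Omega
  have := hr.neBot
  obtain ⟨Λ, hΛ⟩ := hr.exists_boundary_value
  have hmul : ∀ h k, Λ (shuffle h k) = Λ h * Λ k := by
    intro h k
    refine tendsto_nhds_unique (hΛ _) (((hΛ h).mul (hΛ k)).congr' ?_)
    filter_upwards [self_mem_nhdsWithin] with z hz
    exact (polylog_shuffle hz h k).symm
  have ha : Λ (word [.a]) = θ := by
    refine (tendsto_nhds_unique (hΛ _) hr.tendsto_polylog_a).trans ?_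
    rw [hθ', neg_neg]
  have hb : Λ (word [.b]) = θ := (tendsto_nhds_unique (hΛ _) hr.tendsto_polylog_b).trans hθ
  have hr0 : r ≠ 0 := Complex.slitPlane_ne_zero hr.mem_slitPlane
  have hs0 : ∀ z ∈ sector r, z ≠ 0 := fun z hz => Omega_ne_zero (sector_subset r hz)
  have hm : Tendsto (fun z => 1 - z⁻¹) (𝓝[sector r] r) (𝓝[Omega] r) := by
    refine tendsto_nhdsWithin_iff.2 ⟨?_, ?_⟩
    · have h1 : ContinuousAt (fun z : ℂ => 1 - z⁻¹) r :=
        continuousAt_const.sub (continuousAt_inv₀ hr0)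
      have h2 := h1.tendsto
      rw [← hr.one_sub, sub_sub_cancel] at h2
      exact h2.mono_left nhdsWithin_le_nhds
    · filter_upwards [self_mem_nhdsWithin] with z hz
      exact map_mem_Omega hz
  have hchord : ∀ᶠ t : ℝ in 𝓝[>] 0, t ∈ Set.Ioo (0 : ℝ) (1 / 2) :=
    Ioo_mem_nhdsGT (by norm_num)
  have e : Λ ∘ₗ twist tauMat = zetaReg (3 * θ) := by
    -- As r lies on the boundary, it is approached inside the sector, and 1 is approached along the
    -- chord 1 + t(r - 1).
    refine eq_zetaReg_of_transport (f := tauMat) rfl (isOpen_sector r)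
      (convex_sector r).isPreconnected (sector_subset r) (m := fun z => 1 - z⁻¹)
      (m' := fun z => (z ^ 2)⁻¹) (fun z hz => map_mem_Omega hz)
      (fun z hz => ?_) (fun z hz x => ?_)
      (l := Filter.map (fun t : ℝ => 1 + t * (r - 1)) (𝓝[>] 0)) (l' := 𝓝[sector r] r)
      ⟨?_, 4, ?_⟩ ?_ ⟨2, ?_⟩ self_mem_nhdsWithin _ (fun w => ?_) (fun h k => ?_) ?_ ?_
    · refine ((hasDerivAt_inv (hs0 z hz)).const_sub 1).congr_deriv ?_
      rw [neg_neg]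
    · have h0 := hs0 z hz
      have h1 : 1 - z ≠ 0 := by
        intro h1
        have := hz.1
        rw [← sub_eq_zero.1 h1, norm_one] at this
        exact lt_irrefl _ this
      have h1' : z - 1 ≠ 0 := by
        rw [← neg_sub]
        exact neg_ne_zero.2 h1
      have e1 : 1 - z⁻¹ = (z - 1) / z := by field_simp
      have e2 : (1 - z)⁻¹ = -(z - 1)⁻¹ := by rw [← neg_sub, inv_neg]
      cases x
      · simp only [sum_letter, tauMat, om, sub_sub_cancel, inv_inv]
        rw [e1, e2, inv_div]
        push_cast
        field_simp
        ring
      · simp only [sum_letter, tauMat, om, sub_sub_cancel, inv_inv]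
        push_cast
        field_simp
        ring
    · have : Tendsto (fun t : ℝ => 1 + t * (r - 1)) (𝓝 0) (𝓝 (1 + (0 : ℝ) * (r - 1))) :=
        Continuous.tendsto (by fun_prop) 0
      rw [Complex.ofReal_zero, zero_mul, add_zero] at this
      exact this.mono_left nhdsWithin_le_nhds
    · rw [eventually_map]
      filter_upwards [hchord] with t ht
      obtain ⟨h1, h2, h3⟩ := hr.chord ⟨ht.1, ht.2.trans (by norm_num)⟩
      refine ⟨h1.1, ?_⟩
      rw [h2]
      -- On the chord 1 - |z|² = t - t² ≥ t/2 for t < 1/2, and 1 + |z| ≤ 2; hence 1 - |z| ≥ t/4,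
      -- which explains the Stolz constant 4.
      have h4 := h1.1
      have h5 := norm_nonneg (1 + t * (r - 1))
      nlinarith [ht.1, ht.2]
    · rw [eventually_map]
      filter_upwards [hchord] with t ht
      exact (hr.chord ⟨ht.1, ht.2.trans (by norm_num)⟩).1
    · rw [eventually_map]
      filter_upwards [hchord] with t ht
      have h1 := (hr.chord ⟨ht.1, ht.2.trans (by norm_num)⟩).1
      set z := 1 + t * (r - 1)
      have h0 := hs0 z h1
      have e1 : 1 - z⁻¹ = -(1 - z) * z⁻¹ := by field_simp; ring
      rw [e1, norm_mul, norm_neg, norm_inv, mul_comm]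
      refine mul_le_mul_of_nonneg_right ?_ (norm_nonneg _)
      have h2 : 1 / 2 < ‖z‖ := h1.2.1.trans_le (Complex.re_le_norm z)
      rw [inv_le_comm₀ (by linarith) (by norm_num)]
      linarith
    -- Within the sector both z and 1 - 1/z tend to r inside `Omega`, so every factor of the
    -- transport tends to a boundary value, and multiplicativity of Λ reassembles Λ ∘ `twist
    -- tauMat`.
    · have h1 : Tendsto (fun z => transport tauMat z (1 - z⁻¹) w) (𝓝[sector r] r)
          (𝓝 (convC (fun w => Λ (word w)) (fun w => Λ (antiW tauMat w)) w)) :=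
        tendsto_finsetSum _ fun i _ =>
          ((hΛ _).mono_left (nhdsWithin_mono _ (sector_subset r))).mul ((hΛ _).comp hm)
      rw [LinearMap.comp_apply, twist_word, twistW, map_sum]
      simp only [hmul, anti_word]
      exact h1
    · rw [LinearMap.comp_apply, twist_shuffle, hmul]
      rfl
    · rw [LinearMap.comp_apply, twist_word, twistW_letter]
      simp only [tauMat, one_smul, map_add, ha, hb]
      ring
    · rw [LinearMap.comp_apply, twist_word, twistW_letter]
      simp [tauMat, ha, hb]
  rw [← e]
  exact hΛ _

end IsCorner

/-- The relation 1 - ρ = ρ⁻¹ is 2 cos(π/3) = 1. The angles ±π/3 lie within the range of the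
principal logarithm, so no multiple of 2πi appears. -/
theorem isCorner_rho : IsCorner rho ∧ Complex.log rho = Real.pi * Complex.I / 3 ∧
    Complex.log (1 - rho) = -(Real.pi * Complex.I / 3) := by
  have e : (Real.pi * Complex.I / 3 : ℂ) = ((Real.pi / 3 : ℝ) : ℂ) * Complex.I := by
    push_cast
    ring
  have h1 : 1 - rho = rho⁻¹ := by
    have h2 := Complex.two_cos ((Real.pi / 3 : ℝ) : ℂ)
    rw [← Complex.ofReal_cos, Real.cos_pi_div_three] at h2
    rw [rho, ← Complex.exp_neg, e, ← neg_mul, sub_eq_iff_eq_add, add_comm, ← h2]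
    norm_num
  have hp := Real.pi_pos
  refine ⟨⟨by rw [rho, e, Complex.norm_exp_ofReal_mul_I], h1⟩, ?_, ?_⟩
  · rw [rho, Complex.log_exp]
    · rw [e, Complex.im_ofReal_mul, Complex.I_im]; linarith
    · rw [e, Complex.im_ofReal_mul, Complex.I_im]; linarith
  · rw [h1, rho, ← Complex.exp_neg, Complex.log_exp]
    · rw [Complex.neg_im, e, Complex.im_ofReal_mul, Complex.I_im]; linarith
    · rw [Complex.neg_im, e, Complex.im_ofReal_mul, Complex.I_im]; linarith

theorem isCorner_inv_rho : IsCorner rho⁻¹ := by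
  obtain ⟨⟨h1, h2⟩, _⟩ := isCorner_rho
  exact ⟨by rw [norm_inv, h1, inv_one], by rw [← h2, h2, inv_inv, ← h2, sub_sub_cancel]⟩

theorem tendsto_polylog_rho (h : H) :
    Tendsto (fun z => polylog z (twist tauMat h)) (𝓝[Omega] rho)
      (𝓝 (zetaReg (Real.pi * Complex.I) h)) := by
  obtain ⟨h1, h2, h3⟩ := isCorner_rho
  have := h1.tendsto_polylog_twist h2 h3 h
  rwa [mul_div_cancel₀ _ (by norm_num : (3 : ℂ) ≠ 0)] at this

theorem tendsto_polylog_inv_rho (h : H) :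
    Tendsto (fun z => polylog z (twist tauMat h)) (𝓝[Omega] rho⁻¹)
      (𝓝 (zetaReg (-(Real.pi * Complex.I)) h)) := by
  obtain ⟨h1, h2, h3⟩ := isCorner_rho
  have := isCorner_inv_rho.tendsto_polylog_twist (θ := -(Real.pi * Complex.I / 3))
    (by rw [← h1.one_sub, h3]) (by rw [← h1.one_sub, sub_sub_cancel, h2, neg_neg]) h
  rwa [mul_neg, mul_div_cancel₀ _ (by norm_num : (3 : ℂ) ≠ 0)] at this

end Polyzeta

/-! ### The two identities for regular functions on P and Q. -/

theorem theorem18 :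
    (∀ φ : Reg P,
      -- the value `ζ(φ)` does not depend on the extension of `φ`, and `φ` has exactly one right
      -- `K`-invariant extension, so that `L_φ` is well defined
      (∀ h : H, Extends φ.1 h → zetaReg 0 h = zetaOn 0 φ) ∧
      (∃! Φ : H, RightInvariant K Φ ∧ Extends φ.1 Φ) ∧
      zetaOn 0 φ = polylogOn K (squareOp φ) (1 / 2)) ∧
    (∀ ψ : Reg Q,
      -- the same for `ζ^±(ψ)` and the right `L`-invariant extension of `ψ`
      (∀ h : H, Extends ψ.1 h →
        zetaReg (Real.pi * Complex.I) h = zetaOn (Real.pi * Complex.I) ψ ∧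
        zetaReg (-(Real.pi * Complex.I)) h = zetaOn (-(Real.pi * Complex.I)) ψ) ∧
      (∃! Ψ : H, RightInvariant L Ψ ∧ Extends ψ.1 Ψ) ∧
      -- `ρ` and `ρ⁻¹` are boundary points of the unit disc: the value of `L_{∇ψ}` there is its
      -- limit
      Filter.Tendsto (polylogOn L (nablaOp ψ)) (nhdsWithin rho Omega)
        (nhds (zetaOn (Real.pi * Complex.I) ψ)) ∧
      Filter.Tendsto (polylogOn L (nablaOp ψ)) (nhdsWithin rho⁻¹ Omega)
        (nhds (zetaOn (-(Real.pi * Complex.I)) ψ))) := by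
  constructor
  · intro φ
    -- Two unrelated extensions h and k are allowed on the two sides: this gives the independence of
    -- the extension and the identity at once.
    have key : ∀ h : H, Extends φ.1 h → ∀ k : H, Extends φ.1 k →
        zetaReg 0 h = polylog (1 / 2) (twist sigmaMat k) := by
      intro h hh k hk
      rw [← twist_eq_of_extends mem_P_iff hh hk, ← polylog_half_twist]
      rfl
    have hφ := Classical.choose_spec φ.2
    refine ⟨fun h hh => ?_, existsUnique_invariant symDivisible_sigma mem_P_iff φ, ?_⟩
    · rw [zetaOn, key h hh _ hh, key _ hφ _ hh]
    · have e := polylogOn_eq symDivisible_sigma mem_P_iff (χ := squareOp φ) (fun s hs => by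
        have hp : Gam.act sigmaMat s = s := s.2
        refine congrArg φ.1 (Subtype.ext ?_)
        change (s : Gam) ^ 2 = s * Gam.act sigmaMat s
        rw [hp, pow_two]) hφ (1 / 2)
      exact (key _ hφ _ hφ).trans e.symm
  · intro ψ
    have hψ := Classical.choose_spec ψ.2
    have key : ∀ h : H, Extends ψ.1 h → ∀ z,
        polylogOn L (nablaOp ψ) z = polylog z (twist tauMat h) := fun h hh z =>
      polylogOn_eq symDivisible_tau mem_Q_iff (χ := nablaOp ψ) (fun _ _ => rfl) hh z
    have h1 : ∀ h : H, Extends ψ.1 h → Filter.Tendsto (polylogOn L (nablaOp ψ))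
        (nhdsWithin rho Omega) (nhds (zetaReg (Real.pi * Complex.I) h)) := fun h hh =>
      (tendsto_polylog_rho h).congr fun z => (key h hh z).symm
    have h2 : ∀ h : H, Extends ψ.1 h → Filter.Tendsto (polylogOn L (nablaOp ψ))
        (nhdsWithin rho⁻¹ Omega) (nhds (zetaReg (-(Real.pi * Complex.I)) h)) := fun h hh =>
      (tendsto_polylog_inv_rho h).congr fun z => (key h hh z).symm
    -- One function has ζ^±(h) as its limit for every extension h of ψ; since `Omega` accumulates at
    -- ρ and ρ⁻¹, uniqueness of limits gives independence of h.
    have := isCorner_rho.1.neBot_Omega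
    have := isCorner_inv_rho.neBot_Omega
    exact ⟨fun h hh => ⟨tendsto_nhds_unique (h1 h hh) (h1 _ hψ),
      tendsto_nhds_unique (h2 h hh) (h2 _ hψ)⟩,
      existsUnique_invariant symDivisible_tau mem_Q_iff ψ, h1 _ hψ, h2 _ hψ⟩
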